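/- For $\nu\in\mathbb C$ and real $z\ge 1$ let $P_\nu(z)$ be the Legendre function of the first kind, i.e. the analytic continuation to $[1,\infty)$ of ${}_2F_1(-\nu,\nu+1;1;\tfrac{1-z}{2})$, equivalently $$P_\nu(z)=\frac1\pi\int_0^\pi\bigl(z+\sqrt{z^2-1}\,\cos\varphi\bigr)^\nu\,d\varphi .$$ The Buschman--Erdélyi operator of zero order smoothness is $$({}_1S^\nu_{0+}f)(x)=\frac{d}{dx}\int_0^x P_\nu\!\left(\frac xt\right)f(t)\,dt,\qquad x>0 .$$ We say that ${}_1S^\nu_{0+}f$ is defined if the integral converges absolutely for every $x>0$ and is, as a function of $x$, differentiable at almost every $x>0$. Let $Mf(s)=\int_0^\infty x^{s-1}f(x)\,dx$ be the Mellin transform, and put $$m(s)=\frac{\Gamma\left(-\frac s2+\frac\nu2+1\right)\Gamma\left(-\frac s2-\frac\nu2+\frac12\right)}{\Gamma\left(\frac12-\frac s2\right)\Gamma\left(1-\frac s2\right)},$$ where $1/\Gamma$ is taken to be $0$ at the poles of $\Gamma$. **Theorem.** 1. Let $\nu,s\in\mathbb C$ with $\operatorname{Re}s<\min(2+\operatorname{Re}\nu,\,1-\operatorname{Re}\nu)$.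 For every $f:(0,\infty)\to\mathbb C$ whose Mellin integral converges absolutely at $s$, ${}_1S^\nu_{0+}f$ is defined, its Mellin integral converges absolutely at $s$, and $$M[{}_1S^\nu_{0+}f](s)=m(s)\,Mf(s).$$ 2. For real $\nu$ regard ${}_1S^\nu_{0+}$ as an operator in the complex space $L_2(0,\infty)$ with its natural domain $D_\nu=\{f\in L_2(0,\infty):\ {}_1S^\nu_{0+}f\text{ is defined and lies in }L_2(0,\infty)\}$, and let $\|{}_1S^\nu_{0+}\|=\sup\{\|{}_1S^\nu_{0+}f\|_{L_2}: f\in D_\nu,\ \|f\|_{L_2}\le1\}\in[0,\infty]$. Then $D_\nu$ is dense in $L_2(0,\infty)$ for every real $\nu$, and $D_\nu=L_2(0,\infty)$ if $-\frac32<\nu<\frac12$. The norm $\|{}_1S^\nu_{0+}\|$ is periodic in $\nu\in\mathbb R$ with period $2$, and for every real $\nu$ not of the form $2k+\frac12$, $k\in\mathbb Z$, $$\|{}_1S^\nu_{0+}\|=\frac1{\min\left(1,\sqrt{1-\sin\pi\nu}\right)} .$$ 3. For real $\nu$, the operator ${}_1S^\nu_{0+}$ is bounded in $L_2(0,\infty)$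 (on its dense domain $D_\nu$, so that it extends uniquely to a bounded operator on $L_2(0,\infty)$) if $\nu\ne 2k+\frac12$ for all $k\in\mathbb Z$, and it is unbounded if $\nu=2k+\frac12$ for some $k\in\mathbb Z$. -/

import Mathlib

open MeasureTheory Set
open scoped ENNReal

noncomputable section

namespace BuschmanErdelyi

/-- The Legendre function of the first kind `P_ν(z)` for real `z ≥ 1` and complex degree `ν`, by
Laplace's integral `P_ν(z) = (1/π) ∫_0^π (z + √(z² - 1) cos φ)^ν dφ`. This is the analytic
continuation to `[1, ∞)` of `₂F₁(-ν, ν + 1; 1; (1 - z)/2)`; the base of the power is positive. -/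
def legendreP (ν : ℂ) (z : ℝ) : ℂ :=
  (1 / (Real.pi : ℂ)) *
    ∫ φ in (0 : ℝ)..Real.pi, ((z + Real.sqrt (z ^ 2 - 1) * Real.cos φ : ℝ) : ℂ) ^ ν

/-- The function `x ↦ ∫_0^x P_ν(x/t) f(t) dt`. -/
def primitive (ν : ℂ) (f : ℝ → ℂ) (x : ℝ) : ℂ :=
  ∫ t in Ioo 0 x, legendreP ν (x / t) * f t

/-- The Buschman–Erdélyi operator of zero order smoothness,
`(S f)(x) = d/dx ∫_0^x P_ν(x/t) f(t) dt`. -/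
def opS (ν : ℂ) (f : ℝ → ℂ) (x : ℝ) : ℂ :=
  deriv (primitive ν f) x

/-- The formula defining `S f` makes sense: the integral converges absolutely for every `x > 0`
and is differentiable at almost every `x > 0`. -/
structure Admissible (ν : ℂ) (f : ℝ → ℂ) : Prop where
  integrableOn : ∀ x : ℝ, 0 < x → IntegrableOn (fun t => legendreP ν (x / t) * f t) (Ioo 0 x)
  differentiableAt : ∀ᵐ x ∂(volume.restrict (Ioi (0 : ℝ))), DifferentiableAt ℝ (primitive ν f) x

/-- The multiplier `m(s)`. In the half plane `Re s < min (2 + Re ν) (1 - Re ν)` the only pole of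
the four Gamma factors is that of `Γ(1/2 - s/2)` at `s = 1`, where the value here is the
correct limit `0`. -/
def multiplier (ν s : ℂ) : ℂ :=
  Complex.Gamma (-s / 2 + ν / 2 + 1) * Complex.Gamma (-s / 2 - ν / 2 + 1 / 2) /
    (Complex.Gamma (1 / 2 - s / 2) * Complex.Gamma (1 - s / 2))

/-- The complex Hilbert space `L₂(0, ∞)`. -/
abbrev L2 : Type := Lp ℂ 2 (volume.restrict (Ioi (0 : ℝ)))

theorem primitive_congr (ν : ℂ) {f g : ℝ → ℂ} (h : f =ᵐ[volume.restrict (Ioi (0 : ℝ))] g) :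
    primitive ν f = primitive ν g := by
  funext x
  unfold primitive
  refine integral_congr_ae ?_
  have h' := ae_restrict_of_ae_restrict_of_subset (Ioo_subset_Ioi_self : Ioo (0 : ℝ) x ⊆ Ioi 0) h
  filter_upwards [h'] with t ht
  rw [ht]

theorem Admissible.congr {ν : ℂ} {f g : ℝ → ℂ} (hf : Admissible ν f)
    (h : f =ᵐ[volume.restrict (Ioi (0 : ℝ))] g) : Admissible ν g := by
  refine ⟨fun x hx => ?_, ?_⟩
  · refine (hf.integrableOn x hx).congr ?_
    have h' := ae_restrict_of_ae_restrict_of_subset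
      (Ioo_subset_Ioi_self : Ioo (0 : ℝ) x ⊆ Ioi 0) h
    filter_upwards [h'] with t ht
    rw [ht]
  · rw [← primitive_congr ν h]
    exact hf.differentiableAt

theorem opS_congr (ν : ℂ) {f g : ℝ → ℂ} (h : f =ᵐ[volume.restrict (Ioi (0 : ℝ))] g) :
    opS ν f = opS ν g := by
  unfold opS
  rw [primitive_congr ν h]

theorem primitive_add {ν : ℂ} {f g : ℝ → ℂ} (hf : Admissible ν f) (hg : Admissible ν g) :
    primitive ν (f + g) = primitive ν f + primitive ν g := by
  funext x
  rcases le_or_gt x 0 with hx | hx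
  · simp [primitive, Ioo_eq_empty (not_lt.mpr hx)]
  · simp only [primitive, Pi.add_apply, mul_add]
    exact integral_add (hf.integrableOn x hx) (hg.integrableOn x hx)

theorem primitive_smul (ν c : ℂ) (f : ℝ → ℂ) : primitive ν (c • f) = c • primitive ν f := by
  funext x
  simp only [primitive, Pi.smul_apply, smul_eq_mul, ← integral_const_mul]
  congr 1
  funext t
  ring

theorem Admissible.add {ν : ℂ} {f g : ℝ → ℂ} (hf : Admissible ν f) (hg : Admissible ν g) :
    Admissible ν (f + g) := by
  refine ⟨fun x hx => ?_, ?_⟩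
  · simp only [Pi.add_apply, mul_add]
    exact (hf.integrableOn x hx).add (hg.integrableOn x hx)
  · rw [primitive_add hf hg]
    filter_upwards [hf.differentiableAt, hg.differentiableAt] with x h1 h2
    exact h1.add h2

theorem Admissible.smul {ν : ℂ} {f : ℝ → ℂ} (c : ℂ) (hf : Admissible ν f) :
    Admissible ν (c • f) := by
  refine ⟨fun x hx => ?_, ?_⟩
  · have h := (hf.integrableOn x hx).const_mul c
    refine h.congr (Filter.Eventually.of_forall fun t => ?_)
    simp only [Pi.smul_apply, smul_eq_mul]
    ring
  · rw [primitive_smul]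
    filter_upwards [hf.differentiableAt] with x h1
    exact h1.const_smul c

theorem Admissible.zero (ν : ℂ) : Admissible ν 0 := by
  have h : primitive ν 0 = fun _ => 0 := by
    funext x
    simp [primitive]
  refine ⟨fun x _ => by simp, ?_⟩
  rw [h]
  exact Filter.Eventually.of_forall fun x => differentiableAt_const _

theorem opS_add_ae {ν : ℂ} {f g : ℝ → ℂ} (hf : Admissible ν f) (hg : Admissible ν g) :
    opS ν (f + g) =ᵐ[volume.restrict (Ioi (0 : ℝ))] opS ν f + opS ν g := by
  filter_upwards [hf.differentiableAt, hg.differentiableAt] with x h1 h2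
  simp only [opS, primitive_add hf hg, Pi.add_apply]
  exact deriv_add h1 h2

theorem opS_smul_ae {ν : ℂ} {f : ℝ → ℂ} (c : ℂ) (hf : Admissible ν f) :
    opS ν (c • f) =ᵐ[volume.restrict (Ioi (0 : ℝ))] c • opS ν f := by
  filter_upwards [hf.differentiableAt] with x h1
  simp only [opS, primitive_smul, Pi.smul_apply]
  exact deriv_const_smul c h1

/-- The natural domain of `S` in `L₂(0, ∞)`: all `f` in `L₂` for which `S f` is defined by its
formula and lies in `L₂`. -/
def domainS (ν : ℂ) : Submodule ℂ L2 where
  carrier := {f | Admissible ν f ∧ MemLp (opS ν f) 2 (volume.restrict (Ioi (0 : ℝ)))}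
  zero_mem' := by
    have h0 : (0 : ℝ → ℂ) =ᵐ[volume.restrict (Ioi (0 : ℝ))] (0 : L2) := (Lp.coeFn_zero _ _ _).symm
    refine ⟨(Admissible.zero ν).congr h0, ?_⟩
    rw [← opS_congr ν h0]
    have h : opS ν 0 = 0 := by
      have h1 : primitive ν 0 = fun _ => 0 := by
        funext x
        simp [primitive]
      funext x
      simp [opS, h1]
    rw [h]
    exact MemLp.zero
  add_mem' := by
    rintro f g ⟨hf, hf2⟩ ⟨hg, hg2⟩
    have h0 := (Lp.coeFn_add f g).symm
    refine ⟨(hf.add hg).congr h0, ?_⟩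
    rw [← opS_congr ν h0]
    exact (memLp_congr_ae (opS_add_ae hf hg)).mpr (hf2.add hg2)
  smul_mem' := by
    rintro c f ⟨hf, hf2⟩
    have h0 := (Lp.coeFn_smul c f).symm
    refine ⟨(hf.smul c).congr h0, ?_⟩
    rw [← opS_congr ν h0]
    exact (memLp_congr_ae (opS_smul_ae c hf)).mpr (hf2.const_smul c)

/-- The operator `S` in `L₂(0, ∞)` with its natural domain. -/
def opL2 (ν : ℂ) : L2 →ₗ.[ℂ] L2 where
  domain := domainS ν
  toFun :=
    { toFun := fun f => f.2.2.toLp (opS ν (f : L2))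
      map_add' := by
        intro f g
        rw [← MemLp.toLp_add f.2.2 g.2.2]
        refine MemLp.toLp_congr _ _ ?_
        have h := opS_congr ν (Lp.coeFn_add (f : L2) (g : L2))
        rw [Submodule.coe_add, h]
        exact opS_add_ae f.2.1 g.2.1
      map_smul' := by
        intro c f
        rw [RingHom.id_apply, ← MemLp.toLp_const_smul c f.2.2]
        refine MemLp.toLp_congr _ _ ?_
        have h := opS_congr ν (Lp.coeFn_smul c (f : L2))
        rw [Submodule.coe_smul, h]
        exact opS_smul_ae c f.2.1 }

/-- The operator is bounded on its domain. -/
def IsBoundedOp (T : L2 →ₗ.[ℂ] L2) : Prop :=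
  ∃ C : ℝ, ∀ f : T.domain, ‖T f‖ ≤ C * ‖f‖

/-- The operator norm `sup {‖T f‖ : f in the domain, ‖f‖ ≤ 1}`, possibly infinite. -/
def opNorm (T : L2 →ₗ.[ℂ] L2) : ℝ≥0∞ :=
  ⨆ f : T.domain, ⨆ _ : ‖f‖ ≤ 1, ‖T f‖ₑ

end BuschmanErdelyi

end

/-!
For `y > 1` let `Q_ν = P_ν'`. The derivative of `x ↦ ∫_0^x P_ν(x/t) f(t) dt` is
`f(x) + ∫_0^x Q_ν(x/t) f(t) dt/t` at almost every `x`, by Fubini's theorem, as soon as `t^(-c) f(t)`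
is integrable near zero and `P_ν(y) = O(y^c)` (`IsDiffKernel.ae_hasDerivAt`). So `S` is a
multiplicative convolution operator, and its Mellin multiplier is `1 + ∫_1^∞ y^(s-1) Q_ν(y) dy`,
which equals `(1 - s) ∫_1^∞ y^(s-2) P_ν(y) dy`. The last integral reduces to beta integrals when
`P_ν` is written as a Mehler integral; the duplication formula gives `multiplier ν s`
(`integral_cpow_mul_legendreP`, `mellin_opS`).

On the line `Re s = 1/2` the reflection formula gives
`|m(1/2 + iτ)|² = cosh πτ / (cosh πτ - sin πν)` (`norm_sq_multiplier`). For `-3/2 < ν < 1/2` this line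
lies in the half plane of convergence, `S` is everywhere defined on `L₂`, and by Plancherel's theorem
for the Mellin transform its norm is the supremum of `|m|` on the line.

For other degrees the Mellin transform of `P_ν` no longer converges on the line, and the natural
domain is a proper subspace. The assertion `NormCriterion ν`, that `S_ν` is bounded by `C` on its
domain if and only if `|m| ≤ C` on the line, and that functions vanishing near zero suffice to see
this, is carried from `ν - 2` to `ν` for `ν > 1/2`. Let
`(W g)(x) = g(x) - (2ν - 1) x^(-ν) ∫_0^x t^(ν-1) g(t) dt`, whose multiplier `(s - 1 + ν)/(s - ν)` is
unimodular on the line, so that `W` is an isometry with dense range. The contiguity relation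
`y (P_ν' - P_{ν-2}') = ν P_ν + (ν - 1) P_{ν-2}` implies two facts.

* If `f` is in the domain for `ν`, then `W S_ν f = S_{ν-2} f` (`mem_domainS_sub_two`). Thus upper bounds
  for `S_{ν-2}` are upper bounds for `S_ν`. The integrability of `t^(-ν) f(t)` near zero that is needed
  here follows from the absolute convergence of the defining integral, because `P_ν(y) ≥ y^ν / 2`.
* If `h` vanishes near zero, then `S_ν W h = S_{ν-2} h` (`opA_step_mem_dom0`). Thus the domain for `ν`
  is dense and lower bounds for `S_{ν-2}` are lower bounds for `S_ν`.

At `ν = 1/2` the multiplier has a pole at `τ = 0`. There `S B` is a convolution operator for the Hardy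
operator `B` with multiplier `(s - 1/2)/(s - 1)`, which compensates the pole (`opA_half_mem_dom0`), and a
bound for `S` would be a bound for `m` away from the pole. Degrees `ν ≤ -3/2` reduce to these by
`P_ν = P_{-1-ν}`. Since the criterion depends on `ν` only through `sin πν`, the norm is periodic, and
`lineBound_iff` computes the supremum of the multiplier.
-/

namespace BuschmanErdelyi

open Filter Topology

/-! ### Laplace's integral and the three-term recurrence -/

/-- The base `z + √(z² - 1) cos φ` of the power in Laplace's integral. -/
noncomputable def lapBase (z φ : ℝ) : ℝ := z + Real.sqrt (z ^ 2 - 1) * Real.cos φ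

theorem continuous_lapBase : Continuous fun p : ℝ × ℝ => lapBase p.1 p.2 := by
  unfold lapBase; fun_prop

theorem continuous_lapBase_right (z : ℝ) : Continuous (lapBase z) := by
  unfold lapBase; fun_prop

theorem sqrt_sq_sub_one_lt {z : ℝ} (hz : 1 ≤ z) : Real.sqrt (z ^ 2 - 1) < z := by
  rw [Real.sqrt_lt' (by linarith)]; linarith

theorem lapBase_pos {z : ℝ} (hz : 1 ≤ z) (φ : ℝ) : 0 < lapBase z φ := by
  have h1 := sqrt_sq_sub_one_lt hz
  have h2 := Real.sqrt_nonneg (z ^ 2 - 1)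
  have h3 := Real.neg_one_le_cos φ
  unfold lapBase; nlinarith

theorem sq_sqrt_mul_sin {z : ℝ} (hz : 1 ≤ z) (φ : ℝ) :
    (z ^ 2 - 1) * Real.sin φ ^ 2 = 2 * z * lapBase z φ - lapBase z φ ^ 2 - 1 := by
  have h1 : Real.sqrt (z ^ 2 - 1) ^ 2 = z ^ 2 - 1 := Real.sq_sqrt (by nlinarith)
  have h2 := Real.sin_sq_add_cos_sq φ
  unfold lapBase
  linear_combination (z ^ 2 - 1) * h2 + Real.cos φ ^ 2 * h1

/-- A Cauchy–Schwarz estimate: the base dominates the sine. -/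
theorem abs_sin_le_lapBase {z : ℝ} (hz : 1 ≤ z) (φ : ℝ) : |Real.sin φ| ≤ lapBase z φ := by
  refine abs_le_of_sq_le_sq ?_ (lapBase_pos hz φ).le
  have h1 : Real.sqrt (z ^ 2 - 1) ^ 2 = z ^ 2 - 1 := Real.sq_sqrt (by nlinarith)
  have h2 := Real.sin_sq_add_cos_sq φ
  unfold lapBase
  nlinarith [sq_nonneg (Real.sqrt (z ^ 2 - 1) + z * Real.cos φ)]

theorem hasDerivAt_ofReal_cpow_comp {f : ℝ → ℝ} {f' x : ℝ} (hf : HasDerivAt f f' x)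
    (hx : 0 < f x) (c : ℂ) :
    HasDerivAt (fun y => (f y : ℂ) ^ c) (c * (f x : ℂ) ^ (c - 1) * f') x := by
  have h1 : HasDerivAt (fun w : ℂ => w ^ c) (c * (f x : ℂ) ^ (c - 1)) (f x : ℂ) := by
    simpa using! (hasDerivAt_id (f x : ℂ)).cpow_const (c := c)
      (Complex.ofReal_mem_slitPlane.mpr hx)
  exact h1.comp x hf.ofReal_comp

theorem legendreP_eq (ν : ℂ) (z : ℝ) :
    legendreP ν z = (1 / (Real.pi : ℂ)) * ∫ φ in (0 : ℝ)..Real.pi, (lapBase z φ : ℂ) ^ ν := rfl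

theorem continuous_lapBase_cpow (ν : ℂ) {z : ℝ} (hz : 1 ≤ z) :
    Continuous fun φ => (lapBase z φ : ℂ) ^ ν := by
  have h := continuous_lapBase_right z
  refine Continuous.cpow (by fun_prop) continuous_const fun φ => ?_
  exact Complex.ofReal_mem_slitPlane.mpr (lapBase_pos hz φ)

theorem continuousOn_legendreP (ν : ℂ) : ContinuousOn (legendreP ν) (Ici 1) := by
  have h : Continuous fun z : ℝ => legendreP ν (max 1 z) := by
    simp only [legendreP_eq]
    refine continuous_const.mul
      (intervalIntegral.continuous_parametric_intervalIntegral_of_continuous' ?_ _ _)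
    have h2 : Continuous fun p : ℝ × ℝ => lapBase (max 1 p.1) p.2 :=
      continuous_lapBase.comp (by fun_prop : Continuous fun p : ℝ × ℝ => (max 1 p.1, p.2))
    refine Continuous.cpow (by fun_prop) continuous_const fun p => ?_
    exact Complex.ofReal_mem_slitPlane.mpr (lapBase_pos (le_max_left _ _) _)
  refine h.continuousOn.congr fun z hz => ?_
  simp [max_eq_right (mem_Ici.mp hz)]

theorem legendreP_one (ν : ℂ) : legendreP ν 1 = 1 := by
  have : ∀ φ, lapBase 1 φ = 1 := fun φ => by simp [lapBase]
  simp [legendreP_eq, this, Real.pi_ne_zero]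

theorem hasDerivAt_lapBase (z φ : ℝ) :
    HasDerivAt (lapBase z) (-(Real.sqrt (z ^ 2 - 1) * Real.sin φ)) φ := by
  have := ((Real.hasDerivAt_cos φ).const_mul (Real.sqrt (z ^ 2 - 1))).const_add z
  refine this.congr_deriv (by ring)

theorem cpow_sub_one_mul {r : ℝ} (hr : 0 < r) (ν : ℂ) :
    (r : ℂ) ^ ν = (r : ℂ) ^ (ν - 1) * r := by
  have : (r : ℂ) ≠ 0 := by exact_mod_cast hr.ne'
  rw [Complex.cpow_sub _ _ this, Complex.cpow_one]; field_simp

/-- The three-term recurrence of the Legendre functions; it is the integral over `[0, π]` of the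
derivative of `(z + √(z² - 1) cos φ)^(ν - 1) sin φ`. -/
theorem legendreP_recurrence (ν : ℂ) {z : ℝ} (hz : 1 < z) :
    ν * legendreP ν z - (2 * ν - 1) * z * legendreP (ν - 1) z + (ν - 1) * legendreP (ν - 2) z
      = 0 := by
  have hz' := hz.le
  set R : ℝ := Real.sqrt (z ^ 2 - 1) with hR
  have hder : ∀ φ ∈ uIcc 0 Real.pi, HasDerivAt
      (fun φ : ℝ => (R : ℂ) * ((lapBase z φ : ℂ) ^ (ν - 1) * (Real.sin φ : ℂ)))
      (ν * (lapBase z φ : ℂ) ^ ν - (2 * ν - 1) * z * (lapBase z φ : ℂ) ^ (ν - 1)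
        + (ν - 1) * (lapBase z φ : ℂ) ^ (ν - 2)) φ := by
    intro φ _
    have hr := lapBase_pos hz' φ
    have h2 := hasDerivAt_ofReal_cpow_comp (hasDerivAt_lapBase z φ) hr (ν - 1)
    have h3 : HasDerivAt (fun φ : ℝ => (Real.sin φ : ℂ)) _ φ := (Real.hasDerivAt_sin φ).ofReal_comp
    convert! (h2.mul h3).const_mul (R : ℂ) using 1
    have e1 := cpow_sub_one_mul hr ν
    have e2 := cpow_sub_one_mul hr (ν - 1)
    rw [show ν - 1 - 1 = ν - 2 by ring] at e2 ⊢
    have e3 : ((z ^ 2 - 1) * Real.sin φ ^ 2 : ℂ)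
        = 2 * z * lapBase z φ - lapBase z φ ^ 2 - 1 := by
      exact_mod_cast sq_sqrt_mul_sin hz' φ
    have e4 : ((R : ℝ) : ℂ) ^ 2 = (z : ℂ) ^ 2 - 1 := by
      have : R ^ 2 = z ^ 2 - 1 := Real.sq_sqrt (by nlinarith)
      exact_mod_cast this
    have e5 : (R : ℂ) * Real.cos φ = lapBase z φ - z := by
      simp [lapBase, hR]
    rw [e1, e2]
    push_cast
    push_cast at e3 e5
    set L := (lapBase z φ : ℂ)
    set X := L ^ (ν - 2)
    linear_combination ((ν - 1) * X) * e3 - X * L * e5 +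
      ((ν - 1) * X * (Complex.sin φ) ^ 2) * e4
  have c0 := (continuous_lapBase_cpow ν hz').intervalIntegrable (μ := volume) 0 Real.pi
  have c1 := (continuous_lapBase_cpow (ν - 1) hz').intervalIntegrable (μ := volume) 0 Real.pi
  have c2 := (continuous_lapBase_cpow (ν - 2) hz').intervalIntegrable (μ := volume) 0 Real.pi
  have h := intervalIntegral.integral_eq_sub_of_hasDerivAt hder
    (((c0.const_mul _).sub (c1.const_mul _)).add (c2.const_mul _))
  rw [intervalIntegral.integral_add ((c0.const_mul _).sub (c1.const_mul _)) (c2.const_mul _),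
    intervalIntegral.integral_sub (c0.const_mul _) (c1.const_mul _)] at h
  simp only [intervalIntegral.integral_const_mul, Real.sin_pi, Real.sin_zero, Complex.ofReal_zero,
    mul_zero, sub_zero] at h
  simp only [legendreP_eq]
  linear_combination (1 / (Real.pi : ℂ)) * h

/-! ### The derivative of the Legendre function -/

/-- The derivative of `P_ν` on `(1, ∞)`, `P_ν'(z) = ν (z P_ν(z) - P_{ν-1}(z)) / (z² - 1)`. -/
noncomputable def legendreQ (ν : ℂ) (z : ℝ) : ℂ :=
  ν * (z * legendreP ν z - legendreP (ν - 1) z) / ((z ^ 2 - 1 : ℝ) : ℂ)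

theorem sq_sub_one_ne_zero {z : ℝ} (hz : 1 < z) : ((z ^ 2 - 1 : ℝ) : ℂ) ≠ 0 := by
  have : z ^ 2 - 1 ≠ 0 := by nlinarith
  exact_mod_cast this

theorem continuousOn_legendreQ (ν : ℂ) : ContinuousOn (legendreQ ν) (Ioi 1) := by
  have h1 := (continuousOn_legendreP ν).mono Ioi_subset_Ici_self
  have h2 := (continuousOn_legendreP (ν - 1)).mono Ioi_subset_Ici_self
  unfold legendreQ
  refine ContinuousOn.div ?_ (by fun_prop) fun z hz => sq_sub_one_ne_zero hz
  exact continuousOn_const.mul ((Complex.continuous_ofReal.continuousOn.mul h1).sub h2)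

theorem hasDerivAt_legendreP (ν : ℂ) {z : ℝ} (hz : 1 < z) :
    HasDerivAt (legendreP ν) (legendreQ ν z) z := by
  -- the derivative of the integrand in `z`
  let D : ℝ → ℝ → ℂ := fun y φ => ν * (lapBase y φ : ℂ) ^ (ν - 1) *
    ((1 + y / Real.sqrt (y ^ 2 - 1) * Real.cos φ : ℝ) : ℂ)
  have hder : ∀ y, 1 < y → ∀ φ, HasDerivAt (fun y => (lapBase y φ : ℂ) ^ ν) (D y φ) y := by
    intro y hy φ
    have hpos : y ^ 2 - 1 ≠ 0 := by nlinarith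
    have h1 : HasDerivAt (fun y => lapBase y φ)
        (1 + y / Real.sqrt (y ^ 2 - 1) * Real.cos φ) y := by
      have h0 : HasDerivAt (fun y : ℝ => y ^ 2 - 1) (2 * y) y := by
        simpa using (hasDerivAt_pow 2 y).sub_const 1
      have := (hasDerivAt_id y).add ((h0.sqrt hpos).mul_const (Real.cos φ))
      convert! this using 1
      field_simp
    exact hasDerivAt_ofReal_cpow_comp h1 (lapBase_pos hy.le φ) ν
  have hDc : ContinuousOn (fun p : ℝ × ℝ => D p.1 p.2) (Ioi 1 ×ˢ univ) := by
    have hb : ContinuousOn (fun p : ℝ × ℝ => (lapBase p.1 p.2 : ℂ)) (Ioi 1 ×ˢ univ) :=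
      (Complex.continuous_ofReal.comp continuous_lapBase).continuousOn
    refine (continuousOn_const.mul (hb.cpow_const fun p hp => ?_)).mul ?_
    · exact Complex.ofReal_mem_slitPlane.mpr (lapBase_pos (le_of_lt hp.1) _)
    · refine Complex.continuous_ofReal.comp_continuousOn ?_
      refine continuousOn_const.add (ContinuousOn.mul (ContinuousOn.div (by fun_prop) ?_ ?_) ?_)
      · exact (Real.continuous_sqrt.comp (by fun_prop)).continuousOn
      · intro p hp
        have : (1 : ℝ) < p.1 := hp.1
        exact (Real.sqrt_pos.mpr (by nlinarith)).ne'
      · exact (Real.continuous_cos.comp continuous_snd).continuousOn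
  obtain ⟨a, ha1, haz⟩ := exists_between hz
  have hK : IsCompact (Icc a (z + 1) ×ˢ Icc 0 Real.pi) := isCompact_Icc.prod isCompact_Icc
  have hsub : Icc a (z + 1) ×ˢ Icc 0 Real.pi ⊆ Ioi (1 : ℝ) ×ˢ (univ : Set ℝ) := by
    rintro p ⟨hp, -⟩
    exact ⟨lt_of_lt_of_le ha1 hp.1, trivial⟩
  obtain ⟨M, hM⟩ := hK.exists_bound_of_continuousOn (hDc.mono hsub)
  have hslice : Continuous (D z) := by
    have hc : Continuous fun φ : ℝ => ((z, φ) : ℝ × ℝ) := by fun_prop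
    exact hDc.comp_continuous hc fun φ => ⟨hz, trivial⟩
  have key := intervalIntegral.hasDerivAt_integral_of_dominated_loc_of_deriv_le (μ := volume)
    (a := 0) (b := Real.pi)
    (F := fun y φ => (lapBase y φ : ℂ) ^ ν) (F' := D) (x₀ := z) (s := Icc a (z + 1))
    (bound := fun _ => M) (Icc_mem_nhds haz (by linarith))
    (by
      filter_upwards [lt_mem_nhds hz] with y hy
      exact (continuous_lapBase_cpow ν (le_of_lt hy)).aestronglyMeasurable)
    ((continuous_lapBase_cpow ν hz.le).intervalIntegrable _ _)
    hslice.aestronglyMeasurable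
    (by
      refine Eventually.of_forall fun φ hφ y hy => hM (y, φ) ⟨hy, ?_⟩
      rw [uIoc_of_le Real.pi_pos.le] at hφ
      exact Ioc_subset_Icc_self hφ)
    (by simp)
    (Eventually.of_forall fun φ _ y hy => hder y (lt_of_lt_of_le ha1 hy.1) φ)
  refine (key.2.const_mul (1 / (Real.pi : ℂ))).congr_deriv ?_
  have hR2 : Real.sqrt (z ^ 2 - 1) ^ 2 = z ^ 2 - 1 := Real.sq_sqrt (by nlinarith)
  have hR0 : Real.sqrt (z ^ 2 - 1) ≠ 0 := (Real.sqrt_pos.mpr (by nlinarith)).ne'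
  have hne := sq_sub_one_ne_zero hz
  have hD : ∀ φ, D z φ = ν / ((z ^ 2 - 1 : ℝ) : ℂ) *
      (z * (lapBase z φ : ℂ) ^ ν - (lapBase z φ : ℂ) ^ (ν - 1)) := by
    intro φ
    have hr := lapBase_pos hz.le φ
    have e1 : (z ^ 2 - 1) * (1 + z / Real.sqrt (z ^ 2 - 1) * Real.cos φ) = z * lapBase z φ - 1 := by
      unfold lapBase
      set R := Real.sqrt (z ^ 2 - 1)
      field_simp
      linear_combination (-(z * Real.cos φ)) * hR2
    have e2 : ((z ^ 2 - 1 : ℝ) : ℂ) * ((1 + z / Real.sqrt (z ^ 2 - 1) * Real.cos φ : ℝ) : ℂ)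
        = z * lapBase z φ - 1 := by exact_mod_cast e1
    rw [cpow_sub_one_mul hr ν]
    simp only [D]
    rw [div_mul_eq_mul_div ν, eq_div_iff hne]
    linear_combination (ν * (lapBase z φ : ℂ) ^ (ν - 1)) * e2
  have c0 := (continuous_lapBase_cpow ν hz.le).intervalIntegrable (μ := volume) 0 Real.pi
  have c1 := (continuous_lapBase_cpow (ν - 1) hz.le).intervalIntegrable (μ := volume) 0 Real.pi
  simp only [hD, intervalIntegral.integral_const_mul]
  rw [intervalIntegral.integral_sub (c0.const_mul _) c1, intervalIntegral.integral_const_mul]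
  simp only [legendreQ, legendreP_eq]
  ring

/-- The contiguity relation `z P_ν' - ν P_ν = P_{ν-1}'`. -/
theorem legendreQ_sub_one (ν : ℂ) {z : ℝ} (hz : 1 < z) :
    legendreQ (ν - 1) z = z * legendreQ ν z - ν * legendreP ν z := by
  have h := legendreP_recurrence ν hz
  have hne := sq_sub_one_ne_zero hz
  unfold legendreQ
  rw [show ν - 1 - 1 = ν - 2 by ring]
  field_simp
  push_cast
  linear_combination -h

/-- The contiguity relation `P_{ν-1}' = z P_{ν-2}' + (ν - 1) P_{ν-2}`. -/
theorem legendreQ_sub_one' (ν : ℂ) {z : ℝ} (hz : 1 < z) :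
    legendreQ (ν - 1) z = z * legendreQ (ν - 2) z + (ν - 1) * legendreP (ν - 2) z := by
  have h := legendreP_recurrence (ν - 1) hz
  have hne := sq_sub_one_ne_zero hz
  rw [show ν - 1 - 1 = ν - 2 by ring, show ν - 1 - 2 = ν - 3 by ring] at h
  unfold legendreQ
  rw [show ν - 1 - 1 = ν - 2 by ring, show ν - 2 - 1 = ν - 3 by ring]
  field_simp
  push_cast
  linear_combination z * h

/-! ### Size of the Legendre function -/

/-- The Legendre function of real degree, as a real number. It dominates the Legendre functions
whose degree has real part `a`. -/
noncomputable def legendreR (a z : ℝ) : ℝ :=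
  (1 / Real.pi) * ∫ φ in (0 : ℝ)..Real.pi, lapBase z φ ^ a

theorem continuous_lapBase_rpow (a : ℝ) {z : ℝ} (hz : 1 ≤ z) :
    Continuous fun φ => lapBase z φ ^ a :=
  (continuous_lapBase_right z).rpow_const fun φ => Or.inl (lapBase_pos hz φ).ne'

theorem norm_lapBase_cpow (ν : ℂ) {z : ℝ} (hz : 1 ≤ z) (φ : ℝ) :
    ‖(lapBase z φ : ℂ) ^ ν‖ = lapBase z φ ^ ν.re :=
  Complex.norm_cpow_eq_rpow_re_of_pos (lapBase_pos hz φ) ν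

theorem norm_legendreP_le (ν : ℂ) {z : ℝ} (hz : 1 ≤ z) :
    ‖legendreP ν z‖ ≤ legendreR ν.re z := by
  rw [legendreP_eq, legendreR, norm_mul]
  have hpi := Real.pi_pos
  have h1 : ‖(1 / (Real.pi : ℂ))‖ = 1 / Real.pi := by
    rw [norm_div, norm_one, Complex.norm_real, Real.norm_of_nonneg hpi.le]
  rw [h1]
  refine mul_le_mul_of_nonneg_left ?_ (by positivity)
  refine (intervalIntegral.norm_integral_le_integral_norm hpi.le).trans_eq ?_
  simp only [norm_lapBase_cpow ν hz]

theorem legendreP_ofReal (a : ℝ) {z : ℝ} (hz : 1 ≤ z) :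
    legendreP (a : ℂ) z = (legendreR a z : ℂ) := by
  rw [legendreP_eq, legendreR]
  push_cast
  rw [← intervalIntegral.integral_ofReal]
  simp only [Complex.ofReal_cpow (lapBase_pos hz _).le]

theorem legendreR_pos (a : ℝ) {z : ℝ} (hz : 1 ≤ z) : 0 < legendreR a z := by
  have hpi := Real.pi_pos
  refine mul_pos (by positivity) ?_
  exact intervalIntegral.intervalIntegral_pos_of_pos
    ((continuous_lapBase_rpow a hz).intervalIntegrable _ _)
    (fun φ => Real.rpow_pos_of_pos (lapBase_pos hz φ) _) hpi

theorem legendreR_le {a z : ℝ} (ha : 0 ≤ a) (hz : 1 ≤ z) : legendreR a z ≤ (2 * z) ^ a := by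
  have hpi := Real.pi_pos
  have h : ∫ φ in (0 : ℝ)..Real.pi, lapBase z φ ^ a ≤ ∫ _φ in (0 : ℝ)..Real.pi, (2 * z) ^ a := by
    refine intervalIntegral.integral_mono_on hpi.le
      ((continuous_lapBase_rpow a hz).intervalIntegrable _ _) (by simp) fun φ _ => ?_
    refine Real.rpow_le_rpow (lapBase_pos hz φ).le ?_ ha
    have h1 := sqrt_sq_sub_one_lt hz
    have h2 := Real.sqrt_nonneg (z ^ 2 - 1)
    have h3 := Real.cos_le_one φ
    unfold lapBase; nlinarith
  rw [intervalIntegral.integral_const, smul_eq_mul, sub_zero] at h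
  calc legendreR a z ≤ (1 / Real.pi) * (Real.pi * (2 * z) ^ a) :=
        mul_le_mul_of_nonneg_left h (by positivity)
    _ = _ := by field_simp

theorem le_legendreR {a z : ℝ} (ha : 0 ≤ a) (hz : 1 ≤ z) : z ^ a / 2 ≤ legendreR a z := by
  have hpi := Real.pi_pos
  have hc := continuous_lapBase_rpow a hz
  have h : ∫ _φ in (0 : ℝ)..(Real.pi / 2), z ^ a ≤
      ∫ φ in (0 : ℝ)..(Real.pi / 2), lapBase z φ ^ a := by
    refine intervalIntegral.integral_mono_on (by positivity) (by simp)
      (hc.intervalIntegrable _ _) fun φ hφ => ?_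
    refine Real.rpow_le_rpow (by linarith) ?_ ha
    have h2 := Real.sqrt_nonneg (z ^ 2 - 1)
    have h3 := Real.cos_nonneg_of_mem_Icc (x := φ) ⟨by linarith [hφ.1], hφ.2⟩
    have := mul_nonneg h2 h3
    unfold lapBase; linarith
  have h' : 0 ≤ ∫ φ in (Real.pi / 2)..Real.pi, lapBase z φ ^ a :=
    intervalIntegral.integral_nonneg (by linarith) fun φ _ =>
      (Real.rpow_pos_of_pos (lapBase_pos hz φ) _).le
  rw [intervalIntegral.integral_const, smul_eq_mul, sub_zero] at h
  have h3 := intervalIntegral.integral_add_adjacent_intervals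
    (hc.intervalIntegrable (μ := volume) 0 (Real.pi / 2))
    (hc.intervalIntegrable (μ := volume) (Real.pi / 2) Real.pi)
  calc z ^ a / 2 = (1 / Real.pi) * (Real.pi / 2 * z ^ a) := by field_simp
    _ ≤ legendreR a z := by
      refine mul_le_mul_of_nonneg_left ?_ (by positivity)
      linarith

/-- The derivative of `P_ν` is bounded by a multiple of `P_{Re ν}(z) / z`. -/
theorem exists_norm_legendreQ_le (ν : ℂ) :
    ∃ C : ℝ, 0 ≤ C ∧ ∀ z, 1 < z → ‖legendreQ ν z‖ ≤ C * (legendreR ν.re z / z) := by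
  refine ⟨‖ν‖ * (1 + ‖ν - 1‖), by positivity, fun z hz => ?_⟩
  have hpi := Real.pi_pos
  have hz' := hz.le
  -- `(z P_ν - P_{ν-1}) / (z² - 1) = (P_ν + (ν - 1) J) / z` with the nonsingular integral `J`
  set J : ℂ := (1 / (Real.pi : ℂ)) *
    ∫ φ in (0 : ℝ)..Real.pi, (lapBase z φ : ℂ) ^ (ν - 2) * (Real.sin φ : ℂ) ^ 2 with hJ
  have hne := sq_sub_one_ne_zero hz
  have hJ1 : ((z ^ 2 - 1 : ℝ) : ℂ) * J =
      2 * z * legendreP (ν - 1) z - legendreP ν z - legendreP (ν - 2) z := by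
    have c0 := (continuous_lapBase_cpow ν hz').intervalIntegrable (μ := volume) 0 Real.pi
    have c1 := (continuous_lapBase_cpow (ν - 1) hz').intervalIntegrable (μ := volume) 0 Real.pi
    have c2 := (continuous_lapBase_cpow (ν - 2) hz').intervalIntegrable (μ := volume) 0 Real.pi
    have e : ∀ φ, ((z ^ 2 - 1 : ℝ) : ℂ) * ((lapBase z φ : ℂ) ^ (ν - 2) * (Real.sin φ : ℂ) ^ 2) =
        2 * z * (lapBase z φ : ℂ) ^ (ν - 1) - (lapBase z φ : ℂ) ^ ν
          - (lapBase z φ : ℂ) ^ (ν - 2) := by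
      intro φ
      have hr := lapBase_pos hz' φ
      have e1 := cpow_sub_one_mul hr ν
      have e2 := cpow_sub_one_mul hr (ν - 1)
      rw [show ν - 1 - 1 = ν - 2 by ring] at e2
      have e3 : ((z ^ 2 - 1) * Real.sin φ ^ 2 : ℂ)
          = 2 * z * lapBase z φ - lapBase z φ ^ 2 - 1 := by
        exact_mod_cast sq_sqrt_mul_sin hz' φ
      rw [e1, e2]
      push_cast at e3 ⊢
      linear_combination ((lapBase z φ : ℂ) ^ (ν - 2)) * e3
    have h := congrArg (fun F : ℝ → ℂ => ∫ φ in (0 : ℝ)..Real.pi, F φ) (funext e)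
    rw [intervalIntegral.integral_sub ((c1.const_mul _).sub c0) c2,
      intervalIntegral.integral_sub (c1.const_mul _) c0,
      intervalIntegral.integral_const_mul, intervalIntegral.integral_const_mul] at h
    simp only [legendreP_eq, hJ]
    linear_combination (1 / (Real.pi : ℂ)) * h
  have hz0 : (z : ℂ) ≠ 0 := by exact_mod_cast (by linarith : z ≠ 0)
  have hQ : legendreQ ν z = ν * (legendreP ν z + (ν - 1) * J) / z := by
    have h := legendreP_recurrence ν hz
    unfold legendreQ
    rw [div_eq_div_iff hne hz0]
    push_cast at hJ1 ⊢
    linear_combination -(ν * (ν - 1)) * hJ1 + ν * h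
  have hJ2 : ‖J‖ ≤ legendreR ν.re z := by
    rw [hJ, legendreR, norm_mul]
    have h1 : ‖(1 / (Real.pi : ℂ))‖ = 1 / Real.pi := by
      rw [norm_div, norm_one, Complex.norm_real, Real.norm_of_nonneg hpi.le]
    rw [h1]
    refine mul_le_mul_of_nonneg_left ?_ (by positivity)
    refine intervalIntegral.norm_integral_le_of_norm_le hpi.le
      (Eventually.of_forall fun φ _ => ?_)
      ((continuous_lapBase_rpow _ hz').intervalIntegrable _ _)
    have hr := lapBase_pos hz' φ
    rw [norm_mul, norm_lapBase_cpow _ hz', norm_pow, Complex.norm_real, Real.norm_eq_abs]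
    have h2 := abs_sin_le_lapBase hz' φ
    calc lapBase z φ ^ (ν - 2).re * |Real.sin φ| ^ 2
        ≤ lapBase z φ ^ (ν - 2).re * lapBase z φ ^ 2 := by
          gcongr
      _ = lapBase z φ ^ ν.re := by
          rw [← Real.rpow_natCast, ← Real.rpow_add hr]; simp
  rw [hQ, norm_div, norm_mul, Complex.norm_real, Real.norm_of_nonneg (by linarith : 0 ≤ z),
    mul_assoc, mul_div_assoc]
  refine mul_le_mul_of_nonneg_left ?_ (norm_nonneg _)
  rw [← mul_div_assoc]
  refine div_le_div_of_nonneg_right ?_ (by linarith)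
  calc ‖legendreP ν z + (ν - 1) * J‖ ≤ ‖legendreP ν z‖ + ‖ν - 1‖ * ‖J‖ := by
        rw [← norm_mul]; exact norm_add_le _ _
    _ ≤ legendreR ν.re z + ‖ν - 1‖ * legendreR ν.re z := by
        gcongr
        exact norm_legendreP_le ν hz'
    _ = _ := by ring

/-! ### Mehler's integral and the symmetry of the degree -/

/-- The range of the base `z + √(z² - 1) cos φ` for `0 < φ < π`. -/
def mehlerSet (z : ℝ) : Set ℝ := {r | 0 < r ∧ r ^ 2 + 1 < 2 * z * r}

theorem image_lapBase {z : ℝ} (hz : 1 < z) : lapBase z '' Ioo 0 Real.pi = mehlerSet z := by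
  have hR : 0 < Real.sqrt (z ^ 2 - 1) := Real.sqrt_pos.mpr (by nlinarith)
  have hR2 : Real.sqrt (z ^ 2 - 1) ^ 2 = z ^ 2 - 1 := Real.sq_sqrt (by nlinarith)
  ext r
  constructor
  · rintro ⟨φ, hφ, rfl⟩
    refine ⟨lapBase_pos hz.le φ, ?_⟩
    have h := sq_sqrt_mul_sin hz.le φ
    have h2 := Real.sin_pos_of_mem_Ioo hφ
    have h3 : 0 < (z ^ 2 - 1) * Real.sin φ ^ 2 := by
      rw [← hR2]; positivity
    linarith
  · rintro ⟨hr, h⟩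
    have h1 : (r - z) ^ 2 < Real.sqrt (z ^ 2 - 1) ^ 2 := by rw [hR2]; nlinarith
    obtain ⟨h2, h3⟩ := abs_lt.mp (abs_lt_of_sq_lt_sq h1 hR.le)
    have h4 : -1 < (r - z) / Real.sqrt (z ^ 2 - 1) := by rw [lt_div_iff₀ hR]; linarith
    have h5 : (r - z) / Real.sqrt (z ^ 2 - 1) < 1 := by rw [div_lt_iff₀ hR]; linarith
    refine ⟨Real.arccos ((r - z) / Real.sqrt (z ^ 2 - 1)), ⟨Real.arccos_pos.mpr h5, ?_⟩, ?_⟩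
    · exact lt_of_le_of_ne (Real.arccos_le_pi _) fun h => by
        rw [Real.arccos_eq_pi] at h; linarith
    · rw [lapBase, Real.cos_arccos h4.le h5.le]; field_simp; ring

theorem measurableSet_mehlerSet (z : ℝ) : MeasurableSet (mehlerSet z) :=
  (measurableSet_lt measurable_const measurable_id).inter
    (measurableSet_lt (f := fun r : ℝ => r ^ 2 + 1) (g := fun r => 2 * z * r)
      (by fun_prop) (by fun_prop))

theorem injOn_lapBase {z : ℝ} (hz : 1 < z) : InjOn (lapBase z) (Ioo 0 Real.pi) := by
  have hR : 0 < Real.sqrt (z ^ 2 - 1) := Real.sqrt_pos.mpr (by nlinarith)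
  intro φ hφ ψ hψ h
  have h' : Real.cos φ = Real.cos ψ := by
    unfold lapBase at h
    exact mul_left_cancel₀ hR.ne' (by linarith)
  exact Real.injOn_cos (Ioo_subset_Icc_self hφ) (Ioo_subset_Icc_self hψ) h'

theorem abs_deriv_lapBase {z φ : ℝ} (hz : 1 < z) (hφ : φ ∈ Ioo 0 Real.pi) :
    |-(Real.sqrt (z ^ 2 - 1) * Real.sin φ)| =
      Real.sqrt (2 * z * lapBase z φ - lapBase z φ ^ 2 - 1) := by
  have hs := Real.sin_pos_of_mem_Ioo hφ
  rw [abs_neg, abs_of_nonneg (mul_nonneg (Real.sqrt_nonneg _) hs.le), ← sq_sqrt_mul_sin hz.le,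
    Real.sqrt_mul (by nlinarith), Real.sqrt_sq hs.le]

/-- Mehler's form of the Legendre function: Laplace's integral in the variable
`r = z + √(z² - 1) cos φ`. -/
theorem legendreP_eq_mehler (ν : ℂ) {z : ℝ} (hz : 1 < z) :
    legendreP ν z = (1 / (Real.pi : ℂ)) *
      ∫ r in mehlerSet z, (r : ℂ) ^ ν / (Real.sqrt (2 * z * r - r ^ 2 - 1) : ℂ) := by
  rw [legendreP_eq, intervalIntegral.integral_of_le Real.pi_pos.le, ← image_lapBase hz,
    integral_image_eq_integral_abs_deriv_smul measurableSet_Ioo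
      (fun φ _ => (hasDerivAt_lapBase z φ).hasDerivWithinAt) (injOn_lapBase hz),
    integral_Ioc_eq_integral_Ioo]
  congr 1
  refine setIntegral_congr_fun measurableSet_Ioo fun φ hφ => ?_
  have hR : 0 < Real.sqrt (z ^ 2 - 1) := Real.sqrt_pos.mpr (by nlinarith)
  have hs := Real.sin_pos_of_mem_Ioo hφ
  have h0 : |-(Real.sqrt (z ^ 2 - 1) * Real.sin φ)| ≠ 0 := by
    rw [abs_neg]; positivity
  rw [abs_deriv_lapBase hz hφ] at h0
  simp only [abs_deriv_lapBase hz hφ, Complex.real_smul]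
  have h1 : ((Real.sqrt (2 * z * lapBase z φ - lapBase z φ ^ 2 - 1) : ℝ) : ℂ) ≠ 0 := by
    exact_mod_cast h0
  rw [mul_div_assoc', mul_div_cancel_left₀ _ h1]

theorem image_inv_mehlerSet (z : ℝ) : Inv.inv '' mehlerSet z = mehlerSet z := by
  have h : ∀ r ∈ mehlerSet z, r⁻¹ ∈ mehlerSet z := by
    rintro r ⟨hr, h⟩
    refine ⟨inv_pos.mpr hr, ?_⟩
    have h1 : r⁻¹ ^ 2 + 1 = (r ^ 2 + 1) * r⁻¹ ^ 2 := by field_simp; ring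
    have h2 : 2 * z * r⁻¹ = (2 * z * r) * r⁻¹ ^ 2 := by field_simp
    rw [h1, h2]
    exact mul_lt_mul_of_pos_right h (by positivity)
  ext r
  constructor
  · rintro ⟨q, hq, rfl⟩; exact h q hq
  · exact fun hr => ⟨r⁻¹, h r hr, inv_inv r⟩

theorem ofReal_cpow_eq_exp {r : ℝ} (hr : 0 < r) (c : ℂ) :
    (r : ℂ) ^ c = Complex.exp ((Real.log r : ℂ) * c) := by
  rw [Complex.cpow_def_of_ne_zero (by exact_mod_cast hr.ne'), Complex.ofReal_log hr.le]

/-- The symmetry `P_ν = P_{-1-ν}`, by the substitution `r ↦ 1 / r` in Mehler's integral. -/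
theorem legendreP_symm (ν : ℂ) {z : ℝ} (hz : 1 < z) :
    legendreP (-1 - ν) z = legendreP ν z := by
  rw [legendreP_eq_mehler ν hz, legendreP_eq_mehler _ hz]
  congr 1
  rw [← image_inv_mehlerSet z, integral_image_eq_integral_abs_deriv_smul
    (measurableSet_mehlerSet z) (fun r hr => (hasDerivAt_inv hr.1.ne').hasDerivWithinAt)
    inv_injective.injOn, image_inv_mehlerSet]
  refine setIntegral_congr_fun (measurableSet_mehlerSet z) fun r hr => ?_
  have hr0 := hr.1
  have e1 : |-(r ^ 2)⁻¹| = (r ^ 2)⁻¹ := by rw [abs_neg, abs_of_pos (by positivity)]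
  have e2 : Real.sqrt (2 * z * r⁻¹ - r⁻¹ ^ 2 - 1) =
      Real.sqrt (2 * z * r - r ^ 2 - 1) * r⁻¹ := by
    rw [show 2 * z * r⁻¹ - r⁻¹ ^ 2 - 1 = (2 * z * r - r ^ 2 - 1) * r⁻¹ ^ 2 by field_simp; ring,
      Real.sqrt_mul (by have := hr.2; linarith), Real.sqrt_sq (by positivity)]
  have e3 : ((r⁻¹ : ℝ) : ℂ) ^ (-1 - ν) = (r : ℂ) ^ ν * r := by
    rw [ofReal_cpow_eq_exp (inv_pos.mpr hr0), ofReal_cpow_eq_exp hr0, Real.log_inv]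
    have : (r : ℂ) = Complex.exp (Real.log r : ℂ) := by
      rw [← Complex.ofReal_exp, Real.exp_log hr0]
    rw [show Complex.exp (Real.log r * ν) * (r : ℂ) =
      Complex.exp (Real.log r * ν) * Complex.exp (Real.log r : ℂ) by rw [← this]]
    rw [← Complex.exp_add]
    push_cast; ring_nf
  have h1 : (r : ℂ) ≠ 0 := by exact_mod_cast hr0.ne'
  have h2 : (Real.sqrt (2 * z * r - r ^ 2 - 1) : ℂ) ≠ 0 := by
    have := Real.sqrt_pos.mpr (by have := hr.2; linarith : 0 < 2 * z * r - r ^ 2 - 1)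
    exact_mod_cast this.ne'
  simp only [e1, e2, e3, Complex.real_smul]
  push_cast
  field_simp

/-! ### The Mellin transform of the Legendre function -/

theorem image_div_one_sub : (fun x : ℝ => x / (1 - x)) '' Ioo 0 1 = Ioi 0 := by
  ext t
  constructor
  · rintro ⟨x, ⟨h0, h1⟩, rfl⟩
    exact div_pos h0 (by linarith)
  · intro ht
    have ht' : (0 : ℝ) < t := ht
    refine ⟨t / (1 + t), ⟨by positivity, ?_⟩, ?_⟩
    · rw [div_lt_one (by positivity)]; linarith
    · have : (1 : ℝ) + t ≠ 0 := by positivity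
      simp only
      field_simp
      ring

theorem hasDerivAt_div_one_sub {x : ℝ} (hx : x < 1) :
    HasDerivAt (fun x : ℝ => x / (1 - x)) (((1 - x) ^ 2)⁻¹) x := by
  have h : (1 : ℝ) - x ≠ 0 := by linarith
  refine ((hasDerivAt_id x).div ((hasDerivAt_id x).const_sub 1) h).congr_deriv ?_
  simp only [id]
  field_simp
  ring

theorem injOn_div_one_sub : InjOn (fun x : ℝ => x / (1 - x)) (Ioo 0 1) := by
  rintro x ⟨_, hx⟩ y ⟨_, hy⟩ h
  have h1 : (1 : ℝ) - x ≠ 0 := by linarith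
  have h2 : (1 : ℝ) - y ≠ 0 := by linarith
  simp only at h
  rw [div_eq_div_iff h1 h2] at h
  linarith

theorem beta_integrand_eq (u v : ℂ) {x : ℝ} (hx : x ∈ Ioo (0 : ℝ) 1) :
    |((1 - x) ^ 2)⁻¹| • (((x / (1 - x) : ℝ) : ℂ) ^ (u - 1) *
      ((1 + x / (1 - x) : ℝ) : ℂ) ^ (-(u + v))) = (x : ℂ) ^ (u - 1) * (1 - (x : ℂ)) ^ (v - 1) := by
  obtain ⟨h0, h1⟩ := hx
  have h2 : 0 < 1 - x := by linarith
  have e1 : 1 + x / (1 - x) = (1 - x)⁻¹ := by field_simp; ring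
  have e2 : |((1 - x) ^ 2)⁻¹| = Real.exp (-2 * Real.log (1 - x)) := by
    rw [abs_of_pos (by positivity), ← Real.exp_log (by positivity : 0 < ((1 - x) ^ 2)⁻¹),
      Real.log_inv, Real.log_pow]
    push_cast; ring_nf
  have e3 : (1 - (x : ℂ)) = ((1 - x : ℝ) : ℂ) := by push_cast; ring
  rw [e1, e2, e3, ofReal_cpow_eq_exp (div_pos h0 h2), ofReal_cpow_eq_exp (inv_pos.mpr h2),
    ofReal_cpow_eq_exp h0, ofReal_cpow_eq_exp h2, Real.log_div h0.ne' h2.ne', Real.log_inv,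
    Complex.real_smul, Complex.ofReal_exp, ← Complex.exp_add, ← Complex.exp_add, ← Complex.exp_add]
  congr 1
  push_cast
  ring

theorem integrableOn_beta_Ioi {u v : ℂ} (hu : 0 < u.re) (hv : 0 < v.re) :
    IntegrableOn (fun t : ℝ => (t : ℂ) ^ (u - 1) * ((1 + t : ℝ) : ℂ) ^ (-(u + v))) (Ioi 0) := by
  rw [← image_div_one_sub, integrableOn_image_iff_integrableOn_abs_deriv_smul measurableSet_Ioo
    (fun x hx => (hasDerivAt_div_one_sub hx.2).hasDerivWithinAt) injOn_div_one_sub]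
  have h := Complex.betaIntegral_convergent hu hv
  rw [intervalIntegrable_iff_integrableOn_Ioo_of_le zero_le_one] at h
  exact h.congr_fun (fun x hx => (beta_integrand_eq u v hx).symm) measurableSet_Ioo

/-- Euler's beta integral over the half line. -/
theorem integral_beta_Ioi {u v : ℂ} (hu : 0 < u.re) (hv : 0 < v.re) :
    ∫ t in Ioi (0 : ℝ), (t : ℂ) ^ (u - 1) * ((1 + t : ℝ) : ℂ) ^ (-(u + v)) =
      Complex.Gamma u * Complex.Gamma v / Complex.Gamma (u + v) := by
  rw [← image_div_one_sub, integral_image_eq_integral_abs_deriv_smul measurableSet_Ioo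
    (fun x hx => (hasDerivAt_div_one_sub hx.2).hasDerivWithinAt) injOn_div_one_sub,
    ← Complex.betaIntegral_eq_Gamma_mul_div u v hu hv, Complex.betaIntegral,
    intervalIntegral.integral_of_le zero_le_one, integral_Ioc_eq_integral_Ioo]
  exact setIntegral_congr_fun measurableSet_Ioo fun x hx => beta_integrand_eq u v hx

/-- The lower end `(r + 1/r) / 2` of the range of `z` for which `r` lies in `mehlerSet z`. -/
noncomputable def mehlerBound (r : ℝ) : ℝ := (r ^ 2 + 1) / (2 * r)

theorem mehlerBound_pos {r : ℝ} (hr : 0 < r) : 0 < mehlerBound r := by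
  unfold mehlerBound; positivity

theorem mem_mehlerSet_iff {r z : ℝ} (hr : 0 < r) : r ∈ mehlerSet z ↔ mehlerBound r < z := by
  unfold mehlerSet mehlerBound
  rw [div_lt_iff₀ (by positivity)]
  constructor
  · rintro ⟨_, h⟩; linarith
  · intro h; exact ⟨hr, by linarith⟩

theorem one_lt_of_mem_mehlerSet {r z : ℝ} (h : r ∈ mehlerSet z) : 1 < z := by
  obtain ⟨h0, h1⟩ := h
  by_contra hz
  nlinarith [sq_nonneg (r - 1)]

theorem image_mul_one_add {A : ℝ} (hA : 0 < A) : (fun t : ℝ => A * (1 + t)) '' Ioi 0 = Ioi A := by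
  ext z
  constructor
  · rintro ⟨t, ht, rfl⟩
    have : (0 : ℝ) < t := ht
    show A < A * (1 + t)
    nlinarith
  · intro hz
    have hz' : A < z := hz
    refine ⟨z / A - 1, ?_, by field_simp; ring⟩
    show 0 < z / A - 1
    rw [sub_pos, one_lt_div hA]; exact hz'

theorem hasDerivAt_mul_one_add (A t : ℝ) : HasDerivAt (fun t : ℝ => A * (1 + t)) A t := by
  simpa using ((hasDerivAt_id t).const_add 1).const_mul A

theorem injOn_mul_one_add {A : ℝ} (hA : 0 < A) : InjOn (fun t : ℝ => A * (1 + t)) (Ioi 0) := by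
  intro x _ y _ h
  have := mul_left_cancel₀ hA.ne' h
  linarith

/-- The integrand of the double integral behind the Mellin transform of the Legendre function. -/
noncomputable def mehlerKernel (ν s : ℂ) (z r : ℝ) : ℂ :=
  (z : ℂ) ^ (s - 2) * ((r : ℂ) ^ ν / (Real.sqrt (2 * z * r - r ^ 2 - 1) : ℂ))

theorem mehlerKernel_comp {ν s : ℂ} {r : ℝ} (hr : 0 < r) {t : ℝ} (ht : t ∈ Ioi (0 : ℝ)) :
    |mehlerBound r| • mehlerKernel ν s (mehlerBound r * (1 + t)) r =
      ((r : ℂ) ^ ν * (((2 * r : ℝ) : ℂ) ^ (-(1 / 2) : ℂ) * (mehlerBound r : ℂ) ^ (s - 3 / 2))) *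
        ((t : ℂ) ^ ((1 / 2 : ℂ) - 1) * ((1 + t : ℝ) : ℂ) ^ (-((1 / 2 : ℂ) + (3 / 2 - s)))) := by
  have ht' : (0 : ℝ) < t := ht
  have hA := mehlerBound_pos hr
  set A := mehlerBound r with hAdef
  have e1 : 2 * (A * (1 + t)) * r - r ^ 2 - 1 = 2 * r * A * t := by
    have : 2 * r * A = r ^ 2 + 1 := by rw [hAdef, mehlerBound]; field_simp
    linear_combination this
  have e2 : Real.sqrt (2 * r * A * t) = Real.exp (1 / 2 * Real.log (2 * r * A * t)) := by
    rw [Real.sqrt_eq_rpow, Real.rpow_def_of_pos (by positivity)]; ring_nf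
  have e3 : |A| = Real.exp (Real.log A) := by rw [abs_of_pos hA, Real.exp_log hA]
  unfold mehlerKernel
  rw [e1, e2, e3, Real.log_mul (by positivity) (by positivity), Real.log_mul (by positivity)
    (by positivity), ofReal_cpow_eq_exp (by positivity : 0 < A * (1 + t)), ofReal_cpow_eq_exp hr,
    ofReal_cpow_eq_exp (by positivity : 0 < 2 * r), ofReal_cpow_eq_exp hA,
    ofReal_cpow_eq_exp ht', ofReal_cpow_eq_exp (by positivity : 0 < 1 + t),
    Real.log_mul (by positivity) (by positivity), Complex.real_smul, Complex.ofReal_exp,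
    Complex.ofReal_exp, ← Complex.exp_sub]
  simp only [← Complex.exp_add]
  congr 1
  push_cast
  ring

theorem integrableOn_mehlerKernel (ν : ℂ) {s : ℂ} (hs : s.re < 3 / 2) {r : ℝ} (hr : 0 < r) :
    IntegrableOn (fun z => mehlerKernel ν s z r) (Ioi (mehlerBound r)) := by
  have hA := mehlerBound_pos hr
  rw [← image_mul_one_add hA, integrableOn_image_iff_integrableOn_abs_deriv_smul measurableSet_Ioi
    (fun x _ => (hasDerivAt_mul_one_add _ x).hasDerivWithinAt) (injOn_mul_one_add hA)]
  have h := (integrableOn_beta_Ioi (u := 1 / 2) (v := 3 / 2 - s) (by simp)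
    (by simpa using hs)).const_mul
    ((r : ℂ) ^ ν * (((2 * r : ℝ) : ℂ) ^ (-(1 / 2) : ℂ) * (mehlerBound r : ℂ) ^ (s - 3 / 2)))
  exact IntegrableOn.congr_fun h (fun t ht => (mehlerKernel_comp hr ht).symm) measurableSet_Ioi

theorem two_mul_cpow_mul_mehlerBound_cpow (ν s : ℂ) {r : ℝ} (hr : 0 < r) :
    (r : ℂ) ^ ν * (((2 * r : ℝ) : ℂ) ^ (-(1 / 2) : ℂ) * (mehlerBound r : ℂ) ^ (s - 3 / 2)) =
      (2 : ℂ) ^ (1 - s) *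
        ((r : ℂ) ^ (ν + 2 - s - 1) * ((1 + r ^ 2 : ℝ) : ℂ) ^ (-(3 / 2 - s))) := by
  have h2 : ((2 : ℝ) : ℂ) = 2 := by norm_num
  have e : mehlerBound r = (1 + r ^ 2) / (2 * r) := by unfold mehlerBound; ring
  rw [e, ← h2, ofReal_cpow_eq_exp hr, ofReal_cpow_eq_exp (by positivity),
    ofReal_cpow_eq_exp (by positivity), ofReal_cpow_eq_exp (by positivity), ofReal_cpow_eq_exp hr,
    ofReal_cpow_eq_exp (by positivity), Real.log_div (by positivity) (by positivity),
    Real.log_mul (by positivity) (by positivity)]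
  simp only [← Complex.exp_add]
  congr 1
  push_cast
  ring

theorem integral_mehlerKernel (ν : ℂ) {s : ℂ} (hs : s.re < 3 / 2) {r : ℝ} (hr : 0 < r) :
    ∫ z in Ioi (mehlerBound r), mehlerKernel ν s z r =
      Complex.Gamma (1 / 2) * Complex.Gamma (3 / 2 - s) / Complex.Gamma (2 - s) *
      (2 : ℂ) ^ (1 - s) *
        ((r : ℂ) ^ (ν + 2 - s - 1) * ((1 + r ^ 2 : ℝ) : ℂ) ^ (-(3 / 2 - s))) := by
  have hA := mehlerBound_pos hr
  rw [← image_mul_one_add hA, integral_image_eq_integral_abs_deriv_smul measurableSet_Ioi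
    (fun x _ => (hasDerivAt_mul_one_add _ x).hasDerivWithinAt) (injOn_mul_one_add hA),
    setIntegral_congr_fun measurableSet_Ioi fun t ht => mehlerKernel_comp hr ht,
    integral_const_mul, integral_beta_Ioi (by simp) (by simpa using hs),
    two_mul_cpow_mul_mehlerBound_cpow ν s hr, show (1 / 2 : ℂ) + (3 / 2 - s) = 2 - s by ring]
  ring

theorem mellin_one_add_sq_cpow {w c : ℂ} :
    (fun r : ℝ => (r : ℂ) ^ (w - 1) * ((1 + r ^ 2 : ℝ) : ℂ) ^ c) =
      fun r : ℝ => (r : ℂ) ^ (w - 1) • (fun t : ℝ => ((1 + t : ℝ) : ℂ) ^ c) (r ^ (2 : ℝ)) := by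
  funext r
  simp [smul_eq_mul]

theorem integrableOn_one_add_sq {w c : ℂ} (hw : 0 < w.re) (hc : w.re < 2 * c.re) :
    IntegrableOn (fun r : ℝ => (r : ℂ) ^ (w - 1) * ((1 + r ^ 2 : ℝ) : ℂ) ^ (-c)) (Ioi 0) := by
  rw [mellin_one_add_sq_cpow]
  refine (MellinConvergent.comp_rpow (f := fun t : ℝ => ((1 + t : ℝ) : ℂ) ^ (-c)) (s := w)
    two_ne_zero).mpr ?_
  have h := integrableOn_beta_Ioi (u := w / 2) (v := c - w / 2) (by simpa using hw)
    (by simp; linarith)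
  rw [show w / 2 + (c - w / 2) = c by ring] at h
  simpa [MellinConvergent] using h

theorem integral_one_add_sq {w c : ℂ} (hw : 0 < w.re) (hc : w.re < 2 * c.re) :
    ∫ r in Ioi (0 : ℝ), (r : ℂ) ^ (w - 1) * ((1 + r ^ 2 : ℝ) : ℂ) ^ (-c) =
      1 / 2 * (Complex.Gamma (w / 2) * Complex.Gamma (c - w / 2) / Complex.Gamma c) := by
  have h := integral_beta_Ioi (u := w / 2) (v := c - w / 2) (by simpa using hw)
    (by simp; linarith)
  rw [show w / 2 + (c - w / 2) = c by ring] at h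
  have h2 := mellin_comp_rpow (fun t : ℝ => ((1 + t : ℝ) : ℂ) ^ (-c)) w 2
  rw [mellin_one_add_sq_cpow, ← h]
  refine h2.trans ?_
  simp [mellin]

/-- The set of pairs `(z, r)` with `r` in `mehlerSet z`. -/
def mehlerRegion : Set (ℝ × ℝ) := {p | p.2 ∈ mehlerSet p.1}

theorem measurableSet_mehlerRegion : MeasurableSet mehlerRegion :=
  (measurableSet_lt (f := fun _ : ℝ × ℝ => (0 : ℝ)) (g := fun p => p.2) (by fun_prop)
    (by fun_prop)).inter
    (measurableSet_lt (f := fun p : ℝ × ℝ => p.2 ^ 2 + 1) (g := fun p => 2 * p.1 * p.2)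
      (by fun_prop) (by fun_prop))

theorem measurable_mehlerKernel (ν s : ℂ) :
    Measurable fun p : ℝ × ℝ => mehlerKernel ν s p.1 p.2 := by
  unfold mehlerKernel
  fun_prop

theorem norm_mehlerKernel (ν s : ℂ) {z r : ℝ} (h : r ∈ mehlerSet z) :
    (‖mehlerKernel ν s z r‖ : ℂ) = mehlerKernel (ν.re : ℂ) (s.re : ℂ) z r := by
  have hz : 0 < z := by linarith [one_lt_of_mem_mehlerSet h]
  have hr := h.1
  unfold mehlerKernel
  rw [norm_mul, norm_div, Complex.norm_cpow_eq_rpow_re_of_pos hz,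
    Complex.norm_cpow_eq_rpow_re_of_pos hr, Complex.norm_real,
    Real.norm_of_nonneg (Real.sqrt_nonneg _)]
  push_cast
  rw [Complex.ofReal_cpow hz.le, Complex.ofReal_cpow hr.le]
  simp

theorem indicator_mehlerRegion (ν s : ℂ) {r : ℝ} (hr : 0 < r) :
    (fun z => mehlerRegion.indicator (fun p : ℝ × ℝ => mehlerKernel ν s p.1 p.2) (z, r)) =
      (Ioi (mehlerBound r)).indicator fun z => mehlerKernel ν s z r := by
  funext z
  by_cases h : mehlerBound r < z
  · rw [indicator_of_mem (show (z, r) ∈ mehlerRegion from (mem_mehlerSet_iff hr).mpr h),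
      indicator_of_mem (show z ∈ Ioi _ from h)]
  · rw [indicator_of_notMem (show (z, r) ∉ mehlerRegion from fun h' =>
      h ((mem_mehlerSet_iff hr).mp h')), indicator_of_notMem (show z ∉ Ioi _ from h)]

theorem indicator_mehlerRegion_of_nonpos (ν s : ℂ) {r : ℝ} (hr : ¬ 0 < r) :
    (fun z => mehlerRegion.indicator (fun p : ℝ × ℝ => mehlerKernel ν s p.1 p.2) (z, r)) = 0 := by
  funext z
  exact indicator_of_notMem (show (z, r) ∉ mehlerRegion from fun h => hr h.1) _

theorem re_lt_of_lt_min {a σ : ℝ} (h : σ < min (2 + a) (1 - a)) : σ < 3 / 2 := by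
  have := lt_min_iff.mp h; linarith

theorem integral_indicator_mehlerRegion (ν : ℂ) {s : ℂ} (hs : s.re < 3 / 2) :
    (fun r => ∫ z, mehlerRegion.indicator (fun p : ℝ × ℝ => mehlerKernel ν s p.1 p.2) (z, r)) =
      (Ioi 0).indicator fun r : ℝ =>
        Complex.Gamma (1 / 2) * Complex.Gamma (3 / 2 - s) / Complex.Gamma (2 - s) *
        (2 : ℂ) ^ (1 - s) *
          ((r : ℂ) ^ (ν + 2 - s - 1) * ((1 + r ^ 2 : ℝ) : ℂ) ^ (-(3 / 2 - s))) := by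
  funext r
  by_cases hr : 0 < r
  · rw [indicator_mehlerRegion ν s hr, integral_indicator measurableSet_Ioi,
      integral_mehlerKernel ν hs hr, indicator_of_mem (show r ∈ Ioi 0 from hr)]
  · rw [indicator_mehlerRegion_of_nonpos ν s hr, indicator_of_notMem (show r ∉ Ioi 0 from hr)]
    simp

/-- Absolute convergence of the double integral, which justifies the change of order of integration
in the Mellin transform of Mehler's integral. -/
theorem integrable_mehlerRegion (ν : ℂ) {s : ℂ} (hs : s.re < min (2 + ν.re) (1 - ν.re)) :
    Integrable (mehlerRegion.indicator fun p : ℝ × ℝ => mehlerKernel ν s p.1 p.2) := by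
  have hs' := re_lt_of_lt_min hs
  obtain ⟨h1, h2⟩ := lt_min_iff.mp hs
  have hm := ((measurable_mehlerKernel ν s).indicator
    measurableSet_mehlerRegion).aestronglyMeasurable (μ := (volume : Measure (ℝ × ℝ)))
  refine (integrable_prod_iff' hm).mpr ⟨Eventually.of_forall fun r => ?_, ?_⟩
  · by_cases hr : 0 < r
    · rw [indicator_mehlerRegion ν s hr]
      exact (integrableOn_mehlerKernel ν hs' hr).integrable_indicator measurableSet_Ioi
    · rw [indicator_mehlerRegion_of_nonpos ν s hr]
      exact integrable_zero _ _ _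
  · have hre : ((s.re : ℂ)).re < 3 / 2 := by simpa using hs'
    have h := integral_indicator_mehlerRegion (ν.re : ℂ) hre
    have hI := (integrable_indicator_iff measurableSet_Ioi).mpr
      ((integrableOn_one_add_sq (w := (ν.re : ℂ) + 2 - s.re) (c := 3 / 2 - (s.re : ℂ))
      (by simp; linarith) (by simp; linarith)).const_mul (Complex.Gamma (1 / 2) *
        Complex.Gamma (3 / 2 - (s.re : ℂ)) / Complex.Gamma (2 - (s.re : ℂ)) *
        (2 : ℂ) ^ (1 - (s.re : ℂ))))
    rw [← h] at hI
    refine hI.re.congr (Eventually.of_forall fun r => ?_)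
    have e : (fun z => mehlerRegion.indicator
        (fun p : ℝ × ℝ => mehlerKernel (ν.re : ℂ) (s.re : ℂ) p.1 p.2) (z, r)) = fun z =>
        ((‖mehlerRegion.indicator (fun p : ℝ × ℝ => mehlerKernel ν s p.1 p.2) (z, r)‖ : ℝ) : ℂ) := by
      funext z
      by_cases hz : (z, r) ∈ mehlerRegion
      · rw [indicator_of_mem hz, indicator_of_mem hz, norm_mehlerKernel ν s hz]
      · rw [indicator_of_notMem hz, indicator_of_notMem hz]; simp
    simp only [e]
    rw [integral_complex_ofReal]
    exact Complex.ofReal_re _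

theorem integral_indicator_mehlerRegion_left (ν s : ℂ) :
    (fun z => ∫ r, mehlerRegion.indicator (fun p : ℝ × ℝ => mehlerKernel ν s p.1 p.2) (z, r)) =
      (Ioi 1).indicator fun z : ℝ => (Real.pi : ℂ) * ((z : ℂ) ^ (s - 2) * legendreP ν z) := by
  funext z
  have e : (fun r => mehlerRegion.indicator (fun p : ℝ × ℝ => mehlerKernel ν s p.1 p.2) (z, r)) =
      (mehlerSet z).indicator fun r => mehlerKernel ν s z r := by
    funext r
    by_cases h : r ∈ mehlerSet z
    · rw [indicator_of_mem (show (z, r) ∈ mehlerRegion from h), indicator_of_mem h]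
    · rw [indicator_of_notMem (show (z, r) ∉ mehlerRegion from h), indicator_of_notMem h]
  rw [e, integral_indicator (measurableSet_mehlerSet z)]
  by_cases hz : 1 < z
  · rw [indicator_of_mem (show z ∈ Ioi 1 from hz), legendreP_eq_mehler ν hz]
    simp only [mehlerKernel]
    rw [integral_const_mul]
    have : (Real.pi : ℂ) ≠ 0 := by exact_mod_cast Real.pi_ne_zero
    field_simp
  · rw [indicator_of_notMem (show z ∉ Ioi 1 from hz)]
    have : mehlerSet z = ∅ := eq_empty_of_forall_notMem fun r hr => hz (one_lt_of_mem_mehlerSet hr)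
    simp [this]

theorem integrableOn_cpow_mul_legendreP (ν : ℂ) {s : ℂ}
    (hs : s.re < min (2 + ν.re) (1 - ν.re)) :
    IntegrableOn (fun z : ℝ => (z : ℂ) ^ (s - 2) * legendreP ν z) (Ioi 1) := by
  have h := (integrable_mehlerRegion ν hs).integral_prod_left
  rw [integral_indicator_mehlerRegion_left, integrable_indicator_iff measurableSet_Ioi] at h
  refine (IntegrableOn.congr_fun (h.const_mul (1 / (Real.pi : ℂ))) (fun z _ => ?_)
    measurableSet_Ioi)
  have : (Real.pi : ℂ) ≠ 0 := by exact_mod_cast Real.pi_ne_zero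
  field_simp

theorem integrableOn_rpow_mul_legendreR {a σ : ℝ} (hs : σ < min (2 + a) (1 - a)) :
    IntegrableOn (fun z : ℝ => z ^ (σ - 2) * legendreR a z) (Ioi 1) := by
  refine IntegrableOn.congr_fun (integrableOn_cpow_mul_legendreP (a : ℂ) (s := (σ : ℂ))
    (by simpa using hs)).norm (fun z hz => ?_) measurableSet_Ioi
  have hz' : (1 : ℝ) < z := hz
  rw [legendreP_ofReal a hz'.le, norm_mul, Complex.norm_cpow_eq_rpow_re_of_pos (by linarith),
    Complex.norm_real, Real.norm_of_nonneg (legendreR_pos a hz'.le).le]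
  simp

/-- The Mellin transform of the Legendre function over `(1, ∞)`. -/
theorem integral_cpow_mul_legendreP (ν : ℂ) {s : ℂ}
    (hs : s.re < min (2 + ν.re) (1 - ν.re)) :
    (1 - s) * ∫ z in Ioi (1 : ℝ), (z : ℂ) ^ (s - 2) * legendreP ν z = multiplier ν s := by
  have hs' := re_lt_of_lt_min hs
  obtain ⟨h1, h2⟩ := lt_min_iff.mp hs
  have hpi : (Real.pi : ℂ) ≠ 0 := by exact_mod_cast Real.pi_ne_zero
  have h := integral_integral_swap (f := fun z r => mehlerRegion.indicator
    (fun p : ℝ × ℝ => mehlerKernel ν s p.1 p.2) (z, r)) (integrable_mehlerRegion ν hs)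
  rw [integral_indicator_mehlerRegion_left, integral_indicator_mehlerRegion ν hs',
    integral_indicator measurableSet_Ioi, integral_indicator measurableSet_Ioi,
    integral_const_mul, integral_const_mul,
    integral_one_add_sq (by simp; linarith) (by simp; linarith)] at h
  have hG : Complex.Gamma (3 / 2 - s) ≠ 0 :=
    Complex.Gamma_ne_zero_of_re_pos (by simpa using hs')
  have hG2 : Complex.Gamma (2 - s) ≠ 0 :=
    Complex.Gamma_ne_zero_of_re_pos (by simp; linarith)
  have hG3 : Complex.Gamma (1 - s / 2) ≠ 0 :=
    Complex.Gamma_ne_zero_of_re_pos (by simp; linarith)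
  have hdup := Complex.Gamma_mul_Gamma_add_half (1 - s / 2)
  rw [show 1 - s / 2 + 1 / 2 = 1 / 2 - s / 2 + 1 by ring, show 2 * (1 - s / 2) = 2 - s by ring,
    show 1 - (2 - s) = -1 + s by ring] at hdup
  have e1 : (ν + 2 - s) / 2 = -s / 2 + ν / 2 + 1 := by ring
  have e2 : 3 / 2 - s - (ν + 2 - s) / 2 = -s / 2 - ν / 2 + 1 / 2 := by ring
  rw [e2, e1] at h
  unfold multiplier
  rcases eq_or_ne s 1 with rfl | hs1
  · simp [Complex.Gamma_zero]
  have hs2 : 1 / 2 - s / 2 ≠ 0 := fun h0 => hs1 (by linear_combination (-2) * h0)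
  rw [Complex.Gamma_add_one _ hs2] at hdup
  have hhalf : Complex.Gamma (1 / 2) = (Real.sqrt Real.pi : ℂ) := by
    rw [Complex.Gamma_one_half_eq, Real.sqrt_eq_rpow, Complex.ofReal_cpow Real.pi_pos.le]
    norm_num
  have hsq : (Real.sqrt Real.pi : ℂ) ^ 2 = Real.pi := by
    exact_mod_cast Real.sq_sqrt Real.pi_pos.le
  have hsq0 : (Real.sqrt Real.pi : ℂ) ≠ 0 := by
    exact_mod_cast (Real.sqrt_pos.mpr Real.pi_pos).ne'
  have h20 : (2 : ℂ) ^ (-1 + s) ≠ 0 := by simp [Complex.cpow_eq_zero_iff]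
  have h2p : (2 : ℂ) ^ (1 - s) = ((2 : ℂ) ^ (-1 + s))⁻¹ := by
    rw [← Complex.cpow_neg]; ring_nf
  have hG4 : Complex.Gamma (1 / 2 - s / 2) ≠ 0 := by
    intro h0
    rw [h0] at hdup
    simp [hG2, hsq0, h20] at hdup
  rw [hhalf, h2p] at h
  set I := ∫ z in Ioi (1 : ℝ), (z : ℂ) ^ (s - 2) * legendreP ν z
  set G1 := Complex.Gamma (-s / 2 + ν / 2 + 1)
  set G2 := Complex.Gamma (-s / 2 - ν / 2 + 1 / 2)
  set G3 := Complex.Gamma (3 / 2 - s)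
  set G4 := Complex.Gamma (2 - s)
  set G5 := Complex.Gamma (1 / 2 - s / 2)
  set G6 := Complex.Gamma (1 - s / 2)
  set T := (2 : ℂ) ^ (-1 + s)
  set P := (Real.sqrt Real.pi : ℂ)
  rw [← hsq] at h
  have h' : P * T * G4 * I * 2 = G1 * G2 := by
    field_simp at h
    linear_combination h
  rw [eq_div_iff (mul_ne_zero hG4 hG3), ← h']
  linear_combination 2 * I * hdup

theorem integrableOn_cpow_mul_legendreQ (ν : ℂ) {s : ℂ}
    (hs : s.re < min (2 + ν.re) (1 - ν.re)) :
    IntegrableOn (fun z : ℝ => (z : ℂ) ^ (s - 1) * legendreQ ν z) (Ioi 1) := by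
  obtain ⟨C, hC, hQ⟩ := exists_norm_legendreQ_le ν
  have h := (integrableOn_rpow_mul_legendreR hs).const_mul C
  refine Integrable.mono' h ?_ ?_
  · refine ContinuousOn.aestronglyMeasurable ?_ measurableSet_Ioi
    refine ContinuousOn.mul (fun z hz => ?_) (continuousOn_legendreQ ν)
    have hz' : (1 : ℝ) < z := hz
    exact (Complex.continuousAt_ofReal_cpow_const z _ (Or.inr (by linarith))).continuousWithinAt
  · filter_upwards [ae_restrict_mem measurableSet_Ioi] with z hz
    have hz' : (1 : ℝ) < z := hz
    have hz0 : 0 < z := by linarith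
    rw [norm_mul, Complex.norm_cpow_eq_rpow_re_of_pos hz0]
    calc z ^ (s - 1).re * ‖legendreQ ν z‖ ≤ z ^ (s - 1).re * (C * (legendreR ν.re z / z)) := by
          gcongr
          exact hQ z hz'
      _ = C * (z ^ (s.re - 2) * legendreR ν.re z) := by
          rw [show (s - 1).re = s.re - 2 + 1 by simp; ring, Real.rpow_add_one hz0.ne']
          field_simp

theorem hasDerivAt_cpow_mul_legendreP (ν s : ℂ) {z : ℝ} (hz : 1 < z) :
    HasDerivAt (fun z : ℝ => (z : ℂ) ^ (s - 1) * legendreP ν z)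
      ((s - 1) * ((z : ℂ) ^ (s - 2) * legendreP ν z) + (z : ℂ) ^ (s - 1) * legendreQ ν z) z := by
  have h1 := hasDerivAt_ofReal_cpow_comp (hasDerivAt_id z) (by simp; linarith) (s - 1)
  refine (h1.mul (hasDerivAt_legendreP ν hz)).congr_deriv ?_
  simp only [id]
  rw [show s - 1 - 1 = s - 2 by ring]
  push_cast
  ring

theorem continuousOn_cpow_mul_legendreP (ν s : ℂ) :
    ContinuousOn (fun z : ℝ => (z : ℂ) ^ (s - 1) * legendreP ν z) (Ici 1) := by
  refine ContinuousOn.mul (fun z hz => ?_) (continuousOn_legendreP ν)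
  have hz' : (1 : ℝ) ≤ z := hz
  exact (Complex.continuousAt_ofReal_cpow_const z _ (Or.inr (by linarith))).continuousWithinAt

theorem integrableOn_deriv_cpow_mul_legendreP (ν : ℂ) {s : ℂ}
    (hs : s.re < min (2 + ν.re) (1 - ν.re)) :
    IntegrableOn (fun z : ℝ => (s - 1) * ((z : ℂ) ^ (s - 2) * legendreP ν z) +
      (z : ℂ) ^ (s - 1) * legendreQ ν z) (Ioi 1) :=
  ((integrableOn_cpow_mul_legendreP ν hs).const_mul (s - 1)).add
    (integrableOn_cpow_mul_legendreQ ν hs)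

theorem exists_norm_cpow_mul_legendreP_le (ν : ℂ) {s : ℂ}
    (hs : s.re < min (2 + ν.re) (1 - ν.re)) :
    ∃ C : ℝ, 0 ≤ C ∧ ∀ z : ℝ, 1 ≤ z → ‖(z : ℂ) ^ (s - 1) * legendreP ν z‖ ≤ C := by
  have hI := integrableOn_deriv_cpow_mul_legendreP ν hs
  refine ⟨1 + ∫ z in Ioi (1 : ℝ), ‖(s - 1) * ((z : ℂ) ^ (s - 2) * legendreP ν z) +
      (z : ℂ) ^ (s - 1) * legendreQ ν z‖, by positivity, fun z hz => ?_⟩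
  have hIz : IntervalIntegrable (fun z : ℝ => (s - 1) * ((z : ℂ) ^ (s - 2) * legendreP ν z) +
      (z : ℂ) ^ (s - 1) * legendreQ ν z) volume 1 z := by
    rw [intervalIntegrable_iff_integrableOn_Ioc_of_le hz]
    exact hI.mono_set Ioc_subset_Ioi_self
  have h := intervalIntegral.integral_eq_sub_of_hasDerivAt_of_le hz
    ((continuousOn_cpow_mul_legendreP ν s).mono Icc_subset_Ici_self)
    (fun x hx => hasDerivAt_cpow_mul_legendreP ν s hx.1) hIz
  rw [Complex.ofReal_one, Complex.one_cpow, legendreP_one, one_mul] at h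
  rw [← sub_add_cancel ((z : ℂ) ^ (s - 1) * legendreP ν z) 1, ← h, add_comm]
  refine (norm_add_le _ _).trans ?_
  rw [norm_one]
  gcongr
  rw [intervalIntegral.integral_of_le hz]
  refine (norm_integral_le_integral_norm _).trans ?_
  exact setIntegral_mono_set hI.norm (Eventually.of_forall fun _ => norm_nonneg _)
    Ioc_subset_Ioi_self.eventuallyLE

/-- Growth of the Legendre function: `P_a(z) = O(z^c)` for every `c > max a (-1 - a)`. -/
theorem exists_legendreR_le {a c : ℝ} (h1 : a < c) (h2 : -1 - a < c) :
    ∃ C : ℝ, 0 ≤ C ∧ ∀ z, 1 ≤ z → legendreR a z ≤ C * z ^ c := by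
  obtain ⟨C, hC, h⟩ := exists_norm_cpow_mul_legendreP_le (a : ℂ) (s := ((1 - c : ℝ) : ℂ))
    (by rw [Complex.ofReal_re, Complex.ofReal_re, lt_min_iff]; constructor <;> linarith)
  refine ⟨C, hC, fun z hz => ?_⟩
  have hz0 : 0 < z := by linarith
  have h3 := h z hz
  rw [norm_mul, Complex.norm_cpow_eq_rpow_re_of_pos hz0, legendreP_ofReal a hz, Complex.norm_real,
    Real.norm_of_nonneg (legendreR_pos a hz).le] at h3
  have e : (((1 - c : ℝ) : ℂ) - 1).re = -c := by simp
  rw [e, Real.rpow_neg hz0.le, inv_mul_le_iff₀ (Real.rpow_pos_of_pos hz0 c)] at h3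
  linarith

theorem tendsto_cpow_mul_legendreP (ν : ℂ) {s : ℂ} (hs : s.re < min (2 + ν.re) (1 - ν.re)) :
    Tendsto (fun z : ℝ => (z : ℂ) ^ (s - 1) * legendreP ν z) atTop (𝓝 0) := by
  obtain ⟨σ, hσ1, hσ2⟩ := exists_between hs
  obtain ⟨h1, h2⟩ := lt_min_iff.mp hσ2
  obtain ⟨C, hC, h⟩ := exists_legendreR_le (a := ν.re) (c := 1 - σ) (by linarith) (by linarith)
  have ht : Tendsto (fun z : ℝ => C * z ^ (-(σ - s.re))) atTop (𝓝 0) := by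
    simpa using (tendsto_rpow_neg_atTop (by linarith : 0 < σ - s.re)).const_mul C
  refine squeeze_zero_norm' ?_ ht
  filter_upwards [eventually_ge_atTop 1] with z hz
  have hz0 : 0 < z := by linarith
  rw [norm_mul, Complex.norm_cpow_eq_rpow_re_of_pos hz0]
  calc z ^ (s - 1).re * ‖legendreP ν z‖ ≤ z ^ (s - 1).re * (C * z ^ (1 - σ)) := by
        gcongr
        exact (norm_legendreP_le ν hz).trans (h z hz)
    _ = C * z ^ (-(σ - s.re)) := by
        rw [mul_left_comm, ← Real.rpow_add hz0]
        congr 2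
        simp

/-- The Mellin multiplier of `f ↦ f + ∫_0^x P_ν'(x/t) f(t) dt/t`. -/
theorem one_add_integral_cpow_mul_legendreQ (ν : ℂ) {s : ℂ}
    (hs : s.re < min (2 + ν.re) (1 - ν.re)) :
    1 + ∫ z in Ioi (1 : ℝ), (z : ℂ) ^ (s - 1) * legendreQ ν z = multiplier ν s := by
  have h := integral_Ioi_of_hasDerivAt_of_tendsto
    ((continuousOn_cpow_mul_legendreP ν s) 1 self_mem_Ici)
    (fun x hx => hasDerivAt_cpow_mul_legendreP ν s hx)
    (integrableOn_deriv_cpow_mul_legendreP ν hs) (tendsto_cpow_mul_legendreP ν hs)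
  rw [integral_add ((integrableOn_cpow_mul_legendreP ν hs).const_mul (s - 1))
    (integrableOn_cpow_mul_legendreQ ν hs), integral_const_mul, Complex.ofReal_one,
    Complex.one_cpow, legendreP_one, one_mul] at h
  rw [← integral_cpow_mul_legendreP ν hs]
  linear_combination h

/-! ### Kernel integrals and their derivatives -/

/-- The multiplicative convolution `∫_0^x k(x/t) f(t) dt/t` over `(0, x)`. -/
noncomputable def mconv (k f : ℝ → ℂ) (x : ℝ) : ℂ :=
  ∫ t in Ioo 0 x, k (x / t) * (f t / t)

/-- The integrand of the multiplicative convolution as a function on the plane. -/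
noncomputable def convIntegrand (k f : ℝ → ℂ) : ℝ × ℝ → ℂ :=
  {z | z.2 < z.1}.indicator fun z => k (z.1 / z.2) * (f z.2 / z.2)

theorem convIntegrand_of_lt (k f : ℝ → ℂ) {x t : ℝ} (h : t < x) :
    convIntegrand k f (x, t) = k (x / t) * (f t / t) :=
  indicator_of_mem (show (x, t) ∈ {z : ℝ × ℝ | z.2 < z.1} from h) _

theorem convIntegrand_of_not_lt (k f : ℝ → ℂ) {x t : ℝ} (h : ¬ t < x) :
    convIntegrand k f (x, t) = 0 :=
  indicator_of_notMem (show (x, t) ∉ {z : ℝ × ℝ | z.2 < z.1} from h) _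

theorem aestronglyMeasurable_convIntegrand {k f : ℝ → ℂ} (hk : ContinuousOn k (Ioi 1))
    {A B : Set ℝ} (hA : MeasurableSet A) (hB : MeasurableSet B) (hB0 : B ⊆ Ioi 0)
    (hf : AEStronglyMeasurable f (volume.restrict B)) :
    AEStronglyMeasurable (convIntegrand k f)
      ((volume.restrict A).prod (volume.restrict B)) := by
  have hms : MeasurableSet {z : ℝ × ℝ | z.2 < z.1} :=
    measurableSet_lt measurable_snd measurable_fst
  rw [Measure.prod_restrict]
  have hms2 : MeasurableSet (A ×ˢ B) := hA.prod hB
  rw [convIntegrand, aestronglyMeasurable_indicator_iff hms, Measure.restrict_restrict hms]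
  refine AEStronglyMeasurable.mul ?_ ?_
  · refine ContinuousOn.aestronglyMeasurable (hk.comp ?_ ?_) (hms.inter hms2)
    · exact continuousOn_fst.div continuousOn_snd fun z hz => (hB0 hz.2.2).ne'
    · intro z hz
      have h1 : z.2 < z.1 := hz.1
      exact (one_lt_div (hB0 hz.2.2)).mpr h1
  · have h3 : AEStronglyMeasurable (fun z : ℝ × ℝ => f z.2 / (z.2 : ℂ))
        ((volume.restrict A).prod (volume.restrict B)) := by
      simp only [div_eq_mul_inv]
      exact AEStronglyMeasurable.mul hf.comp_snd
        (by fun_prop : Measurable fun z : ℝ × ℝ => ((z.2 : ℂ))⁻¹).aestronglyMeasurable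
    rw [Measure.prod_restrict] at h3
    exact h3.mono_measure (Measure.restrict_mono inter_subset_right le_rfl)

/-- The integral `∫_0^x p(x/t) f(t) dt`. -/
noncomputable def kernelInt (p f : ℝ → ℂ) (x : ℝ) : ℂ :=
  ∫ t in Ioo 0 x, p (x / t) * f t

/-- A kernel `p` on `[1, ∞)` with `p(1) = 1` and derivative `q`, of growth `O(y^c)` and
`O(y^(c-1))`. -/
structure IsDiffKernel (p q : ℝ → ℂ) (c : ℝ) : Prop where
  continuousOn : ContinuousOn p (Ici 1)
  map_one : p 1 = 1
  hasDerivAt : ∀ y, 1 < y → HasDerivAt p (q y) y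
  continuousOn_deriv : ContinuousOn q (Ioi 1)
  bound : ∃ C : ℝ, 0 ≤ C ∧ ∀ y, 1 ≤ y → ‖p y‖ ≤ C * y ^ c
  bound_deriv : ∃ C : ℝ, 0 ≤ C ∧ ∀ y, 1 < y → ‖q y‖ ≤ C * y ^ (c - 1)

theorem isDiffKernel_legendre {ν : ℂ} {c : ℝ} (h1 : ν.re < c) (h2 : -1 - ν.re < c) :
    IsDiffKernel (legendreP ν) (legendreQ ν) c := by
  obtain ⟨C, hC, hR⟩ := exists_legendreR_le h1 h2
  obtain ⟨D, hD, hQ⟩ := exists_norm_legendreQ_le ν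
  refine ⟨continuousOn_legendreP ν, legendreP_one ν, fun y hy => hasDerivAt_legendreP ν hy,
    continuousOn_legendreQ ν, ⟨C, hC, fun y hy => (norm_legendreP_le ν hy).trans (hR y hy)⟩,
    ⟨D * C, by positivity, fun y hy => (hQ y hy).trans ?_⟩⟩
  have hy0 : 0 < y := by linarith
  rw [mul_assoc, Real.rpow_sub_one hy0.ne', ← mul_div_assoc C]
  refine mul_le_mul_of_nonneg_left (div_le_div_of_nonneg_right (hR y hy.le) hy0.le) hD

/-- `t^(-c) f(t)` is integrable near zero and locally integrable on `(0, ∞)`. -/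
def LocInt (c : ℝ) (f : ℝ → ℂ) : Prop :=
  ∀ X : ℝ, 0 < X → IntegrableOn (fun t : ℝ => ((t ^ (-c) : ℝ) : ℂ) * f t) (Ioo 0 X)

theorem LocInt.eq_mul {c : ℝ} (f : ℝ → ℂ) {t : ℝ} (ht : 0 < t) :
    f t = ((t ^ c : ℝ) : ℂ) * (((t ^ (-c) : ℝ) : ℂ) * f t) := by
  rw [← mul_assoc, ← Complex.ofReal_mul, ← Real.rpow_add ht]
  simp

theorem LocInt.aestronglyMeasurable {c : ℝ} {f : ℝ → ℂ} (hf : LocInt c f) {X : ℝ} (hX : 0 < X) :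
    AEStronglyMeasurable f (volume.restrict (Ioo 0 X)) := by
  have h : AEStronglyMeasurable (fun t : ℝ => ((t ^ c : ℝ) : ℂ) * (((t ^ (-c) : ℝ) : ℂ) * f t))
      (volume.restrict (Ioo 0 X)) :=
    AEStronglyMeasurable.mul (by fun_prop) (hf X hX).1
  refine h.congr ?_
  filter_upwards [ae_restrict_mem measurableSet_Ioo] with t ht
  exact (LocInt.eq_mul f ht.1).symm

theorem LocInt.integrableOn {c : ℝ} {f : ℝ → ℂ} (hf : LocInt c f) {a b : ℝ} (ha : 0 < a) :
    IntegrableOn f (Icc a b) := by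
  rcases lt_or_ge b a with hab | hab
  · simp [Icc_eq_empty (not_le.mpr hab)]
  have h1 := (hf (b + 1) (by linarith)).mono_set
    (fun t ht => ⟨by linarith [ht.1], by linarith [ht.2]⟩ : Icc a b ⊆ Ioo 0 (b + 1))
  have h2 : ContinuousOn (fun t : ℝ => ((t ^ c : ℝ) : ℂ)) (Icc a b) := fun t ht =>
    (Complex.continuous_ofReal.continuousAt.comp
      (Real.continuousAt_rpow_const t c (Or.inl (by linarith [ht.1])))).continuousWithinAt
  refine (h1.continuousOn_mul h2 isCompact_Icc).congr_fun (fun t ht => ?_) measurableSet_Icc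
  exact (LocInt.eq_mul f (by linarith [ht.1])).symm

theorem IsDiffKernel.integrableOn {p q f : ℝ → ℂ} {c : ℝ} (hp : IsDiffKernel p q c)
    (hf : LocInt c f) {x : ℝ} (hx : 0 < x) :
    IntegrableOn (fun t => p (x / t) * f t) (Ioo 0 x) := by
  obtain ⟨C, hC, hpb⟩ := hp.bound
  refine Integrable.mono' (((hf x hx).norm).const_mul (C * x ^ c)) ?_ ?_
  · refine AEStronglyMeasurable.mul ?_ (hf.aestronglyMeasurable hx)
    refine ContinuousOn.aestronglyMeasurable (hp.continuousOn.comp ?_ ?_) measurableSet_Ioo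
    · exact continuousOn_const.div continuousOn_id fun t ht => ht.1.ne'
    · intro t ht
      exact (one_le_div ht.1).mpr ht.2.le
  · filter_upwards [ae_restrict_mem measurableSet_Ioo] with t ht
    have ht0 := ht.1
    rw [norm_mul, norm_mul, Complex.norm_real, Real.norm_of_nonneg (by positivity), ← mul_assoc]
    gcongr
    refine (hpb _ ((one_le_div ht0).mpr ht.2.le)).trans_eq ?_
    rw [Real.div_rpow hx.le ht0.le, Real.rpow_neg ht0.le]
    ring

theorem IsDiffKernel.integrable_prod {p q f : ℝ → ℂ} {c : ℝ} (hp : IsDiffKernel p q c)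
    (hf : LocInt c f) {a x : ℝ} (ha : 0 < a) (hax : a < x) :
    Integrable (convIntegrand q f)
      ((volume.restrict (Ioo a x)).prod (volume.restrict (Ioo 0 x))) := by
  obtain ⟨C, hC, hqb⟩ := hp.bound_deriv
  have hx : 0 < x := ha.trans hax
  have h1 : IntegrableOn (fun y : ℝ => C * y ^ (c - 1)) (Ioo a x) := by
    refine (ContinuousOn.integrableOn_Icc fun y hy => ?_).mono_set Ioo_subset_Icc_self
    exact (continuousAt_const.mul (Real.continuousAt_rpow_const y _
      (Or.inl (by linarith [hy.1])))).continuousWithinAt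
  have h2 := Integrable.mul_prod h1 (hf x hx).norm
  refine Integrable.mono' h2 ?_ ?_
  · exact aestronglyMeasurable_convIntegrand hp.continuousOn_deriv measurableSet_Ioo
      measurableSet_Ioo Ioo_subset_Ioi_self (hf.aestronglyMeasurable hx)
  · rw [Measure.prod_restrict]
    filter_upwards [ae_restrict_mem (measurableSet_Ioo.prod measurableSet_Ioo)] with z hz
    obtain ⟨y, t⟩ := z
    obtain ⟨⟨hy1, hy2⟩, ht1, ht2⟩ := hz
    simp only at hy1 hy2 ht1 ht2 ⊢
    have hy0 : 0 < y := ha.trans hy1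
    by_cases hty : t < y
    · rw [convIntegrand_of_lt _ _ hty]
      rw [norm_mul, norm_div, norm_mul, Complex.norm_real, Complex.norm_real,
        Real.norm_of_nonneg ht1.le, Real.norm_of_nonneg (by positivity)]
      calc ‖q (y / t)‖ * (‖f t‖ / t) ≤ (C * (y / t) ^ (c - 1)) * (‖f t‖ / t) := by
            gcongr
            exact hqb _ ((one_lt_div ht1).mpr hty)
        _ = _ := by
            rw [Real.div_rpow hy0.le ht1.le, Real.rpow_sub_one ht1.ne', Real.rpow_neg ht1.le]
            field_simp
    · rw [convIntegrand_of_not_lt _ _ hty, norm_zero]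
      positivity

theorem setIntegral_indicator_lt (q f : ℝ → ℂ) {x y : ℝ} (hy : y < x) :
    ∫ t in Ioo 0 x, convIntegrand q f (y, t) = mconv q f y := by
  have e : (fun t => convIntegrand q f (y, t)) =
      (Iio y).indicator fun t => q (y / t) * (f t / t) := by
    funext t
    by_cases h : t < y
    · rw [convIntegrand_of_lt _ _ h,
        indicator_of_mem (show t ∈ Iio y from h)]
    · rw [convIntegrand_of_not_lt _ _ h,
        indicator_of_notMem (show t ∉ Iio y from h)]
  rw [e, setIntegral_indicator measurableSet_Iio, mconv, Ioo_inter_Iio, min_eq_right hy.le]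

theorem IsDiffKernel.intervalIntegrable {p q f : ℝ → ℂ} {c : ℝ} (hp : IsDiffKernel p q c)
    (hf : LocInt c f) {a x : ℝ} (ha : 0 < a) (hax : a < x) :
    IntervalIntegrable (fun y => f y + mconv q f y) volume a x := by
  rw [intervalIntegrable_iff_integrableOn_Ioo_of_le hax.le]
  refine Integrable.add ((hf.integrableOn ha).mono_set Ioo_subset_Icc_self) ?_
  refine (hp.integrable_prod hf ha hax).integral_prod_left.congr ?_
  filter_upwards [ae_restrict_mem measurableSet_Ioo] with y hy
  exact setIntegral_indicator_lt q f hy.2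

theorem IsDiffKernel.integral_slice {p q : ℝ → ℂ} {c : ℝ} (hp : IsDiffKernel p q c)
    {t b x : ℝ} (ht : 0 < t) (htb : t ≤ b) (hbx : b ≤ x) :
    ∫ y in Ioo b x, q (y / t) / t = p (x / t) - p (b / t) := by
  obtain ⟨C, hC, hqb⟩ := hp.bound_deriv
  have hb : 0 < b := lt_of_lt_of_le ht htb
  have hcont : ContinuousOn (fun y => p (y / t)) (Icc b x) :=
    hp.continuousOn.comp (by fun_prop) fun y hy => (one_le_div ht).mpr (htb.trans hy.1)
  have hder : ∀ y ∈ Ioo b x, HasDerivAt (fun y => p (y / t)) (q (y / t) / t) y := by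
    intro y hy
    have h1 := hp.hasDerivAt (y / t) ((one_lt_div ht).mpr (lt_of_le_of_lt htb hy.1))
    have h2 := h1.scomp y ((hasDerivAt_id y).div_const t)
    refine h2.congr_deriv ?_
    rw [Complex.real_smul]
    push_cast
    ring
  have hint : IntegrableOn (fun y => q (y / t) / t) (Ioo b x) := by
    have hc : IntegrableOn (fun y : ℝ => C * (y / t) ^ (c - 1) / t) (Ioo b x) := by
      refine (ContinuousOn.integrableOn_Icc fun y hy => ?_).mono_set Ioo_subset_Icc_self
      have : y / t ≠ 0 := (div_pos (by linarith [hy.1]) ht).ne'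
      have h1 : ContinuousAt (fun y : ℝ => (y / t) ^ (c - 1)) y :=
        (Real.continuousAt_rpow_const (y / t) (c - 1) (Or.inl this)).comp
          (f := fun y : ℝ => y / t) (by fun_prop)
      exact ((continuousAt_const.mul h1).div_const t).continuousWithinAt
    refine Integrable.mono' hc ?_ ?_
    · refine ContinuousOn.aestronglyMeasurable (ContinuousOn.div_const
        (hp.continuousOn_deriv.comp (by fun_prop) ?_) _) measurableSet_Ioo
      exact fun y hy => (one_lt_div ht).mpr (lt_of_le_of_lt htb hy.1)
    · filter_upwards [ae_restrict_mem measurableSet_Ioo] with y hy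
      rw [norm_div, Complex.norm_real, Real.norm_of_nonneg ht.le]
      gcongr
      exact hqb _ ((one_lt_div ht).mpr (lt_of_le_of_lt htb hy.1))
  have h := intervalIntegral.integral_eq_sub_of_hasDerivAt_of_le hbx hcont hder
    ((intervalIntegrable_iff_integrableOn_Ioo_of_le hbx).mpr hint)
  rwa [intervalIntegral.integral_of_le hbx, integral_Ioc_eq_integral_Ioo] at h

/-- The kernel integral is the primitive of `f + mconv q f`, by Fubini's theorem. -/
theorem IsDiffKernel.kernelInt_sub {p q f : ℝ → ℂ} {c : ℝ} (hp : IsDiffKernel p q c)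
    (hf : LocInt c f) {a x : ℝ} (ha : 0 < a) (hax : a < x) :
    kernelInt p f x - kernelInt p f a = ∫ y in a..x, (f y + mconv q f y) := by
  have hx : 0 < x := ha.trans hax
  have hprod := hp.integrable_prod hf ha hax
  have hfax : IntegrableOn f (Ioo a x) := (hf.integrableOn ha).mono_set Ioo_subset_Icc_self
  have hmc : IntegrableOn (mconv q f) (Ioo a x) := by
    refine hprod.integral_prod_left.congr ?_
    filter_upwards [ae_restrict_mem measurableSet_Ioo] with y hy
    exact setIntegral_indicator_lt q f hy.2
  have hswap := integral_integral_swap (f := fun y t => convIntegrand q f (y, t)) hprod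
  rw [setIntegral_congr_fun measurableSet_Ioo
    (fun y hy => setIntegral_indicator_lt q f hy.2)] at hswap
  have hinner : ∀ t ∈ Ioo 0 x, ∫ y in Ioo a x, convIntegrand q f (y, t) =
      p (x / t) * f t - p (max a t / t) * f t := by
    intro t ht
    have e : (fun y => convIntegrand q f (y, t)) =
        (Ioi t).indicator fun y => (q (y / t) / t) * f t := by
      funext y
      by_cases h : t < y
      · rw [convIntegrand_of_lt _ _ h,
          indicator_of_mem (show y ∈ Ioi t from h)]
        ring
      · rw [convIntegrand_of_not_lt _ _ h,
          indicator_of_notMem (show y ∉ Ioi t from h)]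
    rw [e, setIntegral_indicator measurableSet_Ioi, Ioo_inter_Ioi, integral_mul_const,
      hp.integral_slice ht.1 (le_max_right _ _) (max_le hax.le ht.2.le)]
    ring
  rw [setIntegral_congr_fun measurableSet_Ioo hinner] at hswap
  have i1 := hp.integrableOn hf hx
  have i2 : IntegrableOn (fun t => p (max a t / t) * f t) (Ioo 0 a) :=
    IntegrableOn.congr_fun (hp.integrableOn hf ha)
      (fun t ht => by simp only [max_eq_left ht.2.le]) measurableSet_Ioo
  have i3 : IntegrableOn (fun t => p (max a t / t) * f t) (Ico a x) := by
    refine IntegrableOn.congr_fun ((hf.integrableOn (b := x) ha).mono_set Ico_subset_Icc_self)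
      (fun t ht => ?_) measurableSet_Ico
    have : t ≠ 0 := (ha.trans_le ht.1).ne'
    simp only [max_eq_right ht.1, div_self this, hp.map_one, one_mul]
  have hunion : Ioo 0 a ∪ Ico a x = Ioo 0 x := Ioo_union_Ico_eq_Ioo ha hax.le
  have hdisj : Disjoint (Ioo 0 a) (Ico a x) := by
    rw [Set.disjoint_left]; intro t h1 h2; exact absurd h1.2 (not_lt.mpr h2.1)
  have i4 : IntegrableOn (fun t => p (max a t / t) * f t) (Ioo 0 x) := hunion ▸ i2.union i3
  have e3 : ∫ t in Ioo 0 x, p (max a t / t) * f t = kernelInt p f a + ∫ t in Ioo a x, f t := by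
    rw [← hunion, setIntegral_union hdisj measurableSet_Ico i2 i3]
    congr 1
    · exact setIntegral_congr_fun measurableSet_Ioo fun t ht => by simp only [max_eq_left ht.2.le]
    · rw [← integral_Ico_eq_integral_Ioo]
      refine setIntegral_congr_fun measurableSet_Ico fun t ht => ?_
      have : t ≠ 0 := (ha.trans_le ht.1).ne'
      simp only [max_eq_right ht.1, div_self this, hp.map_one, one_mul]
  rw [integral_sub i1 i4, e3] at hswap
  rw [intervalIntegral.integral_of_le hax.le, integral_Ioc_eq_integral_Ioo,
    integral_add hfax hmc, hswap]
  unfold kernelInt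
  ring

theorem ae_hasDerivAt_of_forall_sub_eq {F G : ℝ → ℂ}
    (hG : ∀ a x : ℝ, 0 < a → a < x → IntervalIntegrable G volume a x)
    (hF : ∀ a x : ℝ, 0 < a → a < x → F x - F a = ∫ y in a..x, G y) :
    ∀ᵐ x ∂(volume.restrict (Ioi (0 : ℝ))), HasDerivAt F (G x) x := by
  rw [ae_restrict_iff' measurableSet_Ioi]
  have h : ∀ n : ℕ, ∀ᵐ x, x ∈ Ioo (1 / ((n : ℝ) + 2)) ((n : ℝ) + 2) → HasDerivAt F (G x) x := by
    intro n
    have hn : (0 : ℝ) < (n : ℝ) + 2 := by positivity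
    have hlt : 1 / ((n : ℝ) + 2) < (n : ℝ) + 2 := by
      rw [div_lt_iff₀ hn]; nlinarith [(Nat.cast_nonneg n : (0 : ℝ) ≤ n)]
    have h1 := (hG _ _ (by positivity) hlt).ae_hasDerivAt_integral
    filter_upwards [h1] with x hx hxI
    have h2 := hx (by rw [uIcc_of_le hlt.le]; exact Ioo_subset_Icc_self hxI) _ left_mem_uIcc
    refine (h2.add_const (F (1 / ((n : ℝ) + 2)))).congr_of_eventuallyEq ?_
    filter_upwards [Ioo_mem_nhds hxI.1 hxI.2] with y hy
    rw [← hF _ _ (by positivity) hy.1]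
    ring
  filter_upwards [ae_all_iff.mpr h] with x hx hx0
  have hx0' : (0 : ℝ) < x := hx0
  obtain ⟨n, hn⟩ := exists_nat_gt (max x (1 / x))
  refine hx n ⟨?_, ?_⟩
  · rw [one_div_lt (by positivity) hx0']
    linarith [le_max_right x (1 / x)]
  · linarith [le_max_left x (1 / x)]

theorem IsDiffKernel.ae_hasDerivAt {p q f : ℝ → ℂ} {c : ℝ} (hp : IsDiffKernel p q c)
    (hf : LocInt c f) :
    ∀ᵐ x ∂(volume.restrict (Ioi (0 : ℝ))),
      HasDerivAt (kernelInt p f) (f x + mconv q f x) x :=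
  ae_hasDerivAt_of_forall_sub_eq (fun _ _ ha hax => hp.intervalIntegrable hf ha hax)
    fun _ _ ha hax => hp.kernelInt_sub hf ha hax

/-! ### Plancherel's theorem for integrable functions -/

theorem norm_sq_eq_integral {α : Type*} [MeasurableSpace α] {μ : Measure α} (f : Lp ℂ 2 μ) :
    ‖f‖ ^ 2 = ∫ x, ‖f x‖ ^ 2 ∂μ := by
  have h1 := inner_self_eq_norm_sq_to_K (𝕜 := ℂ) f
  rw [L2.inner_def] at h1
  have h2 : ∀ x, inner ℂ (f x) (f x) = ((‖f x‖ ^ 2 : ℝ) : ℂ) := fun x => by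
    rw [inner_self_eq_norm_sq_to_K]; push_cast; rfl
  simp only [h2] at h1
  rw [integral_complex_ofReal] at h1
  have h3 : ((‖f‖ ^ 2 : ℝ) : ℂ) = ((∫ x, ‖f x‖ ^ 2 ∂μ : ℝ) : ℂ) := by
    rw [h1]; push_cast; rfl
  exact Complex.ofReal_injective h3

theorem norm_sq_toLp {α : Type*} [MeasurableSpace α] {μ : Measure α} {f : α → ℂ}
    (hf : MemLp f 2 μ) : ‖hf.toLp f‖ ^ 2 = ∫ x, ‖f x‖ ^ 2 ∂μ := by
  rw [norm_sq_eq_integral]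
  refine integral_congr_ae ?_
  filter_upwards [hf.coeFn_toLp] with x hx
  rw [hx]

open FourierTransform in
/-- For an integrable square integrable function the Fourier transform in `L²` is given by the
Fourier integral. -/
theorem coeFn_fourier_toLp {f : ℝ → ℂ} (h1 : Integrable f) (h2 : MemLp f 2) :
    (𝓕 (h2.toLp f) : Lp ℂ 2 (volume : Measure ℝ)) =ᵐ[volume] 𝓕 f := by
  set G : Lp ℂ 2 (volume : Measure ℝ) := 𝓕 (h2.toLp f) with hG
  have hcont : Continuous (𝓕 f) := by
    have := VectorFourier.fourierIntegral_continuous (μ := volume) Real.continuous_fourierChar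
      (L := innerₗ ℝ) continuous_inner h1
    exact this
  have hGloc : LocallyIntegrable G := (Lp.memLp G).locallyIntegrable (by norm_num)
  refine ae_eq_of_integral_contDiff_smul_eq hGloc hcont.locallyIntegrable ?_
  intro g hg hgc
  have hg1 : HasCompactSupport (Complex.ofRealCLM ∘ g) := hgc.comp_left rfl
  have hg2 : ContDiff ℝ ((⊤ : ℕ∞) : WithTop ℕ∞) (Complex.ofRealCLM ∘ g) := by fun_prop
  set φ := hg1.toSchwartzMap hg2 with hφ
  have e1 := congrArg (fun T => T φ) (Lp.fourier_toTemperedDistribution_eq (h2.toLp f))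
  simp only [TemperedDistribution.fourier_apply, Lp.toTemperedDistribution_apply] at e1
  rw [← hG] at e1
  have e2 : ∫ x, g x • G x = ∫ x, φ x • G x := by
    refine integral_congr_ae (Eventually.of_forall fun x => ?_)
    simp [hφ]
  have e3 : ∫ x, g x • 𝓕 f x = ∫ x, φ x • 𝓕 f x := by
    refine integral_congr_ae (Eventually.of_forall fun x => ?_)
    simp [hφ]
  rw [e2, e3, ← e1]
  have e4 : ∫ x, (𝓕 φ) x • (h2.toLp f) x = ∫ x, (𝓕 φ) x • f x := by
    refine integral_congr_ae ?_
    filter_upwards [h2.coeFn_toLp] with x hx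
    rw [hx]
  rw [e4]
  have e5 := VectorFourier.integral_fourierIntegral_smul_eq_flip (μ := volume) (ν := volume)
    (L := innerₗ ℝ) Real.continuous_fourierChar continuous_inner φ.integrable h1
  rw [flip_innerₗ] at e5
  rw [SchwartzMap.fourier_coe]
  exact e5

open FourierTransform in
/-- Plancherel's theorem. -/
theorem integral_norm_sq_fourier {f : ℝ → ℂ} (h1 : Integrable f) (h2 : MemLp f 2) :
    Integrable (fun ξ => ‖𝓕 f ξ‖ ^ 2) ∧ ∫ ξ, ‖𝓕 f ξ‖ ^ 2 = ∫ x, ‖f x‖ ^ 2 := by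
  have h := coeFn_fourier_toLp h1 h2
  have hm : MemLp (𝓕 f) 2 volume := (memLp_congr_ae h).mp (Lp.memLp _)
  refine ⟨(memLp_two_iff_integrable_sq_norm hm.1).mp hm, ?_⟩
  rw [← norm_sq_toLp h2, ← Lp.norm_fourier_eq, norm_sq_eq_integral]
  refine integral_congr_ae ?_
  filter_upwards [h] with x hx
  rw [hx]

/-! ### Plancherel's theorem for the Mellin transform -/

theorem image_exp_neg : (fun u : ℝ => Real.exp (-u)) '' univ = Ioi 0 := by
  ext t
  constructor
  · rintro ⟨u, -, rfl⟩; exact Real.exp_pos _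
  · intro ht
    exact ⟨-Real.log t, trivial, by simp [Real.exp_log ht]⟩

theorem hasDerivAt_exp_neg (u : ℝ) :
    HasDerivAt (fun u : ℝ => Real.exp (-u)) (-Real.exp (-u)) u := by
  simpa using (hasDerivAt_id u).neg.exp

theorem injOn_exp_neg : InjOn (fun u : ℝ => Real.exp (-u)) univ := fun u _ v _ h => by
  simpa using h

theorem cpow_neg_half_exp_neg (u : ℝ) :
    Real.exp (-u) * ‖((Real.exp (-u) : ℝ) : ℂ) ^ ((1 / 2 : ℂ) - 1)‖ = Real.exp (-(1 / 2) * u) := by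
  rw [Complex.norm_cpow_eq_rpow_re_of_pos (Real.exp_pos _), ← Real.exp_mul, ← Real.exp_add]
  congr 1
  norm_num
  ring

theorem exp_weight_sq (f : ℝ → ℂ) (u : ℝ) :
    ‖Real.exp (-(1 / 2) * u) • f (Real.exp (-u))‖ ^ 2 =
      |-Real.exp (-u)| • ‖f (Real.exp (-u))‖ ^ 2 := by
  rw [norm_smul, mul_pow, Real.norm_of_nonneg (Real.exp_pos _).le, abs_neg,
    abs_of_pos (Real.exp_pos _), smul_eq_mul, ← Real.exp_nat_mul]
  congr 2
  push_cast
  ring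

/-- Plancherel's theorem for the Mellin transform on the line `Re s = 1/2`. -/
theorem integral_norm_sq_mellin {f : ℝ → ℂ} (h1 : MellinConvergent f (1 / 2))
    (h2 : MemLp f 2 (volume.restrict (Ioi (0 : ℝ)))) :
    Integrable (fun ξ : ℝ => ‖mellin f (1 / 2 + 2 * Real.pi * ξ * Complex.I)‖ ^ 2) ∧
      ∫ ξ : ℝ, ‖mellin f (1 / 2 + 2 * Real.pi * ξ * Complex.I)‖ ^ 2 =
        ∫ x in Ioi (0 : ℝ), ‖f x‖ ^ 2 := by
  set φ : ℝ → ℂ := fun u => Real.exp (-(1 / 2) * u) • f (Real.exp (-u)) with hφ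
  have hF : ∀ ξ : ℝ, mellin f (1 / 2 + 2 * Real.pi * ξ * Complex.I) =
      FourierTransform.fourier φ ξ := by
    intro ξ
    rw [mellin_eq_fourier]
    have e1 : (1 / 2 + 2 * Real.pi * ξ * Complex.I : ℂ).re = 1 / 2 := by simp
    have e2 : (1 / 2 + 2 * Real.pi * ξ * Complex.I : ℂ).im / (2 * Real.pi) = ξ := by
      have := Real.pi_ne_zero
      simp
    rw [e1, e2]
  have hm : AEStronglyMeasurable φ := by
    have hI := h1
    unfold MellinConvergent at hI
    rw [← image_exp_neg, integrableOn_image_iff_integrableOn_abs_deriv_smul MeasurableSet.univ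
      (fun u _ => (hasDerivAt_exp_neg u).hasDerivWithinAt) injOn_exp_neg, integrableOn_univ] at hI
    have h3 : AEStronglyMeasurable (fun u : ℝ =>
        (Real.exp (-u) * ((Real.exp (-u) : ℝ) : ℂ) ^ ((1 / 2 : ℂ) - 1))⁻¹ *
          Real.exp (-(1 / 2) * u) * (|-Real.exp (-u)| • ((Real.exp (-u) : ℝ) : ℂ) ^
            ((1 / 2 : ℂ) - 1) • f (Real.exp (-u)))) volume :=
      AEStronglyMeasurable.mul (by fun_prop : Measurable _).aestronglyMeasurable hI.1
    refine h3.congr (Eventually.of_forall fun u => ?_)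
    have h4 : ((Real.exp (-u) : ℝ) : ℂ) ≠ 0 := by exact_mod_cast (Real.exp_pos _).ne'
    have h5 : ((Real.exp (-u) : ℝ) : ℂ) ^ ((1 / 2 : ℂ) - 1) ≠ 0 := by
      simp [Complex.cpow_eq_zero_iff]
    simp only [hφ, abs_neg, abs_of_pos (Real.exp_pos _), Complex.real_smul, smul_eq_mul]
    field_simp
  have hφ1 : Integrable φ := by
    have hI := h1.norm
    rw [← IntegrableOn, ← image_exp_neg, integrableOn_image_iff_integrableOn_abs_deriv_smul
      MeasurableSet.univ (fun u _ => (hasDerivAt_exp_neg u).hasDerivWithinAt) injOn_exp_neg,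
      integrableOn_univ] at hI
    refine (integrable_norm_iff hm).mp (hI.congr (Eventually.of_forall fun u => ?_))
    simp only [hφ]
    rw [norm_smul, norm_smul, abs_neg, abs_of_pos (Real.exp_pos _), smul_eq_mul, ← mul_assoc,
      cpow_neg_half_exp_neg, Real.norm_of_nonneg (Real.exp_pos _).le]
  have hsq := (memLp_two_iff_integrable_sq_norm h2.1).mp h2
  have hφ2 : MemLp φ 2 := by
    refine (memLp_two_iff_integrable_sq_norm hm).mpr ?_
    have hI := hsq
    rw [← IntegrableOn, ← image_exp_neg, integrableOn_image_iff_integrableOn_abs_deriv_smul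
      MeasurableSet.univ (fun u _ => (hasDerivAt_exp_neg u).hasDerivWithinAt) injOn_exp_neg,
      integrableOn_univ] at hI
    exact hI.congr (Eventually.of_forall fun u => (exp_weight_sq f u).symm)
  have key := integral_norm_sq_fourier hφ1 hφ2
  simp only [hF]
  refine ⟨key.1, key.2.trans ?_⟩
  rw [← image_exp_neg, integral_image_eq_integral_abs_deriv_smul MeasurableSet.univ
    (fun u _ => (hasDerivAt_exp_neg u).hasDerivWithinAt) injOn_exp_neg, setIntegral_univ]
  exact integral_congr_ae (Eventually.of_forall fun u => exp_weight_sq f u)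

/-! ### Multiplicative convolution and the Mellin transform -/

theorem integrableOn_comp_div_Ioi {k : ℝ → ℂ} (hk : IntegrableOn k (Ioi 1)) {t : ℝ} (ht : 0 < t) :
    IntegrableOn (fun x => k (x / t)) (Ioi t) := by
  have h := integrableOn_Ioi_comp_mul_left_iff (fun x => k (x / t)) 1 ht
  rw [mul_one] at h
  refine h.mp (hk.congr_fun (fun y _ => ?_) measurableSet_Ioi)
  rw [mul_div_cancel_left₀ _ ht.ne']

theorem integral_comp_div_Ioi {E : Type*} [NormedAddCommGroup E] [NormedSpace ℝ E] (k : ℝ → E)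
    {t : ℝ} (ht : 0 < t) :
    ∫ x in Ioi t, k (x / t) = t • ∫ y in Ioi (1 : ℝ), k y := by
  have h := integral_comp_mul_left_Ioi (fun x => k (x / t)) 1 ht
  simp only [mul_div_cancel_left₀ _ ht.ne', mul_one] at h
  rw [h, smul_smul, mul_inv_cancel₀ ht.ne', one_smul]

theorem convIntegrand_slice (k f : ℝ → ℂ) (t : ℝ) :
    (fun x => convIntegrand k f (x, t)) = (Ioi t).indicator fun x => k (x / t) * (f t / t) := by
  funext x
  by_cases h : t < x
  · rw [convIntegrand_of_lt _ _ h, indicator_of_mem (show x ∈ Ioi t from h)]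
  · rw [convIntegrand_of_not_lt _ _ h, indicator_of_notMem (show x ∉ Ioi t from h)]

theorem setIntegral_convIntegrand (k f : ℝ → ℂ) (x : ℝ) :
    ∫ t in Ioi 0, convIntegrand k f (x, t) = mconv k f x := by
  have e : (fun t => convIntegrand k f (x, t)) = (Iio x).indicator fun t => k (x / t) * (f t / t) := by
    funext t
    by_cases h : t < x
    · rw [convIntegrand_of_lt _ _ h, indicator_of_mem (show t ∈ Iio x from h)]
    · rw [convIntegrand_of_not_lt _ _ h, indicator_of_notMem (show t ∉ Iio x from h)]
  rw [e, setIntegral_indicator measurableSet_Iio, mconv, Ioi_inter_Iio]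

theorem integrable_convIntegrand {k f : ℝ → ℂ} (hkc : ContinuousOn k (Ioi 1))
    (hk : IntegrableOn k (Ioi 1)) (hf : IntegrableOn f (Ioi 0)) :
    Integrable (convIntegrand k f)
      ((volume.restrict (Ioi 0)).prod (volume.restrict (Ioi 0))) := by
  have hm := aestronglyMeasurable_convIntegrand hkc (A := Ioi 0) measurableSet_Ioi
    measurableSet_Ioi (Subset.refl (Ioi (0 : ℝ))) hf.1
  refine (integrable_prod_iff' hm).mpr ⟨?_, ?_⟩
  · filter_upwards [ae_restrict_mem measurableSet_Ioi] with t ht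
    rw [convIntegrand_slice, integrable_indicator_iff measurableSet_Ioi, IntegrableOn,
      Measure.restrict_restrict measurableSet_Ioi]
    exact (IntegrableOn.mono_set (Integrable.mul_const (integrableOn_comp_div_Ioi hk ht) _)
      inter_subset_left)
  · refine (hf.norm.const_mul (∫ y in Ioi (1 : ℝ), ‖k y‖)).congr ?_
    filter_upwards [ae_restrict_mem measurableSet_Ioi] with t ht
    have ht' : (0 : ℝ) < t := ht
    have e : (fun x => ‖convIntegrand k f (x, t)‖) =
        (Ioi t).indicator fun x => ‖k (x / t)‖ * (‖f t‖ / t) := by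
      funext x
      rw [show convIntegrand k f (x, t) = _ from congrFun (convIntegrand_slice k f t) x,
        norm_indicator_eq_indicator_norm]
      simp only [norm_mul, norm_div, Complex.norm_real, Real.norm_of_nonneg ht'.le]
    rw [e, setIntegral_indicator measurableSet_Ioi, inter_eq_right.mpr (Ioi_subset_Ioi ht'.le),
      integral_mul_const, integral_comp_div_Ioi (fun y => ‖k y‖) ht', smul_eq_mul]
    field_simp

theorem integrableOn_mconv {k f : ℝ → ℂ} (hkc : ContinuousOn k (Ioi 1))
    (hk : IntegrableOn k (Ioi 1)) (hf : IntegrableOn f (Ioi 0)) :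
    IntegrableOn (mconv k f) (Ioi 0) :=
  (integrable_convIntegrand hkc hk hf).integral_prod_left.congr
    (Eventually.of_forall fun x => setIntegral_convIntegrand k f x)

theorem integral_mconv {k f : ℝ → ℂ} (hkc : ContinuousOn k (Ioi 1))
    (hk : IntegrableOn k (Ioi 1)) (hf : IntegrableOn f (Ioi 0)) :
    ∫ x in Ioi 0, mconv k f x = (∫ y in Ioi 1, k y) * ∫ t in Ioi 0, f t := by
  have h := integral_integral_swap (f := fun x t => convIntegrand k f (x, t))
    (integrable_convIntegrand hkc hk hf)
  simp only [setIntegral_convIntegrand] at h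
  rw [h, ← integral_const_mul]
  refine setIntegral_congr_fun measurableSet_Ioi fun t ht => ?_
  have ht' : (0 : ℝ) < t := ht
  have ht0 : (t : ℂ) ≠ 0 := by exact_mod_cast ht'.ne'
  rw [convIntegrand_slice, setIntegral_indicator measurableSet_Ioi,
    inter_eq_right.mpr (Ioi_subset_Ioi ht'.le), integral_mul_const,
    integral_comp_div_Ioi k ht', Complex.real_smul]
  field_simp

theorem continuousOn_cpow_mul {k : ℝ → ℂ} (hkc : ContinuousOn k (Ioi 1)) (s : ℂ) :
    ContinuousOn (fun y : ℝ => (y : ℂ) ^ s * k y) (Ioi 1) := by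
  refine ContinuousOn.mul (fun y hy => ?_) hkc
  have hy' : (1 : ℝ) < y := hy
  exact (Complex.continuousAt_ofReal_cpow_const y s (Or.inr (by linarith))).continuousWithinAt

theorem mconv_cpow (k f : ℝ → ℂ) (s : ℂ) {x : ℝ} (hx : 0 < x) :
    mconv (fun y : ℝ => (y : ℂ) ^ s * k y) (fun t : ℝ => (t : ℂ) ^ s * f t) x =
      (x : ℂ) ^ s * mconv k f x := by
  unfold mconv
  rw [← integral_const_mul]
  refine setIntegral_congr_fun measurableSet_Ioo fun t ht => ?_
  have ht0 := ht.1
  have e : (x : ℂ) ^ s = ((x / t : ℝ) : ℂ) ^ s * (t : ℂ) ^ s := by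
    rw [← Complex.mul_cpow_ofReal_nonneg (div_pos hx ht0).le ht0.le, ← Complex.ofReal_mul,
      div_mul_cancel₀ _ ht0.ne']
  simp only
  rw [e]
  ring

/-- The Mellin transform turns the multiplicative convolution into a product. -/
theorem mellin_mconv {k f : ℝ → ℂ} {s : ℂ} (hkc : ContinuousOn k (Ioi 1))
    (hk : IntegrableOn (fun y : ℝ => (y : ℂ) ^ (s - 1) * k y) (Ioi 1))
    (hf : MellinConvergent f s) :
    MellinConvergent (mconv k f) s ∧
      mellin (mconv k f) s = (∫ y in Ioi (1 : ℝ), (y : ℂ) ^ (s - 1) * k y) * mellin f s := by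
  have hkc' := continuousOn_cpow_mul hkc (s - 1)
  refine ⟨?_, ?_⟩
  · refine IntegrableOn.congr_fun (integrableOn_mconv hkc' hk hf) (fun x hx => ?_)
      measurableSet_Ioi
    exact mconv_cpow k f (s - 1) hx
  · rw [mellin, mellin]
    simp only [smul_eq_mul]
    rw [← integral_mconv (f := fun t : ℝ => (t : ℂ) ^ (s - 1) * f t) hkc' hk hf]
    exact setIntegral_congr_fun measurableSet_Ioi fun x hx => (mconv_cpow k f (s - 1) hx).symm

/-! ### Multiplicative convolution operators in `L₂(0, ∞)` -/

/-- A kernel on `(1, ∞)` whose Mellin transform converges absolutely on the line `Re s = 1/2`. -/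
structure IsL2Kernel (k : ℝ → ℂ) : Prop where
  continuousOn : ContinuousOn k (Ioi 1)
  integrableOn : IntegrableOn (fun y : ℝ => (y : ℂ) ^ ((1 / 2 : ℂ) - 1) * k y) (Ioi 1)

/-- The absolute Mellin integral of a kernel at `1/2`. -/
noncomputable def kernelMass (k : ℝ → ℂ) : ℝ :=
  ∫ y in Ioi (1 : ℝ), ‖(y : ℂ) ^ ((1 / 2 : ℂ) - 1) * k y‖

theorem kernelMass_nonneg (k : ℝ → ℂ) : 0 ≤ kernelMass k :=
  integral_nonneg fun _ => norm_nonneg _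

theorem image_const_div_Ioo {x : ℝ} (hx : 0 < x) : (fun t : ℝ => x / t) '' Ioo 0 x = Ioi 1 := by
  ext y
  constructor
  · rintro ⟨t, ht, rfl⟩
    exact (one_lt_div ht.1).mpr ht.2
  · intro hy
    have hy' : (1 : ℝ) < y := hy
    have hy0 : 0 < y := by linarith
    refine ⟨x / y, ⟨by positivity, ?_⟩, by field_simp⟩
    rw [div_lt_iff₀ hy0]; nlinarith

theorem hasDerivAt_const_div (x : ℝ) {t : ℝ} (ht : t ≠ 0) :
    HasDerivAt (fun t : ℝ => x / t) (-(x / t ^ 2)) t := by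
  refine ((hasDerivAt_const t x).div (hasDerivAt_id t) ht).congr_deriv ?_
  simp only [id]; ring

theorem injOn_const_div {x : ℝ} (hx : 0 < x) : InjOn (fun t : ℝ => x / t) (Ioo 0 x) := by
  intro t ht u hu h
  have h1 := ht.1.ne'
  have h2 := hu.1.ne'
  simp only at h
  rw [div_eq_div_iff h1 h2] at h
  exact (mul_left_cancel₀ hx.ne' h).symm

theorem norm_cpow_neg_half {y : ℝ} (hy : 0 < y) :
    ‖(y : ℂ) ^ ((1 / 2 : ℂ) - 1)‖ = (Real.sqrt y)⁻¹ := by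
  rw [Complex.norm_cpow_eq_rpow_re_of_pos hy, Real.sqrt_eq_rpow, ← Real.rpow_neg hy.le]
  norm_num

theorem integral_kernel_weight {k : ℝ → ℂ} (hk : IsL2Kernel k) {x : ℝ} (hx : 0 < x) :
    IntegrableOn (fun t : ℝ => ‖k (x / t)‖ * Real.sqrt (x / t) / t) (Ioo 0 x) ∧
      ∫ t in Ioo 0 x, ‖k (x / t)‖ * Real.sqrt (x / t) / t = kernelMass k := by
  have e : ∀ t ∈ Ioo 0 x, |-(x / t ^ 2)| •
      ‖((x / t : ℝ) : ℂ) ^ ((1 / 2 : ℂ) - 1) * k (x / t)‖ =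
      ‖k (x / t)‖ * Real.sqrt (x / t) / t := by
    intro t ht
    have ht0 := ht.1
    have h1 : 0 < x / t := by positivity
    have h2 := Real.sqrt_pos.mpr h1
    have h3 := Real.mul_self_sqrt h1.le
    rw [abs_neg, abs_of_pos (by positivity), norm_mul, norm_cpow_neg_half h1, smul_eq_mul,
      show x / t ^ 2 = x / t / t by field_simp]
    nth_rw 1 [← h3]
    field_simp
  have hd : ∀ t ∈ Ioo 0 x, HasDerivWithinAt (fun t : ℝ => x / t) (-(x / t ^ 2)) (Ioo 0 x) t :=
    fun t ht => (hasDerivAt_const_div x ht.1.ne').hasDerivWithinAt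
  constructor
  · have h := hk.integrableOn.norm
    rw [← IntegrableOn, ← image_const_div_Ioo hx,
      integrableOn_image_iff_integrableOn_abs_deriv_smul measurableSet_Ioo hd
        (injOn_const_div hx)] at h
    exact h.congr_fun e measurableSet_Ioo
  · rw [kernelMass, ← image_const_div_Ioo hx, integral_image_eq_integral_abs_deriv_smul
      measurableSet_Ioo hd (injOn_const_div hx)]
    exact (setIntegral_congr_fun measurableSet_Ioo e).symm

/-- The kernel `y^(-1/2) |k(y)|`. -/
noncomputable def absKernel (k : ℝ → ℂ) (y : ℝ) : ℂ :=
  ((‖(y : ℂ) ^ ((1 / 2 : ℂ) - 1) * k y‖ : ℝ) : ℂ)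

/-- The square of the modulus, as a complex function. -/
noncomputable def absSq (f : ℝ → ℂ) (t : ℝ) : ℂ := ((‖f t‖ ^ 2 : ℝ) : ℂ)

/-- The convolution `mconv (absKernel k) (absSq f)`, as a real number. -/
noncomputable def schurInt (k f : ℝ → ℂ) (x : ℝ) : ℝ :=
  ∫ t in Ioo 0 x, ‖((x / t : ℝ) : ℂ) ^ ((1 / 2 : ℂ) - 1) * k (x / t)‖ * (‖f t‖ ^ 2 / t)

theorem schurInt_nonneg (k f : ℝ → ℂ) (x : ℝ) : 0 ≤ schurInt k f x := by
  refine setIntegral_nonneg measurableSet_Ioo fun t ht => ?_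
  have := ht.1
  positivity

theorem mconv_absKernel (k f : ℝ → ℂ) (x : ℝ) :
    mconv (absKernel k) (absSq f) x = (schurInt k f x : ℂ) := by
  rw [schurInt, ← integral_complex_ofReal, mconv]
  refine setIntegral_congr_fun measurableSet_Ioo fun t _ => ?_
  simp only [absKernel, absSq]
  push_cast
  rfl

theorem IsL2Kernel.continuousOn_absKernel {k : ℝ → ℂ} (hk : IsL2Kernel k) :
    ContinuousOn (absKernel k) (Ioi 1) :=
  Complex.continuous_ofReal.comp_continuousOn (continuousOn_cpow_mul hk.continuousOn _).norm

theorem IsL2Kernel.integrableOn_absKernel {k : ℝ → ℂ} (hk : IsL2Kernel k) :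
    IntegrableOn (absKernel k) (Ioi 1) := hk.integrableOn.norm.ofReal

theorem integrableOn_absSq {f : ℝ → ℂ} (hf : MemLp f 2 (volume.restrict (Ioi (0 : ℝ)))) :
    IntegrableOn (absSq f) (Ioi 0) :=
  ((memLp_two_iff_integrable_sq_norm hf.1).mp hf).ofReal

theorem integral_absSq (f : ℝ → ℂ) :
    ∫ t in Ioi (0 : ℝ), absSq f t = ((∫ t in Ioi (0 : ℝ), ‖f t‖ ^ 2 : ℝ) : ℂ) :=
  integral_complex_ofReal

theorem integral_absKernel (k : ℝ → ℂ) :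
    ∫ y in Ioi (1 : ℝ), absKernel k y = (kernelMass k : ℂ) :=
  integral_complex_ofReal

theorem IsL2Kernel.integrable_convIntegrand_sq {k f : ℝ → ℂ} (hk : IsL2Kernel k)
    (hf : MemLp f 2 (volume.restrict (Ioi (0 : ℝ)))) :
    Integrable (convIntegrand (absKernel k) (absSq f))
      ((volume.restrict (Ioi 0)).prod (volume.restrict (Ioi 0))) := by
  exact integrable_convIntegrand hk.continuousOn_absKernel hk.integrableOn_absKernel
    (integrableOn_absSq hf)

/-- The weighted Cauchy–Schwarz inequality behind Schur's test, at almost every point. -/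
theorem IsL2Kernel.ae_bound {k f : ℝ → ℂ} (hk : IsL2Kernel k)
    (hf : MemLp f 2 (volume.restrict (Ioi (0 : ℝ)))) :
    ∀ᵐ x ∂(volume.restrict (Ioi (0 : ℝ))),
      IntegrableOn (fun t => k (x / t) * (f t / t)) (Ioo 0 x) ∧
      ‖mconv k f x‖ ^ 2 ≤ (kernelMass k + 1) *
        schurInt k f x := by
  have hm : AEStronglyMeasurable (convIntegrand k f)
      ((volume.restrict (Ioi 0)).prod (volume.restrict (Ioi 0))) :=
    aestronglyMeasurable_convIntegrand hk.continuousOn measurableSet_Ioi measurableSet_Ioi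
      (Subset.refl _) hf.1
  filter_upwards [(hk.integrable_convIntegrand_sq hf).prod_right_ae, hm.prodMk_left,
    ae_restrict_mem measurableSet_Ioi] with x hx hmx hx0
  have hx0' : (0 : ℝ) < x := hx0
  have hκ := kernelMass_nonneg k
  obtain ⟨hv, hvκ⟩ := integral_kernel_weight hk hx0'
  set u : ℝ → ℝ := fun t => ‖((x / t : ℝ) : ℂ) ^ ((1 / 2 : ℂ) - 1) * k (x / t)‖ *
    (‖f t‖ ^ 2 / t) with hu_def
  have hsub : Ioo 0 x ⊆ Ioi 0 := Ioo_subset_Ioi_self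
  have hu : IntegrableOn u (Ioo 0 x) := by
    have h1 : IntegrableOn (fun t => convIntegrand (absKernel k) (absSq f) (x, t)) (Ioo 0 x) := IntegrableOn.mono_set hx hsub
    refine (IntegrableOn.congr_fun h1.re (fun t ht => ?_) measurableSet_Ioo)
    rw [convIntegrand_of_lt _ _ ht.2, absKernel, absSq, ← Complex.ofReal_div, ← Complex.ofReal_mul]
    exact Complex.ofReal_re _
  set B : ℝ := schurInt k f x with hB_def
  have hB0 : 0 ≤ B := schurInt_nonneg k f x
  have hBu : ∫ t in Ioo 0 x, u t = B := rfl
  have hpt : ∀ l : ℝ, 0 < l → ∀ t ∈ Ioo 0 x, ‖k (x / t) * (f t / t)‖ ≤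
      (l / 2) * (‖k (x / t)‖ * Real.sqrt (x / t) / t) + (1 / (2 * l)) * u t := by
    intro l hl t ht
    have ht0 := ht.1
    have h1 : 0 < x / t := by positivity
    have h2 := Real.sqrt_pos.mpr h1
    simp only [hu_def]
    rw [norm_mul, norm_mul, norm_div, norm_cpow_neg_half h1, Complex.norm_real,
      Real.norm_of_nonneg ht0.le]
    set S := Real.sqrt (x / t)
    have h4 : (l / 2) * (‖k (x / t)‖ * S / t) + (1 / (2 * l)) * (S⁻¹ * ‖k (x / t)‖ *
        (‖f t‖ ^ 2 / t)) - ‖k (x / t)‖ * (‖f t‖ / t) =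
        ‖k (x / t)‖ / (2 * l * S * t) * (l * S - ‖f t‖) ^ 2 := by
      field_simp
      ring
    have h5 : 0 ≤ ‖k (x / t)‖ / (2 * l * S * t) * (l * S - ‖f t‖) ^ 2 := by positivity
    linarith
  have hbI : ∀ l : ℝ, IntegrableOn (fun t =>
      (l / 2) * (‖k (x / t)‖ * Real.sqrt (x / t) / t) + (1 / (2 * l)) * u t) (Ioo 0 x) :=
    fun l => (hv.const_mul _).add (hu.const_mul _)
  have hpt' : ∀ l : ℝ, 0 < l → ∀ᵐ t ∂(volume.restrict (Ioo 0 x)), ‖k (x / t) * (f t / t)‖ ≤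
      (l / 2) * (‖k (x / t)‖ * Real.sqrt (x / t) / t) + (1 / (2 * l)) * u t := fun l hl => by
    filter_upwards [ae_restrict_mem measurableSet_Ioo] with t ht using hpt l hl t ht
  refine ⟨?_, ?_⟩
  · refine Integrable.mono' (hbI 1) ?_ (hpt' 1 one_pos)
    refine (hmx.mono_measure (Measure.restrict_mono hsub le_rfl)).congr ?_
    filter_upwards [ae_restrict_mem measurableSet_Ioo] with t ht
    exact convIntegrand_of_lt _ _ ht.2
  · have hN : ∀ l : ℝ, 0 < l →
        ‖mconv k f x‖ ≤ (l / 2) * (kernelMass k + 1) + (1 / (2 * l)) * B := by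
      intro l hl
      refine (norm_integral_le_of_norm_le (hbI l) (hpt' l hl)).trans ?_
      rw [integral_add (hv.const_mul _) (hu.const_mul _), integral_const_mul, integral_const_mul,
        hvκ, hBu]
      linarith
    rcases (norm_nonneg (mconv k f x)).eq_or_lt with h0 | h0
    · rw [← h0, zero_pow two_ne_zero]; positivity
    · -- a choice of `l` that makes both terms of the bound comparable to `‖mconv k f x‖`
      have h := hN (‖mconv k f x‖ / (kernelMass k + 1)) (by positivity)
      set N := ‖mconv k f x‖
      set κ := kernelMass k + 1 with hκ'
      have hκ0 : 0 < κ := by positivity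
      have e : N / κ / 2 * κ + 1 / (2 * (N / κ)) * B = N / 2 + κ * B / (2 * N) := by
        field_simp
      rw [e] at h
      have h6 : N / 2 ≤ κ * B / (2 * N) := by linarith
      rw [div_le_div_iff₀ two_pos (by positivity)] at h6
      nlinarith

theorem IsL2Kernel.aestronglyMeasurable_mconv {k f : ℝ → ℂ} (hk : IsL2Kernel k)
    (hf : AEStronglyMeasurable f (volume.restrict (Ioi (0 : ℝ)))) :
    AEStronglyMeasurable (mconv k f) (volume.restrict (Ioi (0 : ℝ))) := by
  have hm : AEStronglyMeasurable (convIntegrand k f)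
      ((volume.restrict (Ioi 0)).prod (volume.restrict (Ioi 0))) :=
    aestronglyMeasurable_convIntegrand hk.continuousOn measurableSet_Ioi measurableSet_Ioi
      (Subset.refl _) hf
  exact hm.integral_prod_right'.congr
    (Eventually.of_forall fun x => setIntegral_convIntegrand k f x)

theorem IsL2Kernel.mconv_sq {k f : ℝ → ℂ} (hk : IsL2Kernel k)
    (hf : MemLp f 2 (volume.restrict (Ioi (0 : ℝ)))) :
    IntegrableOn (fun x => ‖mconv k f x‖ ^ 2) (Ioi 0) ∧
      ∫ x in Ioi (0 : ℝ), ‖mconv k f x‖ ^ 2 ≤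
        (kernelMass k + 1) ^ 2 * ∫ x in Ioi (0 : ℝ), ‖f x‖ ^ 2 := by
  have hκ := kernelMass_nonneg k
  have hB : IntegrableOn (fun x => (schurInt k f x : ℂ)) (Ioi 0) := by
    rw [← funext (mconv_absKernel k f)]
    exact integrableOn_mconv hk.continuousOn_absKernel hk.integrableOn_absKernel
      (integrableOn_absSq hf)
  have hB' : IntegrableOn (schurInt k f) (Ioi 0) := hB.re
  have hval : ∫ x in Ioi (0 : ℝ), schurInt k f x =
      kernelMass k * ∫ x in Ioi (0 : ℝ), ‖f x‖ ^ 2 := by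
    have h := integral_mconv hk.continuousOn_absKernel hk.integrableOn_absKernel
      (integrableOn_absSq hf)
    simp only [mconv_absKernel] at h
    rw [integral_complex_ofReal, integral_absSq, integral_absKernel, ← Complex.ofReal_mul] at h
    exact Complex.ofReal_injective h
  have hae : ∀ᵐ x ∂(volume.restrict (Ioi (0 : ℝ))), ‖mconv k f x‖ ^ 2 ≤ (kernelMass k + 1) *
      schurInt k f x := by
    filter_upwards [hk.ae_bound hf] with x hx using hx.2
  have hI : IntegrableOn (fun x => ‖mconv k f x‖ ^ 2) (Ioi 0) := by
    refine Integrable.mono' (hB'.const_mul (kernelMass k + 1))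
      ((hk.aestronglyMeasurable_mconv hf.1).norm.pow 2) ?_
    filter_upwards [hae] with x hx
    rwa [Real.norm_of_nonneg (by positivity)]
  refine ⟨hI, ?_⟩
  calc ∫ x in Ioi (0 : ℝ), ‖mconv k f x‖ ^ 2
      ≤ ∫ x in Ioi (0 : ℝ), (kernelMass k + 1) * schurInt k f x :=
        integral_mono_ae hI (hB'.const_mul _) hae
    _ = (kernelMass k + 1) * (kernelMass k * ∫ x in Ioi (0 : ℝ), ‖f x‖ ^ 2) := by
        rw [integral_const_mul, hval]
    _ ≤ _ := by
        have h0 : 0 ≤ ∫ x in Ioi (0 : ℝ), ‖f x‖ ^ 2 := integral_nonneg fun _ => by positivity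
        nlinarith [mul_nonneg hκ h0]

theorem IsL2Kernel.memLp_mconv {k f : ℝ → ℂ} (hk : IsL2Kernel k)
    (hf : MemLp f 2 (volume.restrict (Ioi (0 : ℝ)))) :
    MemLp (mconv k f) 2 (volume.restrict (Ioi (0 : ℝ))) :=
  (memLp_two_iff_integrable_sq_norm (hk.aestronglyMeasurable_mconv hf.1)).mpr (hk.mconv_sq hf).1

theorem mconv_congr (k : ℝ → ℂ) {f g : ℝ → ℂ} (h : f =ᵐ[volume.restrict (Ioi (0 : ℝ))] g) :
    mconv k f = mconv k g := by
  funext x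
  refine integral_congr_ae ?_
  filter_upwards [ae_restrict_of_ae_restrict_of_subset
    (Ioo_subset_Ioi_self : Ioo (0 : ℝ) x ⊆ Ioi 0) h] with t ht
  rw [ht]

theorem IsL2Kernel.mconv_add {k f g : ℝ → ℂ} (hk : IsL2Kernel k)
    (hf : MemLp f 2 (volume.restrict (Ioi (0 : ℝ))))
    (hg : MemLp g 2 (volume.restrict (Ioi (0 : ℝ)))) :
    mconv k (f + g) =ᵐ[volume.restrict (Ioi (0 : ℝ))] mconv k f + mconv k g := by
  filter_upwards [hk.ae_bound hf, hk.ae_bound hg] with x h1 h2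
  simp only [mconv, Pi.add_apply]
  rw [← integral_add h1.1 h2.1]
  congr 1
  funext t
  ring

theorem mconv_smul (k : ℝ → ℂ) (c : ℂ) (f : ℝ → ℂ) : mconv k (c • f) = c • mconv k f := by
  funext x
  simp only [mconv, Pi.smul_apply, smul_eq_mul, ← integral_const_mul]
  congr 1
  funext t
  ring

/-- The multiplicative convolution as a bounded operator in `L₂(0, ∞)`. -/
noncomputable def convL2 (k : ℝ → ℂ) (hk : IsL2Kernel k) : L2 →L[ℂ] L2 :=
  LinearMap.mkContinuous
    { toFun := fun f => (hk.memLp_mconv (Lp.memLp f)).toLp (mconv k f)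
      map_add' := fun f g => by
        rw [← MemLp.toLp_add]
        refine MemLp.toLp_congr _ _ ?_
        rw [mconv_congr k (Lp.coeFn_add f g)]
        exact hk.mconv_add (Lp.memLp f) (Lp.memLp g)
      map_smul' := fun c f => by
        rw [RingHom.id_apply, ← MemLp.toLp_const_smul]
        refine MemLp.toLp_congr _ _ ?_
        rw [mconv_congr k (Lp.coeFn_smul c f), mconv_smul] }
    (kernelMass k + 1) (fun f => by
      have hκ := kernelMass_nonneg k
      refine abs_le_of_sq_le_sq' ?_ (by positivity) |>.2
      rw [mul_pow, norm_sq_eq_integral f]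
      exact (norm_sq_toLp (hk.memLp_mconv (Lp.memLp f))).le.trans (hk.mconv_sq (Lp.memLp f)).2)

/-- The operator `f ↦ f + mconv k f` in `L₂(0, ∞)`. -/
noncomputable def opA (k : ℝ → ℂ) (hk : IsL2Kernel k) : L2 →L[ℂ] L2 :=
  ContinuousLinearMap.id ℂ L2 + convL2 k hk

theorem coeFn_opA {k : ℝ → ℂ} (hk : IsL2Kernel k) (f : L2) :
    opA k hk f =ᵐ[volume.restrict (Ioi (0 : ℝ))] fun x => f x + mconv k f x := by
  have h1 : (convL2 k hk f : L2) =ᵐ[volume.restrict (Ioi (0 : ℝ))] mconv k f :=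
    MemLp.coeFn_toLp (hk.memLp_mconv (Lp.memLp f))
  have h2 : opA k hk f = f + convL2 k hk f := rfl
  rw [h2]
  filter_upwards [Lp.coeFn_add f (convL2 k hk f), h1] with x h3 h4
  rw [h3, Pi.add_apply, h4]

/-! ### Functions supported away from zero and infinity -/

/-- The square integrable functions that vanish outside a compact subset of `(0, ∞)`. -/
def cptL2 : Set L2 :=
  {f | ∃ a b : ℝ, 0 < a ∧ a < b ∧ ∀ᵐ t ∂(volume.restrict (Ioi (0 : ℝ))), t ∉ Ioo a b → f t = 0}

theorem dense_cptL2 : Dense cptL2 := by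
  -- the set is a subspace
  let S : Submodule ℂ L2 :=
    { carrier := cptL2
      zero_mem' := ⟨1, 2, one_pos, one_lt_two, by
        filter_upwards [Lp.coeFn_zero ℂ 2 (volume.restrict (Ioi (0 : ℝ)))] with t ht _
        rw [ht]; rfl⟩
      add_mem' := by
        rintro f g ⟨a, b, ha, hab, hf⟩ ⟨a', b', ha', hab', hg⟩
        refine ⟨min a a', max b b', lt_min ha ha', (min_le_left _ _).trans_lt
          (hab.trans_le (le_max_left _ _)), ?_⟩
        filter_upwards [hf, hg, Lp.coeFn_add f g] with t h1 h2 h3 h4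
        rw [h3, Pi.add_apply, h1 fun h => h4 ⟨(min_le_left _ _).trans_lt h.1,
          h.2.trans_le (le_max_left _ _)⟩, h2 fun h => h4 ⟨(min_le_right _ _).trans_lt h.1,
          h.2.trans_le (le_max_right _ _)⟩, add_zero]
      smul_mem' := by
        rintro c f ⟨a, b, ha, hab, hf⟩
        refine ⟨a, b, ha, hab, ?_⟩
        filter_upwards [hf, Lp.coeFn_smul c f] with t h1 h2 h3
        rw [h2, Pi.smul_apply, h1 h3, smul_zero] }
  have hS : S.topologicalClosure = ⊤ := by
    rw [Submodule.topologicalClosure_eq_top_iff, Submodule.eq_bot_iff]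
    intro g hg
    rw [Submodule.mem_orthogonal] at hg
    have hn : ∀ n : ℕ, ∀ᵐ t ∂(volume.restrict (Ioi (0 : ℝ))),
        t ∈ Ioo (1 / ((n : ℝ) + 2)) ((n : ℝ) + 2) → g t = 0 := by
      intro n
      set I := Ioo (1 / ((n : ℝ) + 2)) ((n : ℝ) + 2) with hI
      have hn : (0 : ℝ) < (n : ℝ) + 2 := by positivity
      have hlt : 1 / ((n : ℝ) + 2) < (n : ℝ) + 2 := by
        rw [div_lt_iff₀ hn]; nlinarith [(Nat.cast_nonneg n : (0 : ℝ) ≤ n)]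
      have hmem : MemLp (I.indicator g) 2 (volume.restrict (Ioi (0 : ℝ))) :=
        (Lp.memLp g).indicator measurableSet_Ioo
      have h1 : hmem.toLp _ ∈ S := by
        refine ⟨1 / ((n : ℝ) + 2), (n : ℝ) + 2, by positivity, hlt, ?_⟩
        filter_upwards [hmem.coeFn_toLp] with t h2 h3
        rw [h2, indicator_of_notMem h3]
      have h2 := hg _ h1
      rw [L2.inner_def] at h2
      have h3 : ∫ t in Ioi (0 : ℝ), inner ℂ ((hmem.toLp _ : L2) t) (g t) =
          ((∫ t in Ioi (0 : ℝ), ‖I.indicator g t‖ ^ 2 : ℝ) : ℂ) := by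
        rw [← integral_complex_ofReal]
        refine integral_congr_ae ?_
        filter_upwards [hmem.coeFn_toLp] with t h4
        rw [h4]
        by_cases h5 : t ∈ I
        · rw [indicator_of_mem h5, inner_self_eq_norm_sq_to_K]
          push_cast; rfl
        · rw [indicator_of_notMem h5]; simp
      rw [h3] at h2
      have h4 : ∫ t in Ioi (0 : ℝ), ‖I.indicator g t‖ ^ 2 = 0 := by exact_mod_cast h2
      rw [integral_eq_zero_iff_of_nonneg (fun _ => by positivity)
        ((memLp_two_iff_integrable_sq_norm hmem.1).mp hmem)] at h4
      filter_upwards [h4] with t h5 h6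
      rw [indicator_of_mem h6] at h5
      simpa using h5
    have h0 : g =ᵐ[volume.restrict (Ioi (0 : ℝ))] 0 := by
      filter_upwards [ae_all_iff.mpr hn, ae_restrict_mem measurableSet_Ioi] with x hx hx0
      have hx0' : (0 : ℝ) < x := hx0
      obtain ⟨n, hn⟩ := exists_nat_gt (max x (1 / x))
      refine hx n ⟨?_, ?_⟩
      · rw [one_div_lt (by positivity) hx0']
        linarith [le_max_right x (1 / x)]
      · linarith [le_max_left x (1 / x)]
    exact (Lp.eq_zero_iff_ae_eq_zero).mpr h0
  exact Submodule.dense_iff_topologicalClosure_eq_top.mpr hS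

theorem mellinConvergent_of_mem_cptL2 {f : L2} (hf : f ∈ cptL2) (s : ℂ) :
    MellinConvergent f s := by
  obtain ⟨a, b, ha, hab, h⟩ := hf
  have h1 : IntegrableOn f (Icc a b) := by
    have h2 : MemLp f 2 (volume.restrict (Icc a b)) :=
      (Lp.memLp f).mono_measure (Measure.restrict_mono (fun t ht => ha.trans_le ht.1) le_rfl)
    exact h2.integrable (by norm_num)
  have h2 : ContinuousOn (fun t : ℝ => (t : ℂ) ^ (s - 1)) (Icc a b) := fun t ht =>
    (Complex.continuousAt_ofReal_cpow_const t _
      (Or.inr (ha.trans_le ht.1).ne')).continuousWithinAt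
  have h3 : IntegrableOn (fun t : ℝ => (t : ℂ) ^ (s - 1) • f t) (Icc a b) :=
    h1.continuousOn_mul h2 isCompact_Icc
  have h4 : Integrable ((Icc a b).indicator fun t : ℝ => (t : ℂ) ^ (s - 1) • f t)
      (volume.restrict (Ioi 0)) :=
    ((integrable_indicator_iff measurableSet_Icc).mpr h3).restrict
  refine h4.congr ?_
  filter_upwards [h] with t ht
  by_cases h5 : t ∈ Icc a b
  · rw [indicator_of_mem h5]
  · rw [indicator_of_notMem h5, ht fun h6 => h5 (Ioo_subset_Icc_self h6), smul_zero]

/-! ### Multipliers on the critical line and operator inequalities -/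

/-- The Mellin multiplier `1 + ∫_1^∞ y^(s-1) k(y) dy` of `f ↦ f + mconv k f`. -/
noncomputable def symb (k : ℝ → ℂ) (s : ℂ) : ℂ :=
  1 + ∫ y in Ioi (1 : ℝ), (y : ℂ) ^ (s - 1) * k y

/-- The parametrization `1/2 + 2πiξ` of the critical line. -/
noncomputable def critLine (ξ : ℝ) : ℂ := 1 / 2 + 2 * Real.pi * ξ * Complex.I

theorem critLine_re (ξ : ℝ) : (critLine ξ).re = 1 / 2 := by simp [critLine]

theorem norm_cpow_critLine {y : ℝ} (hy : 0 < y) (ξ : ℝ) :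
    ‖(y : ℂ) ^ (critLine ξ - 1)‖ = ‖(y : ℂ) ^ ((1 / 2 : ℂ) - 1)‖ := by
  rw [Complex.norm_cpow_eq_rpow_re_of_pos hy, Complex.norm_cpow_eq_rpow_re_of_pos hy]
  congr 1
  simp [critLine_re]

theorem IsL2Kernel.integrableOn_critLine {k : ℝ → ℂ} (hk : IsL2Kernel k) (ξ : ℝ) :
    IntegrableOn (fun y : ℝ => (y : ℂ) ^ (critLine ξ - 1) * k y) (Ioi 1) := by
  refine Integrable.mono' hk.integrableOn.norm
    ((continuousOn_cpow_mul hk.continuousOn _).aestronglyMeasurable measurableSet_Ioi) ?_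
  filter_upwards [ae_restrict_mem measurableSet_Ioi] with y hy
  have hy' : (1 : ℝ) < y := hy
  rw [norm_mul, norm_mul, norm_cpow_critLine (by linarith)]

theorem IsL2Kernel.norm_symb_le {k : ℝ → ℂ} (hk : IsL2Kernel k) (ξ : ℝ) :
    ‖symb k (critLine ξ)‖ ≤ 1 + kernelMass k := by
  refine (norm_add_le _ _).trans ?_
  rw [norm_one]
  gcongr
  refine norm_integral_le_of_norm_le hk.integrableOn.norm ?_
  filter_upwards [ae_restrict_mem measurableSet_Ioi] with y hy
  have hy' : (1 : ℝ) < y := hy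
  rw [norm_mul, norm_mul, norm_cpow_critLine (by linarith)]

theorem IsL2Kernel.continuous_symb {k : ℝ → ℂ} (hk : IsL2Kernel k) :
    Continuous fun ξ => symb k (critLine ξ) := by
  refine continuous_const.add (continuous_of_dominated (bound := fun y : ℝ =>
    ‖(y : ℂ) ^ ((1 / 2 : ℂ) - 1) * k y‖) (fun ξ => ?_) (fun ξ => ?_) hk.integrableOn.norm ?_)
  · exact (continuousOn_cpow_mul hk.continuousOn _).aestronglyMeasurable measurableSet_Ioi
  · filter_upwards [ae_restrict_mem measurableSet_Ioi] with y hy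
    have hy' : (1 : ℝ) < y := hy
    rw [norm_mul, norm_mul, norm_cpow_critLine (by linarith)]
  · filter_upwards [ae_restrict_mem measurableSet_Ioi] with y hy
    have hy' : (1 : ℝ) < y := hy
    have hy0 : (y : ℂ) ≠ 0 := by exact_mod_cast (by linarith : y ≠ 0)
    refine Continuous.mul (Continuous.const_cpow ?_ (Or.inl hy0)) continuous_const
    unfold critLine
    fun_prop

theorem mellin_congr_ae {f g : ℝ → ℂ} (h : f =ᵐ[volume.restrict (Ioi (0 : ℝ))] g) (s : ℂ) :
    mellin f s = mellin g s := by
  refine integral_congr_ae ?_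
  filter_upwards [h] with x hx
  rw [hx]

theorem MellinConvergent.congr_ae {f g : ℝ → ℂ} {s : ℂ} (hf : MellinConvergent f s)
    (h : f =ᵐ[volume.restrict (Ioi (0 : ℝ))] g) : MellinConvergent g s := by
  refine Integrable.congr hf ?_
  filter_upwards [h] with x hx
  rw [hx]

/-- On the Mellin side the operator `f ↦ f + mconv k f` is multiplication by `symb k`. -/
theorem hasMellin_add_mconv {k f : ℝ → ℂ} {s : ℂ} (hkc : ContinuousOn k (Ioi 1))
    (hk : IntegrableOn (fun y : ℝ => (y : ℂ) ^ (s - 1) * k y) (Ioi 1))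
    (hf : MellinConvergent f s) :
    HasMellin (fun x => f x + mconv k f x) s (symb k s * mellin f s) := by
  obtain ⟨h1, h2⟩ := mellin_mconv hkc hk hf
  have h := hasMellin_add hf h1
  rw [h2] at h
  rwa [symb, add_mul, one_mul]

theorem norm_sq_opA {k : ℝ → ℂ} (hk : IsL2Kernel k) {h : L2} (hh : h ∈ cptL2) :
    Integrable (fun ξ => ‖symb k (critLine ξ)‖ ^ 2 * ‖mellin h (critLine ξ)‖ ^ 2) ∧
      ‖opA k hk h‖ ^ 2 =
        ∫ ξ, ‖symb k (critLine ξ)‖ ^ 2 * ‖mellin h (critLine ξ)‖ ^ 2 := by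
  have hae := coeFn_opA hk h
  have hM : ∀ ξ, mellin (opA k hk h) (critLine ξ) =
      symb k (critLine ξ) * mellin h (critLine ξ) := fun ξ => by
    rw [mellin_congr_ae hae]
    exact (hasMellin_add_mconv hk.continuousOn (hk.integrableOn_critLine ξ)
      (mellinConvergent_of_mem_cptL2 hh _)).2
  have hc : MellinConvergent (opA k hk h) (1 / 2) :=
    MellinConvergent.congr_ae (hasMellin_add_mconv hk.continuousOn hk.integrableOn
      (mellinConvergent_of_mem_cptL2 hh _)).1 hae.symm
  have key := integral_norm_sq_mellin hc (Lp.memLp _)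
  have e : ∀ ξ : ℝ, ‖mellin (opA k hk h) (1 / 2 + 2 * Real.pi * ξ * Complex.I)‖ ^ 2 =
      ‖symb k (critLine ξ)‖ ^ 2 * ‖mellin h (critLine ξ)‖ ^ 2 := fun ξ => by
    rw [← mul_pow, ← norm_mul, ← hM]; rfl
  simp only [e] at key
  rw [norm_sq_eq_integral, ← key.2]
  exact ⟨key.1, rfl⟩

/-- An inequality between multipliers on the critical line is an inequality between operators. -/
theorem norm_opA_le_of_symb_le {k₁ k₂ : ℝ → ℂ} (hk₁ : IsL2Kernel k₁) (hk₂ : IsL2Kernel k₂)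
    {C : ℝ} (hC : 0 ≤ C)
    (h : ∀ ξ, ‖symb k₁ (critLine ξ)‖ ≤ C * ‖symb k₂ (critLine ξ)‖) (f : L2) :
    ‖opA k₁ hk₁ f‖ ≤ C * ‖opA k₂ hk₂ f‖ := by
  have hclosed : IsClosed {f : L2 | ‖opA k₁ hk₁ f‖ ≤ C * ‖opA k₂ hk₂ f‖} :=
    isClosed_le (by fun_prop) (by fun_prop)
  refine hclosed.closure_subset_iff.mpr (fun g hg => ?_) (dense_cptL2 f)
  obtain ⟨i1, e1⟩ := norm_sq_opA hk₁ hg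
  obtain ⟨i2, e2⟩ := norm_sq_opA hk₂ hg
  refine (abs_le_of_sq_le_sq' (b := C * ‖opA k₂ hk₂ g‖) ?_ (by positivity)).2
  rw [mul_pow, e1, e2, ← integral_const_mul]
  refine integral_mono i1 (i2.const_mul _) fun ξ => ?_
  simp only
  rw [← mul_assoc, ← mul_pow C]
  exact mul_le_mul_of_nonneg_right (pow_le_pow_left₀ (norm_nonneg _) (h ξ) 2) (by positivity)

/-! ### Wave packets concentrated at one frequency -/

/-- The truncated power `x^(-1/2 - 2πiξ₀)` on `(1, 2^(n+1))`; its Mellin transform on the critical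
line concentrates at `ξ₀` as `n` grows. -/
noncomputable def packet (ξ₀ : ℝ) (n : ℕ) : ℝ → ℂ :=
  (Ioo (1 : ℝ) (2 ^ (n + 1))).indicator fun x : ℝ => (x : ℂ) ^ (-critLine ξ₀)

theorem memLp_packet (ξ₀ : ℝ) (n : ℕ) :
    MemLp (packet ξ₀ n) 2 (volume.restrict (Ioi (0 : ℝ))) := by
  refine MemLp.restrict _ ((memLp_indicator_iff_restrict (measurableSet_Ioo (a := (1 : ℝ)))).mpr ?_)
  refine MemLp.of_bound (by fun_prop : Measurable _).aestronglyMeasurable 1 ?_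
  filter_upwards [ae_restrict_mem measurableSet_Ioo] with x hx
  have hx1 : (1 : ℝ) < x := hx.1
  rw [Complex.norm_cpow_eq_rpow_re_of_pos (by linarith)]
  exact Real.rpow_le_one_of_one_le_of_nonpos hx1.le (by simp [critLine_re])

theorem packet_mem_cptL2 (ξ₀ : ℝ) (n : ℕ) : (memLp_packet ξ₀ n).toLp _ ∈ cptL2 := by
  refine ⟨1, 2 ^ (n + 1), one_pos, one_lt_pow₀ one_lt_two (by omega), ?_⟩
  filter_upwards [(memLp_packet ξ₀ n).coeFn_toLp] with t h1 h2
  rw [h1, packet, indicator_of_notMem h2]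

/-- The Mellin transform of the indicator function of `(1, 2)` on the imaginary axis. -/
noncomputable def packetProfile (η : ℝ) : ℂ :=
  mellin ((Ioo (1 : ℝ) 2).indicator fun _ => (1 : ℂ)) (2 * Real.pi * η * Complex.I)

theorem mellin_packet (ξ₀ ξ : ℝ) (n : ℕ) :
    mellin (packet ξ₀ n) (critLine ξ) =
      ((n + 1 : ℕ) : ℂ) * packetProfile ((n + 1 : ℕ) * (ξ - ξ₀)) := by
  set N := n + 1 with hN
  have hN0 : N ≠ 0 := by omega
  have hNr : (N : ℝ) ≠ 0 := by exact_mod_cast hN0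
  have hNc : (N : ℂ) ≠ 0 := by exact_mod_cast hN0
  have e : ∀ x ∈ Ioi (0 : ℝ), packet ξ₀ n x = (x : ℂ) ^ (-critLine ξ₀) •
      ((Ioo (1 : ℝ) 2).indicator (fun _ => (1 : ℂ))) (x ^ ((N : ℝ)⁻¹)) := by
    intro x hx
    have hx0 : (0 : ℝ) < x := hx
    have hp : (x ^ ((N : ℝ)⁻¹)) ^ N = x := Real.rpow_inv_natCast_pow hx0.le hN0
    have hpos : 0 ≤ x ^ ((N : ℝ)⁻¹) := by positivity
    have h1 : 1 < x ↔ 1 < x ^ ((N : ℝ)⁻¹) := by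
      rw [← one_lt_pow_iff_of_nonneg hpos hN0, hp]
    have h2 : x < 2 ^ N ↔ x ^ ((N : ℝ)⁻¹) < 2 := by
      rw [← pow_lt_pow_iff_left₀ hpos zero_le_two hN0, hp]
    by_cases hxm : x ∈ Ioo (1 : ℝ) (2 ^ N)
    · rw [packet, indicator_of_mem hxm, indicator_of_mem (s := Ioo (1 : ℝ) 2) ⟨h1.mp hxm.1, h2.mp hxm.2⟩, smul_eq_mul,
        mul_one]
    · rw [packet, indicator_of_notMem hxm,
        indicator_of_notMem fun h => hxm ⟨h1.mpr h.1, h2.mpr h.2⟩, smul_zero]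
  have e2 : mellin (packet ξ₀ n) (critLine ξ) = mellin (fun x : ℝ => (x : ℂ) ^ (-critLine ξ₀) •
      ((Ioo (1 : ℝ) 2).indicator (fun _ => (1 : ℂ))) (x ^ ((N : ℝ)⁻¹))) (critLine ξ) :=
    setIntegral_congr_fun measurableSet_Ioi fun x hx => by simp only [e x hx]
  rw [e2, mellin_cpow_smul, mellin_comp_rpow, packetProfile]
  rw [abs_of_pos (by positivity), inv_inv, Complex.real_smul]
  congr 2
  simp only [critLine]
  push_cast
  field_simp
  ring

theorem isL2Kernel_zero : IsL2Kernel (0 : ℝ → ℂ) := ⟨continuousOn_const, by simp⟩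

theorem integrable_packetProfile : Integrable fun η => ‖packetProfile η‖ ^ 2 := by
  have h := (norm_sq_opA isL2Kernel_zero (packet_mem_cptL2 0 0)).1
  refine h.congr (Eventually.of_forall fun ξ => ?_)
  simp only
  rw [mellin_congr_ae (memLp_packet 0 0).coeFn_toLp, mellin_packet]
  simp [symb]

theorem integral_packetProfile_pos : 0 < ∫ η, ‖packetProfile η‖ ^ 2 := by
  have hc : MellinConvergent (packet 0 0) (1 / 2) :=
    MellinConvergent.congr_ae (mellinConvergent_of_mem_cptL2 (packet_mem_cptL2 0 0) _)
      (memLp_packet 0 0).coeFn_toLp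
  have h := (integral_norm_sq_mellin hc (memLp_packet 0 0)).2
  have e : ∀ ξ : ℝ, ‖mellin (packet 0 0) (1 / 2 + 2 * Real.pi * ξ * Complex.I)‖ ^ 2 =
      ‖packetProfile ξ‖ ^ 2 := fun ξ => by
    have := mellin_packet 0 ξ 0
    simp only [critLine] at this
    rw [this]
    simp
  simp only [e] at h
  rw [h, integral_pos_iff_support_of_nonneg (fun _ => by positivity)
    ((memLp_two_iff_integrable_sq_norm (memLp_packet 0 0).1).mp (memLp_packet 0 0))]
  have hpos : Ioo (1 : ℝ) 2 ⊆ Ioi 0 := fun x hx => lt_trans one_pos hx.1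
  have hsub : Ioo (1 : ℝ) 2 ⊆ Function.support fun x => ‖packet 0 0 x‖ ^ 2 := by
    intro x hx
    have hx0 : (x : ℂ) ≠ 0 := by exact_mod_cast (by linarith [hx.1] : x ≠ 0)
    simp [packet, hx.1, hx.2, Complex.cpow_eq_zero_iff, hx0]
  refine lt_of_lt_of_le ?_ (measure_mono hsub)
  rw [Measure.restrict_apply measurableSet_Ioo, inter_eq_left.mpr hpos]
  simp

/-- The Plancherel integral of a packet, rescaled around the frequency `ξ₀`. -/
theorem norm_sq_opA_packet {k : ℝ → ℂ} (hk : IsL2Kernel k) (ξ₀ : ℝ) (n : ℕ) :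
    ‖opA k hk ((memLp_packet ξ₀ n).toLp _)‖ ^ 2 = ((n : ℝ) + 1) *
      ∫ η, ‖symb k (critLine (ξ₀ + η / ((n : ℝ) + 1)))‖ ^ 2 * ‖packetProfile η‖ ^ 2 := by
  have hn : (0 : ℝ) < (n : ℝ) + 1 := by positivity
  rw [(norm_sq_opA hk (packet_mem_cptL2 ξ₀ n)).2]
  have e : ∀ ξ, ‖symb k (critLine ξ)‖ ^ 2 *
      ‖mellin ((memLp_packet ξ₀ n).toLp _ : L2) (critLine ξ)‖ ^ 2 =
      (fun y => ((n : ℝ) + 1) ^ 2 * (‖symb k (critLine (ξ₀ + ((n : ℝ) + 1) * y / ((n : ℝ) + 1)))‖ ^ 2 *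
        ‖packetProfile (((n : ℝ) + 1) * y)‖ ^ 2)) (ξ - ξ₀) := by
    intro ξ
    simp only
    rw [mellin_congr_ae (memLp_packet ξ₀ n).coeFn_toLp, mellin_packet,
      mul_div_cancel_left₀ _ hn.ne', add_sub_cancel, norm_mul, mul_pow, Complex.norm_natCast]
    push_cast
    ring
  simp only [e]
  rw [integral_sub_right_eq_self (fun y => ((n : ℝ) + 1) ^ 2 *
    (‖symb k (critLine (ξ₀ + ((n : ℝ) + 1) * y / ((n : ℝ) + 1)))‖ ^ 2 *
        ‖packetProfile (((n : ℝ) + 1) * y)‖ ^ 2)), integral_const_mul,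
    Measure.integral_comp_mul_left (fun z => ‖symb k (critLine (ξ₀ + z / ((n : ℝ) + 1)))‖ ^ 2 *
        ‖packetProfile z‖ ^ 2), abs_of_pos (by positivity), smul_eq_mul]
  field_simp

theorem tendsto_packet {k : ℝ → ℂ} (hk : IsL2Kernel k) (ξ₀ : ℝ) :
    Tendsto (fun n : ℕ => ∫ η, ‖symb k (critLine (ξ₀ + η / ((n : ℝ) + 1)))‖ ^ 2 *
      ‖packetProfile η‖ ^ 2) atTop
      (𝓝 (∫ η, ‖symb k (critLine ξ₀)‖ ^ 2 * ‖packetProfile η‖ ^ 2)) := by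
  refine tendsto_integral_of_dominated_convergence
    (fun η => (1 + kernelMass k) ^ 2 * ‖packetProfile η‖ ^ 2) (fun n => ?_)
    (integrable_packetProfile.const_mul _) (fun n => Eventually.of_forall fun η => ?_)
    (Eventually.of_forall fun η => ?_)
  · refine AEStronglyMeasurable.mul ?_ integrable_packetProfile.1
    exact ((hk.continuous_symb.comp (by fun_prop : Continuous fun η : ℝ =>
      ξ₀ + η / ((n : ℝ) + 1))).norm.pow 2).aestronglyMeasurable
  · rw [Real.norm_of_nonneg (by positivity)]
    gcongr
    exact hk.norm_symb_le _
  · refine Tendsto.mul_const _ ?_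
    have h1 : Tendsto (fun n : ℕ => ξ₀ + η / ((n : ℝ) + 1)) atTop (𝓝 ξ₀) := by
      have := (tendsto_one_div_add_atTop_nhds_zero_nat (𝕜 := ℝ)).const_mul η
      simpa [div_eq_mul_inv] using this.const_add ξ₀
    exact (((hk.continuous_symb.tendsto ξ₀).comp h1).norm).pow 2

/-- Conversely, an operator inequality on compactly supported functions is an inequality between
multipliers. -/
theorem symb_le_of_norm_opA_le {k₁ k₂ : ℝ → ℂ} (hk₁ : IsL2Kernel k₁) (hk₂ : IsL2Kernel k₂)
    {C : ℝ} (hC : 0 ≤ C)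
    (h : ∀ f ∈ cptL2, ‖opA k₁ hk₁ f‖ ≤ C * ‖opA k₂ hk₂ f‖) (ξ : ℝ) :
    ‖symb k₁ (critLine ξ)‖ ≤ C * ‖symb k₂ (critLine ξ)‖ := by
  have hle := le_of_tendsto_of_tendsto' (tendsto_packet hk₁ ξ)
    ((tendsto_packet hk₂ ξ).const_mul (C ^ 2)) fun n => by
      have hn : (0 : ℝ) < (n : ℝ) + 1 := by positivity
      have h1 := pow_le_pow_left₀ (norm_nonneg _) (h _ (packet_mem_cptL2 ξ n)) 2
      rw [mul_pow, norm_sq_opA_packet, norm_sq_opA_packet, mul_left_comm] at h1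
      exact le_of_mul_le_mul_left h1 hn
  rw [integral_const_mul, integral_const_mul, ← mul_assoc] at hle
  have h2 := le_of_mul_le_mul_right hle integral_packetProfile_pos
  rw [← mul_pow] at h2
  exact (abs_le_of_sq_le_sq' h2 (by positivity)).2

/-! ### Hardy-type operators with power kernels -/

/-- The power kernel `-b y^(-a)`. -/
noncomputable def powKernel (a b : ℝ) (y : ℝ) : ℂ := ((-b * y ^ (-a) : ℝ) : ℂ)

theorem integrableOn_cpow_mul_powKernel {a : ℝ} (b : ℝ) {s : ℂ} (hs : s.re < a) :
    IntegrableOn (fun y : ℝ => (y : ℂ) ^ (s - 1) * powKernel a b y) (Ioi 1) ∧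
      1 + ∫ y in Ioi (1 : ℝ), (y : ℂ) ^ (s - 1) * powKernel a b y = 1 + b / (s - a) := by
  have e : ∀ y ∈ Ioi (1 : ℝ), -(b : ℂ) * (y : ℂ) ^ (s - 1 - a) =
      (y : ℂ) ^ (s - 1) * powKernel a b y := by
    intro y hy
    have hy0 : (0 : ℝ) < y := lt_trans one_pos hy
    have hy0' : (y : ℂ) ≠ 0 := by exact_mod_cast hy0.ne'
    rw [powKernel, Complex.ofReal_mul, Complex.ofReal_cpow hy0.le, sub_eq_add_neg _ (a : ℂ),
      Complex.cpow_add _ _ hy0']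
    push_cast
    ring
  have hre : (s - 1 - a).re < -1 := by simp; linarith
  have hi : IntegrableOn (fun y : ℝ => (y : ℂ) ^ (s - 1 - a)) (Ioi 1) :=
    integrableOn_Ioi_cpow_of_lt hre one_pos
  refine ⟨IntegrableOn.congr_fun (hi.const_mul _) e measurableSet_Ioi, ?_⟩
  rw [← setIntegral_congr_fun measurableSet_Ioi e, integral_const_mul,
    integral_Ioi_cpow_of_lt hre one_pos]
  have h0 : s - a ≠ 0 := fun h => by
    have := congrArg Complex.re h
    simp at this; linarith
  rw [Complex.ofReal_one, Complex.one_cpow, show s - 1 - a + 1 = s - a by ring]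
  field_simp

theorem continuousOn_powKernel (a b : ℝ) : ContinuousOn (powKernel a b) (Ioi 1) := fun y hy =>
  (Complex.continuous_ofReal.continuousAt.comp (continuousAt_const.mul
    (Real.continuousAt_rpow_const y _ (Or.inl (lt_trans one_pos hy).ne')))).continuousWithinAt

theorem isL2Kernel_powKernel {a : ℝ} (ha : 1 / 2 < a) (b : ℝ) : IsL2Kernel (powKernel a b) :=
  ⟨continuousOn_powKernel a b, (integrableOn_cpow_mul_powKernel b (by norm_num; linarith)).1⟩

theorem symb_powKernel {a : ℝ} (b : ℝ) {s : ℂ} (hs : s.re < a) :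
    symb (powKernel a b) s = 1 + b / (s - a) :=
  (integrableOn_cpow_mul_powKernel b hs).2

theorem mconv_powKernel (a b : ℝ) (f : ℝ → ℂ) {x : ℝ} (hx : 0 < x) :
    mconv (powKernel a b) f x =
      ((-b * x ^ (-a) : ℝ) : ℂ) * ∫ t in Ioo 0 x, ((t ^ (a - 1) : ℝ) : ℂ) * f t := by
  rw [← integral_const_mul, mconv]
  refine setIntegral_congr_fun measurableSet_Ioo fun t ht => ?_
  have ht0 := ht.1
  simp only [powKernel]
  rw [Real.div_rpow hx.le ht0.le, Real.rpow_neg ht0.le, Real.rpow_sub_one ht0.ne']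
  push_cast
  have : (t : ℂ) ≠ 0 := by exact_mod_cast ht0.ne'
  have h2 : ((t ^ a : ℝ) : ℂ) ≠ 0 := by exact_mod_cast (Real.rpow_pos_of_pos ht0 a).ne'
  field_simp

theorem isDiffKernel_rpow (b : ℝ) :
    IsDiffKernel (fun y => ((y ^ b : ℝ) : ℂ)) (fun y => ((b * y ^ (b - 1) : ℝ) : ℂ)) b where
  continuousOn := fun y hy => (Complex.continuous_ofReal.continuousAt.comp
    (Real.continuousAt_rpow_const y _
      (Or.inl (lt_of_lt_of_le one_pos hy).ne'))).continuousWithinAt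
  map_one := by simp
  hasDerivAt := fun y hy =>
    (Real.hasDerivAt_rpow_const (Or.inl (lt_trans one_pos hy).ne')).ofReal_comp
  continuousOn_deriv := fun y hy => (Complex.continuous_ofReal.continuousAt.comp
    (continuousAt_const.mul (Real.continuousAt_rpow_const y _
      (Or.inl (lt_trans one_pos hy).ne')))).continuousWithinAt
  bound := ⟨1, zero_le_one, fun y hy => by
    rw [Complex.norm_real, Real.norm_of_nonneg (by positivity), one_mul]⟩
  bound_deriv := ⟨|b|, abs_nonneg b, fun y hy => by
    have hy0 : (0 : ℝ) < y := by linarith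
    rw [Complex.norm_real, norm_mul, Real.norm_of_nonneg (Real.rpow_nonneg hy0.le _),
      Real.norm_eq_abs]⟩

theorem setIntegral_Ioo_zero_eq_of_vanish {F : ℝ → ℂ} {c x : ℝ} (hc : 0 < c)
    (hF : ∀ t, t ≤ c → F t = 0) : ∫ t in Ioo 0 x, F t = ∫ t in Ioo c x, F t := by
  rw [← integral_indicator measurableSet_Ioo, ← integral_indicator measurableSet_Ioo]
  congr 1
  funext t
  by_cases h : t ∈ Ioo c x
  · rw [indicator_of_mem h, indicator_of_mem (show t ∈ Ioo 0 x from ⟨hc.trans h.1, h.2⟩)]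
  · rw [indicator_of_notMem h]
    by_cases h2 : t ∈ Ioo 0 x
    · rw [indicator_of_mem h2]
      exact hF t (not_lt.mp fun h3 => h ⟨h3, h2.2⟩)
    · rw [indicator_of_notMem h2]

theorem setIntegral_Ioo_eq_of_vanish {F : ℝ → ℂ} {u x : ℝ} (hu : 0 < u) (hux : u < x)
    (hF : ∀ t, t ≤ u → F t = 0) : ∫ t in Ioo 0 x, F t = ∫ t in u..x, F t := by
  rw [intervalIntegral.integral_of_le hux.le, integral_Ioc_eq_integral_Ioo,
    setIntegral_Ioo_zero_eq_of_vanish hu hF]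

/-- The equation `h + mconv (powKernel a b) h = g` is solved by
`h = g + b x^(b-a) ∫_0^x t^(a-1-b) g(t) dt`, which has compact support when the last integral
vanishes for large `x`. -/
theorem exists_opA_powKernel_eq {a b : ℝ} (ha : 1 / 2 < a) {u v : ℝ} (hu : 0 < u) (huv : u < v)
    {g : ℝ → ℂ} (hg : MemLp g 2 (volume.restrict (Ioi (0 : ℝ))))
    (hg0 : ∀ t, t ∉ Ioo u v → g t = 0)
    (hgi : ∫ t in Ioo u v, ((t ^ (a - 1 - b) : ℝ) : ℂ) * g t = 0) :
    ∃ h : L2, opA (powKernel a b) (isL2Kernel_powKernel ha b) h = hg.toLp g := by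
  have hgI : IntegrableOn g (Icc u v) :=
    (hg.mono_measure (Measure.restrict_mono (fun t ht => hu.trans_le ht.1) le_rfl)).integrable
      (by norm_num)
  have hpow : ∀ c : ℝ, ContinuousOn (fun t : ℝ => ((t ^ c : ℝ) : ℂ)) (Icc u v) := fun c t ht =>
    (Complex.continuous_ofReal.continuousAt.comp (Real.continuousAt_rpow_const t c
      (Or.inl (hu.trans_le ht.1).ne'))).continuousWithinAt
  have hgc : ∀ c : ℝ, Integrable fun t : ℝ => ((t ^ c : ℝ) : ℂ) * g t := fun c => by
    have h1 := hgI.continuousOn_mul (hpow c) isCompact_Icc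
    refine ((integrable_indicator_iff measurableSet_Icc).mpr h1).congr
      (Eventually.of_forall fun t => ?_)
    by_cases ht : t ∈ Icc u v
    · simp only [indicator_of_mem ht]
    · simp only [indicator_of_notMem ht]
      rw [hg0 t fun h => ht (Ioo_subset_Icc_self h), mul_zero]
  set E : ℝ → ℂ := fun t => ((t ^ (a - 1 - b) : ℝ) : ℂ) * g t with hE
  have hE0 : ∀ t, t ∉ Ioo u v → E t = 0 := fun t ht => by rw [hE]; simp only [hg0 t ht, mul_zero]
  set Φ : ℝ → ℂ := fun x => ∫ t in u..x, E t with hΦ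
  have hΦc : Continuous Φ := intervalIntegral.continuous_primitive
    (fun _ _ => (hgc (a - 1 - b)).intervalIntegrable) u
  have hΦ1 : ∀ x, x ≤ u → Φ x = 0 := fun x hx => by
    rw [hΦ]
    simp only
    rw [intervalIntegral.integral_congr (g := fun _ => 0), intervalIntegral.integral_zero]
    intro t ht
    rw [uIcc_of_ge hx] at ht
    exact hE0 t fun h => absurd h.1 (not_lt.mpr ht.2)
  have hΦ2 : ∀ x, v ≤ x → Φ x = 0 := fun x hx => by
    have h1 : Φ x = Φ v + ∫ t in v..x, E t :=
      (intervalIntegral.integral_add_adjacent_intervals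
        (hgc (a - 1 - b)).intervalIntegrable (hgc (a - 1 - b)).intervalIntegrable).symm
    have h2 : Φ v = 0 := by
      rw [hΦ]; simp only
      rw [intervalIntegral.integral_of_le huv.le, integral_Ioc_eq_integral_Ioo, hgi]
    rw [h1, h2, intervalIntegral.integral_congr (g := fun _ => 0),
      intervalIntegral.integral_zero, add_zero]
    intro t ht
    rw [uIcc_of_le hx] at ht
    exact hE0 t fun h => absurd h.2 (not_lt.mpr ht.1)
  have hΦ3 : ∀ x, 0 < x → ∫ t in Ioo 0 x, E t = Φ x := fun x hx => by
    rcases le_or_gt x u with h | h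
    · rw [hΦ1 x h]
      refine setIntegral_eq_zero_of_forall_eq_zero fun t ht => hE0 t fun h' => ?_
      linarith [h'.1, ht.2]
    · exact setIntegral_Ioo_eq_of_vanish hu h fun t ht =>
        hE0 t fun h' => absurd h'.1 (not_lt.mpr ht)
  set ψ : ℝ → ℂ := fun x => ((b * x ^ (b - a) : ℝ) : ℂ) * Φ x with hψ
  have hψ1 : ∀ x, x ≤ u → ψ x = 0 := fun x hx => by rw [hψ]; simp only [hΦ1 x hx, mul_zero]
  have hψL : MemLp ψ 2 (volume.restrict (Ioi (0 : ℝ))) := by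
    have hc : ContinuousOn ψ (Icc u v) := by
      refine ContinuousOn.mul ?_ hΦc.continuousOn
      have := (hpow (b - a)).const_smul b
      refine this.congr fun t ht => ?_
      simp
    have h1 : MemLp ψ 2 (volume.restrict (Icc u v)) := by
      obtain ⟨M, hM⟩ := isCompact_Icc.exists_bound_of_continuousOn hc
      refine MemLp.of_bound (hc.aestronglyMeasurable measurableSet_Icc) M ?_
      filter_upwards [ae_restrict_mem measurableSet_Icc] with t ht using hM t ht
    have h2 : (Icc u v).indicator ψ = ψ := by
      refine indicator_eq_self.mpr fun t ht => ?_
      by_contra h3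
      refine ht ?_
      rcases not_and_or.mp h3 with h4 | h4
      · exact hψ1 t (not_le.mp h4).le
      · rw [hψ]; simp only [hΦ2 t (not_le.mp h4).le, mul_zero]
    rw [← h2]
    exact MemLp.restrict _ ((memLp_indicator_iff_restrict measurableSet_Icc).mpr h1)
  have hhL := hg.add hψL
  refine ⟨hhL.toLp _, ?_⟩
  have hae := coeFn_opA (isL2Kernel_powKernel ha b) (hhL.toLp _)
  rw [mconv_congr _ hhL.coeFn_toLp] at hae
  refine Lp.ext ?_
  filter_upwards [hae, hhL.coeFn_toLp, hg.coeFn_toLp, ae_restrict_mem measurableSet_Ioi]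
    with x h1 h2 h3 hx
  have hx0 : (0 : ℝ) < x := hx
  rw [h1, h2, h3, Pi.add_apply, mconv_powKernel a b _ hx0]
  suffices hs : ∫ t in Ioo 0 x, ((t ^ (a - 1) : ℝ) : ℂ) * (g + ψ) t = ((x ^ b : ℝ) : ℂ) * Φ x by
    rw [hs, hψ]
    simp only
    rw [Real.rpow_sub hx0, Real.rpow_neg hx0.le]
    push_cast
    ring
  -- the integrand is the derivative of `x^b Φ(x)`
  have hv : ∀ t, t ≤ u → (g + ψ) t = 0 := fun t ht => by
    rw [Pi.add_apply, hψ1 t ht, hg0 t fun h' => absurd h'.1 (not_lt.mpr ht), add_zero]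
  rcases le_or_gt x u with h | h
  · rw [hΦ1 x h, mul_zero]
    refine setIntegral_eq_zero_of_forall_eq_zero fun t ht => ?_
    rw [hv t (ht.2.le.trans h), mul_zero]
  rw [setIntegral_Ioo_eq_of_vanish hu h fun t ht => by rw [hv t ht, mul_zero]]
  set f : ℝ → ℂ := fun t => ((t ^ (a - 1) : ℝ) : ℂ) * g t with hf
  have hfE : ∀ t, 0 < t → ((t ^ (-b) : ℝ) : ℂ) * f t = E t := fun t ht => by
    simp only [hf, hE]
    rw [← mul_assoc, ← Complex.ofReal_mul, ← Real.rpow_add ht,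
      show -b + (a - 1) = a - 1 - b by ring]
  have hloc : LocInt b f := fun X hX =>
    ((hgc (a - 1 - b)).integrableOn (s := Ioo 0 X)).congr_fun
      (fun t ht => (hfE t ht.1).symm) measurableSet_Ioo
  have hkey := (isDiffKernel_rpow b).kernelInt_sub hloc hu h
  have hK : ∀ y, 0 < y → kernelInt (fun y => ((y ^ b : ℝ) : ℂ)) f y = ((y ^ b : ℝ) : ℂ) * Φ y :=
    fun y hy => by
      rw [← hΦ3 y hy, ← integral_const_mul, kernelInt]
      refine setIntegral_congr_fun measurableSet_Ioo fun t ht => ?_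
      rw [← hfE t ht.1, Real.div_rpow hy.le ht.1.le, Real.rpow_neg ht.1.le]
      push_cast
      ring
  rw [hK x hx0, hK u hu, hΦ1 u le_rfl, mul_zero, sub_zero] at hkey
  rw [hkey]
  refine intervalIntegral.integral_congr fun y hy => ?_
  rw [uIcc_of_le h.le] at hy
  have hy0 : 0 < y := hu.trans_le hy.1
  simp only [Pi.add_apply]
  have hm : mconv (fun y => ((b * y ^ (b - 1) : ℝ) : ℂ)) f y =
      ((b * y ^ (b - 1) : ℝ) : ℂ) * Φ y := by
    rw [← hΦ3 y hy0, ← integral_const_mul, mconv]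
    refine setIntegral_congr_fun measurableSet_Ioo fun t ht => ?_
    have ht0 := ht.1
    have h5 : (t : ℂ) ≠ 0 := by exact_mod_cast ht0.ne'
    have h6 : ((t ^ b : ℝ) : ℂ) ≠ 0 := by exact_mod_cast (Real.rpow_pos_of_pos ht0 b).ne'
    rw [← hfE t ht.1, Real.div_rpow hy0.le ht.1.le, Real.rpow_neg ht.1.le,
      Real.rpow_sub_one ht0.ne']
    push_cast
    field_simp
  rw [hm, mul_add, hψ]
  simp only [hf]
  rw [← mul_assoc, ← Complex.ofReal_mul]
  congr 3
  rw [show b - 1 = (a - 1) + (b - a) by ring, Real.rpow_add hy0]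
  ring

/-- A function orthogonal to the range is orthogonal to every compactly supported `g` with
`∫ t^(a-1-b) g(t) dt = 0`, hence is a multiple of `t^(a-1-b)`, hence vanishes. -/
theorem denseRange_opA_powKernel {a : ℝ} (ha : 1 / 2 < a) (b : ℝ) :
    DenseRange (opA (powKernel a b) (isL2Kernel_powKernel ha b)) := by
  set A := opA (powKernel a b) (isL2Kernel_powKernel ha b) with hA
  set p : ℝ := a - 1 - b with hp
  have hS : (LinearMap.range (A : L2 →ₗ[ℂ] L2)).topologicalClosure = ⊤ := by
    rw [Submodule.topologicalClosure_eq_top_iff, Submodule.eq_bot_iff]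
    intro G hG
    rw [Submodule.mem_orthogonal] at hG
    -- on every compact interval `G` is a multiple of `t^p`
    have hloc : ∀ n : ℕ, ∃ c : ℂ, ∀ᵐ t ∂(volume.restrict (Ioi (0 : ℝ))),
        t ∈ Ioo (1 / ((n : ℝ) + 2)) ((n : ℝ) + 2) → G t = c * ((t ^ p : ℝ) : ℂ) := by
      intro n
      have hn : (0 : ℝ) < (n : ℝ) + 2 := by positivity
      set u := 1 / ((n : ℝ) + 2) with hu
      set v := (n : ℝ) + 2 with hv
      have hu0 : 0 < u := by positivity
      have huv : u < v := by
        rw [hu, div_lt_iff₀ hn]; nlinarith [(Nat.cast_nonneg n : (0 : ℝ) ≤ n)]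
      have hvL : MemLp ((Ioo u v).indicator fun t : ℝ => ((t ^ p : ℝ) : ℂ)) 2
          (volume.restrict (Ioi (0 : ℝ))) := by
        refine MemLp.restrict _ ((memLp_indicator_iff_restrict measurableSet_Ioo).mpr ?_)
        have hc : ContinuousOn (fun t : ℝ => ((t ^ p : ℝ) : ℂ)) (Icc u v) := fun t ht =>
          (Complex.continuous_ofReal.continuousAt.comp (Real.continuousAt_rpow_const t p
            (Or.inl (hu0.trans_le ht.1).ne'))).continuousWithinAt
        obtain ⟨M, hM⟩ := isCompact_Icc.exists_bound_of_continuousOn hc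
        refine MemLp.of_bound ((hc.mono Ioo_subset_Icc_self).aestronglyMeasurable
          measurableSet_Ioo) M ?_
        filter_upwards [ae_restrict_mem measurableSet_Ioo] with t ht
          using hM t (Ioo_subset_Icc_self ht)
      have hGL : MemLp ((Ioo u v).indicator G) 2 (volume.restrict (Ioi (0 : ℝ))) :=
        (Lp.memLp G).indicator measurableSet_Ioo
      set V : L2 := hvL.toLp _ with hV
      set H : L2 := hGL.toLp _ with hH
      set c : ℂ := inner ℂ V H / inner ℂ V V with hc
      have hgL := hGL.sub (hvL.const_smul c)
      set g := (Ioo u v).indicator G - c • (Ioo u v).indicator fun t : ℝ => ((t ^ p : ℝ) : ℂ)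
        with hg
      have hg0 : ∀ t, t ∉ Ioo u v → g t = 0 := fun t ht => by
        simp [hg, indicator_of_notMem ht]
      have hgHV : hgL.toLp g = H - c • V := by
        rw [hH, hV, ← MemLp.toLp_const_smul, ← MemLp.toLp_sub]
      have hVg : inner ℂ V (hgL.toLp g) = 0 := by
        rw [hgHV, inner_sub_right, inner_smul_right, hc]
        by_cases h0 : inner ℂ V V = 0
        · rw [inner_self_eq_zero.mp h0]; simp
        · field_simp
          simp
      have hgi : ∫ t in Ioo u v, ((t ^ p : ℝ) : ℂ) * g t = 0 := by
        rw [← hVg, L2.inner_def, ← integral_indicator measurableSet_Ioo,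
          ← integral_indicator measurableSet_Ioi]
        have h1 : (Ioo u v).indicator (fun t : ℝ => ((t ^ p : ℝ) : ℂ) * g t) =
            (Ioi 0).indicator fun t => inner ℂ
              ((Ioo u v).indicator (fun t : ℝ => ((t ^ p : ℝ) : ℂ)) t) (g t) := by
          funext t
          by_cases ht : t ∈ Ioo u v
          · rw [indicator_of_mem ht, indicator_of_mem (show t ∈ Ioi 0 from hu0.trans ht.1),
              indicator_of_mem ht, RCLike.inner_apply, Complex.conj_ofReal, mul_comm]
          · rw [indicator_of_notMem ht]
            by_cases h2 : t ∈ Ioi (0 : ℝ)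
            · rw [indicator_of_mem h2, indicator_of_notMem ht, inner_zero_left]
            · rw [indicator_of_notMem h2]
        rw [h1, integral_indicator measurableSet_Ioi, integral_indicator measurableSet_Ioi]
        refine integral_congr_ae ?_
        filter_upwards [hvL.coeFn_toLp, hgL.coeFn_toLp] with t h2 h3
        rw [h2, h3]
      obtain ⟨h, hh⟩ := exists_opA_powKernel_eq ha hu0 huv hgL hg0 hgi
      have hgG : inner ℂ (hgL.toLp g) G = 0 := hG _ ⟨h, hh⟩
      have hgH : inner ℂ (hgL.toLp g) H = inner ℂ (hgL.toLp g) G := by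
        rw [L2.inner_def, L2.inner_def]
        refine integral_congr_ae ?_
        filter_upwards [hgL.coeFn_toLp, hGL.coeFn_toLp] with t h2 h3
        rw [h3, h2]
        by_cases ht : t ∈ Ioo u v
        · rw [indicator_of_mem ht]
        · rw [hg0 t ht, inner_zero_left, inner_zero_left]
      have hzero : hgL.toLp g = 0 := by
        rw [← inner_self_eq_zero (𝕜 := ℂ)]
        nth_rw 2 [hgHV]
        rw [inner_sub_right, inner_smul_right, hgH, hgG, ← inner_conj_symm, hVg]
        simp
      refine ⟨c, ?_⟩
      filter_upwards [hgL.coeFn_toLp, (Lp.eq_zero_iff_ae_eq_zero).mp hzero] with t h1 h2 ht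
      rw [h2, hg, Pi.sub_apply, Pi.smul_apply, indicator_of_mem ht, indicator_of_mem ht] at h1
      exact (sub_eq_zero.mp h1.symm)
    choose c hc using hloc
    have hcc : ∀ n, c n = c 0 := by
      intro n
      have hn : (0 : ℝ) ≤ n := Nat.cast_nonneg n
      have hpos : volume.restrict (Ioi (0 : ℝ)) (Ioo 1 2) ≠ 0 := by
        have hsub : Ioo (1 : ℝ) 2 ⊆ Ioi 0 := fun x hx => lt_trans one_pos hx.1
        rw [Measure.restrict_apply measurableSet_Ioo, inter_eq_left.mpr hsub]
        simp
      obtain ⟨t, ht, h1, h2⟩ := (Frequently.and_eventually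
        (frequently_ae_mem_iff.mpr hpos) ((hc n).and (hc 0))).exists
      have ht0 : (0 : ℝ) < t := lt_trans one_pos ht.1
      have h3 : ∀ m : ℕ, t ∈ Ioo (1 / ((m : ℝ) + 2)) ((m : ℝ) + 2) := fun m => by
        have hm : (0 : ℝ) ≤ m := Nat.cast_nonneg m
        refine ⟨lt_trans ?_ ht.1, by linarith [ht.2]⟩
        rw [div_lt_one (by positivity)]; linarith
      have h4 := (h1 (h3 n)).symm.trans (h2 (h3 0))
      exact mul_right_cancel₀ (by exact_mod_cast (Real.rpow_pos_of_pos ht0 p).ne') h4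
    have hG : ∀ᵐ t ∂(volume.restrict (Ioi (0 : ℝ))), G t = c 0 * ((t ^ p : ℝ) : ℂ) := by
      filter_upwards [ae_all_iff.mpr hc, ae_restrict_mem measurableSet_Ioi] with x hx hx0
      have hx0' : (0 : ℝ) < x := hx0
      obtain ⟨n, hn⟩ := exists_nat_gt (max x (1 / x))
      rw [← hcc n]
      refine hx n ⟨?_, ?_⟩
      · rw [one_div_lt (by positivity) hx0']
        linarith [le_max_right x (1 / x)]
      · linarith [le_max_left x (1 / x)]
    -- no power is square integrable on the half-line
    have hc0 : c 0 = 0 := by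
      by_contra hne
      refine not_integrableOn_Ioi_rpow (2 * p) ?_
      have h1 := (memLp_two_iff_integrable_sq_norm (Lp.memLp G).1).mp (Lp.memLp G)
      refine (h1.const_mul ((‖c 0‖ ^ 2)⁻¹)).congr ?_
      filter_upwards [hG, ae_restrict_mem measurableSet_Ioi] with t ht ht0
      have ht0' : (0 : ℝ) < t := ht0
      have : ‖c 0‖ ≠ 0 := norm_ne_zero_iff.mpr hne
      rw [ht, norm_mul, Complex.norm_real, Real.norm_of_nonneg (by positivity), mul_pow,
        inv_mul_cancel_left₀ (by positivity), ← Real.rpow_natCast, ← Real.rpow_mul ht0'.le]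
      congr 1
      push_cast
      ring
    refine (Lp.eq_zero_iff_ae_eq_zero).mpr ?_
    filter_upwards [hG] with t ht
    rw [ht, hc0, zero_mul]; rfl
  have := Submodule.dense_iff_topologicalClosure_eq_top.mpr hS
  rwa [LinearMap.coe_range] at this

/-! ### The operator as `f + mconv (legendreQ ν) f` -/

theorem MellinConvergent.locInt {f : ℝ → ℂ} {s : ℂ} (hf : MellinConvergent f s) :
    LocInt (1 - s.re) f := by
  intro X hX
  have h1 : IntegrableOn (fun t : ℝ => (t : ℂ) ^ (s - 1) * f t) (Ioo 0 X) :=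
    IntegrableOn.mono_set hf Ioo_subset_Ioi_self
  have h2 : IntegrableOn (fun t : ℝ => (t : ℂ) ^ (-(s.im * Complex.I)) *
      ((t : ℂ) ^ (s - 1) * f t)) (Ioo 0 X) := by
    refine Integrable.bdd_mul (c := 1) h1 (by fun_prop : Measurable _).aestronglyMeasurable ?_
    filter_upwards [ae_restrict_mem measurableSet_Ioo] with t ht
    rw [Complex.norm_cpow_eq_rpow_re_of_pos ht.1]
    simp
  refine h2.congr_fun (fun t ht => ?_) measurableSet_Ioo
  have ht0 : (t : ℂ) ≠ 0 := by exact_mod_cast ht.1.ne'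
  simp only
  rw [← mul_assoc, ← Complex.cpow_add _ _ ht0, Complex.ofReal_cpow ht.1.le]
  congr 2
  apply Complex.ext <;> simp

theorem admissible_of_locInt {ν : ℂ} {c : ℝ} (hd : IsDiffKernel (legendreP ν) (legendreQ ν) c)
    {f : ℝ → ℂ} (hf : LocInt c f) : Admissible ν f := by
  refine ⟨fun x hx => hd.integrableOn hf hx, ?_⟩
  filter_upwards [hd.ae_hasDerivAt hf] with x hx
  exact HasDerivAt.differentiableAt hx

theorem opS_ae_eq {ν : ℂ} {c : ℝ} (hd : IsDiffKernel (legendreP ν) (legendreQ ν) c)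
    {f : ℝ → ℂ} (hf : LocInt c f) :
    opS ν f =ᵐ[volume.restrict (Ioi (0 : ℝ))] fun x => f x + mconv (legendreQ ν) f x := by
  filter_upwards [hd.ae_hasDerivAt hf] with x hx
  exact HasDerivAt.deriv hx

theorem mellin_opS (ν s : ℂ) (hs : s.re < min (2 + ν.re) (1 - ν.re)) (f : ℝ → ℂ)
    (hf : MellinConvergent f s) :
    Admissible ν f ∧ MellinConvergent (opS ν f) s ∧
      mellin (opS ν f) s = multiplier ν s * mellin f s := by
  obtain ⟨h1, h2⟩ := lt_min_iff.mp hs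
  have hd : IsDiffKernel (legendreP ν) (legendreQ ν) (1 - s.re) :=
    isDiffKernel_legendre (by linarith) (by linarith)
  have hl := MellinConvergent.locInt hf
  have hae := opS_ae_eq hd hl
  obtain ⟨h3, h4⟩ := hasMellin_add_mconv (continuousOn_legendreQ ν)
    (integrableOn_cpow_mul_legendreQ ν hs) hf
  refine ⟨admissible_of_locInt hd hl, MellinConvergent.congr_ae h3 hae.symm, ?_⟩
  rw [mellin_congr_ae hae, h4, symb, one_add_integral_cpow_mul_legendreQ ν hs]

/-! ### Square integrable functions and degrees `-3/2 < ν < 1/2` -/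

theorem MemLp.locInt {f : ℝ → ℂ} (hf : MemLp f 2 (volume.restrict (Ioi (0 : ℝ)))) {c : ℝ}
    (hc : c < 1 / 2) : LocInt c f := by
  intro X hX
  have h1 : MemLp f 2 (volume.restrict (Ioo 0 X)) :=
    hf.mono_measure (Measure.restrict_mono Ioo_subset_Ioi_self le_rfl)
  have hm : AEStronglyMeasurable (fun t : ℝ => ((t ^ (-c) : ℝ) : ℂ)) (volume.restrict (Ioo 0 X)) :=
    (by fun_prop : Measurable _).aestronglyMeasurable
  have h2 : MemLp (fun t : ℝ => ((t ^ (-c) : ℝ) : ℂ)) 2 (volume.restrict (Ioo 0 X)) := by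
    refine (memLp_two_iff_integrable_sq_norm hm).mpr ?_
    have h3 : IntegrableOn (fun t : ℝ => t ^ (-(2 * c))) (Ioo 0 X) := by
      rw [← integrableOn_Ioc_iff_integrableOn_Ioo,
        ← intervalIntegrable_iff_integrableOn_Ioc_of_le hX.le]
      exact intervalIntegral.intervalIntegrable_rpow' (by linarith)
    refine IntegrableOn.congr_fun h3 (fun t ht => ?_) measurableSet_Ioo
    rw [Complex.norm_real, Real.norm_of_nonneg (Real.rpow_nonneg ht.1.le _), ← Real.rpow_natCast,
      ← Real.rpow_mul ht.1.le]
    congr 1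
    push_cast
    ring
  exact h2.integrable_mul h1

theorem isL2Kernel_legendreQ {ν : ℂ} (h1 : -3 / 2 < ν.re) (h2 : ν.re < 1 / 2) :
    IsL2Kernel (legendreQ ν) :=
  ⟨continuousOn_legendreQ ν, integrableOn_cpow_mul_legendreQ ν
    (lt_min (by norm_num; linarith) (by norm_num; linarith))⟩

/-- The norm of `S f` in `L₂(0, ∞)`. -/
noncomputable def normS (ν : ℂ) (f : ℝ → ℂ) : ℝ :=
  (eLpNorm (opS ν f) 2 (volume.restrict (Ioi (0 : ℝ)))).toReal

theorem norm_opL2 (ν : ℂ) (f : (opL2 ν).domain) : ‖opL2 ν f‖ = normS ν (f : L2) :=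
  Lp.norm_toLp _ f.2.2

theorem normS_eq_of_ae {ν : ℂ} {f : ℝ → ℂ} {g : L2}
    (h : opS ν f =ᵐ[volume.restrict (Ioi (0 : ℝ))] g) : normS ν f = ‖g‖ := by
  rw [normS, eLpNorm_congr_ae h, Lp.norm_def]

theorem opS_ae_eq_opA {ν : ℂ} (h1 : -3 / 2 < ν.re) (h2 : ν.re < 1 / 2) (f : L2) :
    Admissible ν f ∧ opS ν f =ᵐ[volume.restrict (Ioi (0 : ℝ))]
      opA (legendreQ ν) (isL2Kernel_legendreQ h1 h2) f := by
  obtain ⟨c, hc1, hc2⟩ := exists_between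
    (max_lt h2 (by linarith : -1 - ν.re < 1 / 2))
  obtain ⟨h3, h4⟩ := max_lt_iff.mp hc1
  have hd := isDiffKernel_legendre h3 h4
  have hl := MemLp.locInt (Lp.memLp f) hc2
  exact ⟨admissible_of_locInt hd hl,
    (opS_ae_eq hd hl).trans (coeFn_opA (isL2Kernel_legendreQ h1 h2) f).symm⟩

theorem domainS_eq_top {ν : ℂ} (h1 : -3 / 2 < ν.re) (h2 : ν.re < 1 / 2) : domainS ν = ⊤ := by
  refine Submodule.eq_top_iff'.mpr fun f => ?_
  obtain ⟨h3, h4⟩ := opS_ae_eq_opA h1 h2 f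
  exact ⟨h3, (memLp_congr_ae h4).mpr (Lp.memLp _)⟩

/-! ### The modulus of the multiplier on the critical line -/

/-- The reflection formula for arguments symmetric about the line `Re z = 1/2`. Both sides are `0` at
a pole of `Γ(w)`. -/
theorem norm_Gamma_conj_mul (z w : ℂ) (h : w = 1 - (starRingEnd ℂ) z) :
    ‖Complex.Gamma z * Complex.Gamma w‖ = Real.pi / ‖Complex.sin (Real.pi * w)‖ := by
  have h1 : ‖Complex.Gamma z‖ = ‖Complex.Gamma (1 - w)‖ := by
    rw [h, sub_sub_cancel, Complex.Gamma_conj, Complex.norm_conj]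
  rw [norm_mul, h1, ← norm_mul, mul_comm, Complex.Gamma_mul_Gamma_one_sub, norm_div,
    Complex.norm_real, Real.norm_of_nonneg Real.pi_pos.le]

theorem norm_sq_sin (x y : ℝ) :
    ‖Complex.sin (x + y * Complex.I)‖ ^ 2 = (Real.cosh (2 * y) - Real.cos (2 * x)) / 2 := by
  rw [← Complex.normSq_eq_norm_sq, Complex.sin_add_mul_I, Complex.normSq_apply]
  simp only [← Complex.ofReal_sin, ← Complex.ofReal_cos, ← Complex.ofReal_sinh,
    ← Complex.ofReal_cosh, ← Complex.ofReal_mul]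
  simp only [Complex.add_re, Complex.ofReal_re, Complex.re_ofReal_mul, Complex.I_re, mul_zero,
    Complex.add_im, Complex.ofReal_im, Complex.im_ofReal_mul, Complex.I_im, mul_one, add_zero,
    zero_add]
  have h1 := Real.sin_sq_add_cos_sq x
  have h2 := Real.cosh_sq y
  rw [Real.cosh_two_mul, Real.cos_two_mul]
  have h3 : Real.cosh y ^ 2 = Real.sinh y ^ 2 + 1 := h2
  linear_combination (Real.cosh y ^ 2) * h1 + (1 / 2 - Real.cos x ^ 2) * h3

theorem conj_critLine (ξ : ℝ) : (starRingEnd ℂ) (critLine ξ) = 1 - critLine ξ := by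
  simp only [critLine, map_add, map_mul, map_div₀, map_one, map_ofNat, Complex.conj_ofReal,
    Complex.conj_I]
  ring

/-- On the critical line `|m(1/2 + iτ)|² = cosh πτ / (cosh πτ - sin πν)`. -/
theorem norm_sq_multiplier (ν ξ : ℝ) :
    ‖multiplier ν (critLine ξ)‖ ^ 2 =
      Real.cosh (2 * Real.pi ^ 2 * ξ) /
        (Real.cosh (2 * Real.pi ^ 2 * ξ) - Real.sin (Real.pi * ν)) := by
  have e1 := norm_Gamma_conj_mul (-critLine ξ / 2 + ν / 2 + 1) (-critLine ξ / 2 - ν / 2 + 1 / 2) (by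
    simp only [map_add, map_neg, map_div₀, map_one, map_ofNat, Complex.conj_ofReal, conj_critLine]
    ring)
  have e2 := norm_Gamma_conj_mul (1 - critLine ξ / 2) (1 / 2 - critLine ξ / 2) (by
    simp only [map_sub, map_div₀, map_one, map_ofNat, conj_critLine]
    ring)
  have s1 := norm_sq_sin (Real.pi * (1 / 4 - ν / 2)) (-(Real.pi ^ 2 * ξ))
  have s2 := norm_sq_sin (Real.pi * (1 / 4)) (-(Real.pi ^ 2 * ξ))
  have a1 : ((Real.pi * (1 / 4 - ν / 2) : ℝ) : ℂ) + ((-(Real.pi ^ 2 * ξ) : ℝ) : ℂ) * Complex.I =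
      Real.pi * (-critLine ξ / 2 - ν / 2 + 1 / 2) := by
    simp only [critLine]; push_cast; ring
  have a2 : ((Real.pi * (1 / 4) : ℝ) : ℂ) + ((-(Real.pi ^ 2 * ξ) : ℝ) : ℂ) * Complex.I =
      Real.pi * (1 / 2 - critLine ξ / 2) := by
    simp only [critLine]; push_cast; ring
  rw [a1] at s1
  rw [a2] at s2
  have c1 : Real.cosh (2 * -(Real.pi ^ 2 * ξ)) = Real.cosh (2 * Real.pi ^ 2 * ξ) := by
    rw [← Real.cosh_neg]; congr 1; ring
  have c2 : Real.cos (2 * (Real.pi * (1 / 4 - ν / 2))) = Real.sin (Real.pi * ν) := by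
    rw [← Real.cos_pi_div_two_sub]; congr 1; ring
  have c3 : Real.cos (2 * (Real.pi * (1 / 4))) = 0 := by
    rw [← Real.cos_pi_div_two]; congr 1; ring
  rw [c1, c2] at s1
  rw [c1, c3] at s2
  rw [multiplier, norm_div, e1, mul_comm (Complex.Gamma (1 / 2 - critLine ξ / 2)), e2,
    div_div_div_cancel_left' _ _ Real.pi_ne_zero, div_pow, s1, s2, sub_zero,
    div_div_div_cancel_right₀ two_ne_zero]

theorem symb_legendreQ {ν : ℝ} (h1 : -3 / 2 < ν) (h2 : ν < 1 / 2) (ξ : ℝ) :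
    symb (legendreQ ν) (critLine ξ) = multiplier ν (critLine ξ) := by
  refine one_add_integral_cpow_mul_legendreQ ν ?_
  rw [critLine_re, Complex.ofReal_re, lt_min_iff]
  constructor <;> linarith

/-! ### Best constants -/

/-- The condition `|m(1/2 + iτ)| ≤ C` on the critical line, for `sin πν = σ`, in a form that
excludes a pole. -/
def LineBound (σ C : ℝ) : Prop := ∀ τ : ℝ, Real.cosh τ ≤ C ^ 2 * (Real.cosh τ - σ)

/-- The functions in the domain of `S` that vanish near zero. -/
def dom0 (ν : ℂ) : Set L2 :=
  {f | f ∈ domainS ν ∧ ∃ a : ℝ, 0 < a ∧ ∀ᵐ t ∂(volume.restrict (Ioi (0 : ℝ))), t < a → f t = 0}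

/-- The statement about the degree `ν` that is proved by induction: `S` is bounded by `C` if and
only if its multiplier is, and the functions vanishing near zero already determine the bound. -/
structure NormCriterion (ν : ℝ) : Prop where
  dense : Dense (dom0 (ν : ℂ))
  lineBound : ∀ C : ℝ, 0 ≤ C → (∀ f ∈ dom0 (ν : ℂ), normS ν f ≤ C * ‖f‖) →
    LineBound (Real.sin (Real.pi * ν)) C
  bound : ∀ C : ℝ, 0 ≤ C → LineBound (Real.sin (Real.pi * ν)) C →
    ∀ f ∈ domainS (ν : ℂ), normS ν (f : L2) ≤ C * ‖f‖

theorem symb_zero (s : ℂ) : symb 0 s = 1 := by simp [symb]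

theorem opA_zero (f : L2) : opA 0 isL2Kernel_zero f = f := by
  refine Lp.ext ?_
  filter_upwards [coeFn_opA isL2Kernel_zero f] with x hx
  rw [hx]
  simp [mconv]

theorem vanish_of_mem_cptL2 {f : L2} (hf : f ∈ cptL2) :
    ∃ a : ℝ, 0 < a ∧ ∀ᵐ t ∂(volume.restrict (Ioi (0 : ℝ))), t < a → f t = 0 := by
  obtain ⟨a, b, ha, -, h⟩ := hf
  refine ⟨a, ha, ?_⟩
  filter_upwards [h] with t ht hta
  exact ht fun h' => absurd h'.1 (not_lt.mpr hta.le)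

/-- The criterion when `S` is everywhere defined. -/
theorem normCriterion_of_mem_Ioo {ν : ℝ} (h1 : -3 / 2 < ν) (h2 : ν < 1 / 2) :
    NormCriterion ν := by
  have hk : IsL2Kernel (legendreQ (ν : ℂ)) := isL2Kernel_legendreQ h1 h2
  have hop : ∀ f : L2, normS ν f = ‖opA _ hk f‖ := fun f =>
    normS_eq_of_ae (opS_ae_eq_opA (ν := (ν : ℂ)) h1 h2 f).2
  have hdom : ∀ f : L2, f ∈ domainS (ν : ℂ) := fun f => by
    rw [domainS_eq_top (ν := (ν : ℂ)) h1 h2]; trivial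
  have hsub : cptL2 ⊆ dom0 (ν : ℂ) := fun f hf => ⟨hdom f, vanish_of_mem_cptL2 hf⟩
  have hσ : Real.sin (Real.pi * ν) < 1 := by
    refine lt_of_le_of_ne (Real.sin_le_one _) fun h => ?_
    obtain ⟨k, hk⟩ := Real.sin_eq_one_iff.mp h
    have h3 : ν = 2 * k + 1 / 2 := by
      have := Real.pi_pos
      refine mul_left_cancel₀ Real.pi_pos.ne' ?_
      linarith
    have h4 : (-1 : ℝ) < k := by linarith
    have h5 : (k : ℝ) < 0 := by linarith
    have h6 : (-1 : ℤ) < k := by exact_mod_cast h4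
    have h7 : k < (0 : ℤ) := by exact_mod_cast h5
    omega
  have hpos : ∀ τ : ℝ, 0 < Real.cosh τ - Real.sin (Real.pi * ν) := fun τ => by
    linarith [Real.one_le_cosh τ]
  refine ⟨dense_cptL2.mono hsub, fun C hC h τ => ?_, fun C hC h f _ => ?_⟩
  · have h3 := symb_le_of_norm_opA_le hk isL2Kernel_zero hC (fun f hf => by
      rw [← hop, opA_zero]; exact h f (hsub hf)) (τ / (2 * Real.pi ^ 2))
    rw [symb_legendreQ h1 h2, symb_zero, norm_one, mul_one] at h3
    have h4 := pow_le_pow_left₀ (norm_nonneg _) h3 2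
    have e : 2 * Real.pi ^ 2 * (τ / (2 * Real.pi ^ 2)) = τ := by
      have := Real.pi_ne_zero
      field_simp
    rwa [norm_sq_multiplier, e, div_le_iff₀ (hpos τ)] at h4
  · rw [hop]
    have h3 := norm_opA_le_of_symb_le hk isL2Kernel_zero hC (fun ξ => by
      rw [symb_legendreQ h1 h2, symb_zero, norm_one, mul_one]
      refine (abs_le_of_sq_le_sq' ?_ hC).2
      rw [norm_sq_multiplier, div_le_iff₀ (hpos _)]
      exact h _) f
    rwa [opA_zero] at h3

/-! ### Operators with a power kernel applied before a kernel integral -/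

theorem integral_triangle {w v : ℝ → ℂ} {c x : ℝ} (hw : IntegrableOn w (Ioo c x))
    (hv : IntegrableOn v (Ioo c x)) :
    ∫ t in Ioo c x, w t * ∫ u in Ioo c t, v u =
      ∫ u in Ioo c x, (∫ t in Ioo u x, w t) * v u := by
  have hms : MeasurableSet {z : ℝ × ℝ | z.2 < z.1} :=
    measurableSet_lt measurable_snd measurable_fst
  have hprod := (Integrable.mul_prod hw hv).indicator hms
  have hswap := integral_integral_swap
    (f := fun t u => {z : ℝ × ℝ | z.2 < z.1}.indicator (fun z => w z.1 * v z.2) (t, u)) hprod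
  have e1 : ∀ t u, {z : ℝ × ℝ | z.2 < z.1}.indicator (fun z => w z.1 * v z.2) (t, u) =
      (Iio t).indicator (fun u => w t * v u) u := fun t u => by
    by_cases h : u < t
    · rw [indicator_of_mem (show (t, u) ∈ {z : ℝ × ℝ | z.2 < z.1} from h),
        indicator_of_mem (show u ∈ Iio t from h)]
    · rw [indicator_of_notMem (show (t, u) ∉ {z : ℝ × ℝ | z.2 < z.1} from h),
        indicator_of_notMem (show u ∉ Iio t from h)]
  have e2 : ∀ t u, {z : ℝ × ℝ | z.2 < z.1}.indicator (fun z => w z.1 * v z.2) (t, u) =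
      (Ioi u).indicator (fun t => w t * v u) t := fun t u => by
    by_cases h : u < t
    · rw [indicator_of_mem (show (t, u) ∈ {z : ℝ × ℝ | z.2 < z.1} from h),
        indicator_of_mem (show t ∈ Ioi u from h)]
    · rw [indicator_of_notMem (show (t, u) ∉ {z : ℝ × ℝ | z.2 < z.1} from h),
        indicator_of_notMem (show t ∉ Ioi u from h)]
  have i1 : ∀ t ∈ Ioo c x, ∫ u in Ioo c x,
      {z : ℝ × ℝ | z.2 < z.1}.indicator (fun z => w z.1 * v z.2) (t, u) =
      w t * ∫ u in Ioo c t, v u := fun t ht => by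
    simp only [e1]
    rw [setIntegral_indicator measurableSet_Iio, Ioo_inter_Iio, min_eq_right ht.2.le,
      integral_const_mul]
  have i2 : ∀ u ∈ Ioo c x, ∫ t in Ioo c x,
      {z : ℝ × ℝ | z.2 < z.1}.indicator (fun z => w z.1 * v z.2) (t, u) =
      (∫ t in Ioo u x, w t) * v u := fun u hu => by
    simp only [e2]
    rw [setIntegral_indicator measurableSet_Ioi, Ioo_inter_Ioi, max_eq_right hu.1.le,
      integral_mul_const]
  rwa [setIntegral_congr_fun measurableSet_Ioo i1,
    setIntegral_congr_fun measurableSet_Ioo i2] at hswap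

/-- For functions vanishing near zero, the kernel integral with kernel `p` of
`h + mconv (powKernel a b) h` is a kernel integral of `h`, with the kernel
`p(y) - b y^(1-a) ∫_1^y p(z) z^(a-2) dz`. -/
theorem kernelInt_add_mconv_powKernel {p R h : ℝ → ℂ} {a b c : ℝ}
    (hp : ContinuousOn p (Ici 1)) (hR : ContinuousOn R (Ici 1)) (hR1 : R 1 = 0)
    (hR' : ∀ z, 1 < z → HasDerivAt R (p z * ((z ^ (a - 2) : ℝ) : ℂ)) z) (hc : 0 < c)
    (hh : ∀ X, IntegrableOn h (Icc c X)) (hh0 : ∀ t, t ≤ c → h t = 0) (x : ℝ) :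
    kernelInt p (fun t => h t + mconv (powKernel a b) h t) x =
      kernelInt (fun y => p y - ((b * y ^ (1 - a) : ℝ) : ℂ) * R y) h x := by
  rcases le_or_gt x 0 with hx | hx
  · simp [kernelInt, Ioo_eq_empty (not_lt.mpr hx)]
  rcases le_or_gt x c with hxc | hxc
  · have h0 : ∀ t ∈ Ioo 0 x, h t = 0 := fun t ht => hh0 t (ht.2.le.trans hxc)
    have h1 : ∀ t ∈ Ioo 0 x, mconv (powKernel a b) h t = 0 := fun t ht =>
      setIntegral_eq_zero_of_forall_eq_zero fun u hu => by
        rw [h0 u ⟨hu.1, hu.2.trans ht.2⟩]; simp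
    rw [kernelInt, kernelInt, setIntegral_eq_zero_of_forall_eq_zero fun t ht => by
      rw [h0 t ht, h1 t ht]; simp, setIntegral_eq_zero_of_forall_eq_zero fun t ht => by
      rw [h0 t ht]; simp]
  have hpow : ∀ e : ℝ, ContinuousOn (fun t : ℝ => ((t ^ e : ℝ) : ℂ)) (Icc c x) := fun e t ht =>
    (Complex.continuous_ofReal.continuousAt.comp (Real.continuousAt_rpow_const t e
      (Or.inl (hc.trans_le ht.1).ne'))).continuousWithinAt
  have hpx : ContinuousOn (fun t => p (x / t)) (Icc c x) := by
    refine hp.comp (continuousOn_const.div continuousOn_id fun t ht => ?_) fun t ht => ?_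
    · exact (hc.trans_le ht.1).ne'
    · exact (one_le_div (hc.trans_le ht.1)).mpr ht.2
  set w : ℝ → ℂ := fun t => p (x / t) * ((-b * t ^ (-a) : ℝ) : ℂ) with hw
  set v : ℝ → ℂ := fun t => ((t ^ (a - 1) : ℝ) : ℂ) * h t with hv
  have hwc : ContinuousOn w (Icc c x) := by
    refine hpx.mul (((hpow (-a)).const_smul (-b)).congr fun t ht => ?_)
    simp
  have hwI : IntegrableOn w (Ioo c x) := hwc.integrableOn_Icc.mono_set Ioo_subset_Icc_self
  have hvI : IntegrableOn v (Ioo c x) :=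
    ((hh x).continuousOn_mul (hpow _) isCompact_Icc).mono_set Ioo_subset_Icc_self
  have hv0 : ∀ t, t ≤ c → v t = 0 := fun t ht => by simp only [hv, hh0 t ht, mul_zero]
  have hm : ∀ t, 0 < t → mconv (powKernel a b) h t =
      ((-b * t ^ (-a) : ℝ) : ℂ) * ∫ u in Ioo c t, v u := fun t ht => by
    rw [mconv_powKernel a b h ht, setIntegral_Ioo_zero_eq_of_vanish hc hv0]
  have hm0 : ∀ t, t ≤ c → mconv (powKernel a b) h t = 0 := fun t ht => by
    refine setIntegral_eq_zero_of_forall_eq_zero fun u hu => ?_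
    rw [hh0 u (hu.2.le.trans ht)]; simp
  have hphI : IntegrableOn (fun t => p (x / t) * h t) (Ioo c x) :=
    ((hh x).continuousOn_mul hpx isCompact_Icc).mono_set Ioo_subset_Icc_self
  have hVc : ContinuousOn (fun t => ∫ u in Ioo c t, v u) (Icc c x) := by
    have h1 := intervalIntegral.continuousOn_primitive (a := c) (b := x) (μ := volume)
      (((hh x).continuousOn_mul (hpow (a - 1)) isCompact_Icc))
    refine h1.congr fun t _ => ?_
    exact (integral_Ioc_eq_integral_Ioo).symm
  have hmI : IntegrableOn (fun t => w t * ∫ u in Ioo c t, v u) (Ioo c x) :=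
    (hwc.mul hVc).integrableOn_Icc.mono_set Ioo_subset_Icc_self
  have hslice : ∀ u ∈ Ioo c x, ∫ t in Ioo u x, w t =
      -(((b * x ^ (1 - a) : ℝ) : ℂ) * R (x / u)) := fun u hu => by
    have hu0 := hc.trans hu.1
    have hder : ∀ t ∈ Ioo u x, HasDerivAt
        (fun t => ((b * x ^ (1 - a) : ℝ) : ℂ) * R (x / t)) (w t) t := fun t ht => by
      have ht0 : 0 < t := hu0.trans ht.1
      have h1 := (hR' (x / t) ((one_lt_div ht0).mpr ht.2)).scomp t
        (hasDerivAt_const_div x ht0.ne')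
      refine (h1.const_mul ((b * x ^ (1 - a) : ℝ) : ℂ)).congr_deriv ?_
      rw [Complex.real_smul, hw]
      simp only
      rw [show (p (x / t) * ((-b * t ^ (-a) : ℝ) : ℂ)) =
        ((-b * t ^ (-a) : ℝ) : ℂ) * p (x / t) by ring,
        show ((b * x ^ (1 - a) : ℝ) : ℂ) * (((-(x / t ^ 2) : ℝ) : ℂ) *
          (p (x / t) * (((x / t) ^ (a - 2) : ℝ) : ℂ))) =
          ((b * x ^ (1 - a) * (-(x / t ^ 2)) * (x / t) ^ (a - 2) : ℝ) : ℂ) * p (x / t) by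
        push_cast; ring]
      congr 2
      rw [Real.div_rpow hx.le ht0.le, Real.rpow_sub hx 1 a, Real.rpow_sub hx a 2,
        Real.rpow_sub ht0 a 2, Real.rpow_neg ht0.le, Real.rpow_one]
      norm_cast
      have h2 := (Real.rpow_pos_of_pos hx a).ne'
      have h3 := (Real.rpow_pos_of_pos ht0 a).ne'
      field_simp
    have hcont : ContinuousOn (fun t => ((b * x ^ (1 - a) : ℝ) : ℂ) * R (x / t)) (Icc u x) := by
      refine continuousOn_const.mul (hR.comp (continuousOn_const.div continuousOn_id
        fun t ht => ?_) fun t ht => ?_)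
      · exact (hu0.trans_le ht.1).ne'
      · exact (one_le_div (hu0.trans_le ht.1)).mpr ht.2
    have h1 := intervalIntegral.integral_eq_sub_of_hasDerivAt_of_le hu.2.le hcont hder
      ((intervalIntegrable_iff_integrableOn_Ioo_of_le hu.2.le).mpr
        (hwI.mono_set (Ioo_subset_Ioo_left hu.1.le)))
    rw [intervalIntegral.integral_of_le hu.2.le, integral_Ioc_eq_integral_Ioo,
      div_self hx.ne', hR1, mul_zero, zero_sub] at h1
    exact h1
  have hRI : IntegrableOn (fun u => (∫ t in Ioo u x, w t) * v u) (Ioo c x) := by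
    have h1 : ContinuousOn (fun u => -(((b * x ^ (1 - a) : ℝ) : ℂ) * R (x / u))) (Icc c x) := by
      refine (continuousOn_const.mul (hR.comp (continuousOn_const.div continuousOn_id
        fun t ht => ?_) fun t ht => ?_)).neg
      · exact (hc.trans_le ht.1).ne'
      · exact (one_le_div (hc.trans_le ht.1)).mpr ht.2
    have h2 := (((hh x).continuousOn_mul (hpow (a - 1)) isCompact_Icc).continuousOn_mul h1
      isCompact_Icc).mono_set (Ioo_subset_Icc_self (a := c) (b := x))
    exact h2.congr_fun (fun u hu => by simp only [hslice u hu, hv]) measurableSet_Ioo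
  rw [kernelInt, kernelInt, setIntegral_Ioo_zero_eq_of_vanish hc fun t ht => by
      simp only [hh0 t ht, hm0 t ht, add_zero, mul_zero],
    setIntegral_Ioo_zero_eq_of_vanish hc fun t ht => by simp only [hh0 t ht, mul_zero]]
  have e1 : ∫ t in Ioo c x, p (x / t) * (h t + mconv (powKernel a b) h t) =
      ∫ t in Ioo c x, (p (x / t) * h t + w t * ∫ u in Ioo c t, v u) := by
    refine setIntegral_congr_fun measurableSet_Ioo fun t ht => ?_
    rw [hm t (hc.trans ht.1), hw]
    ring
  rw [e1, integral_add hphI hmI, integral_triangle hwI hvI, ← integral_add hphI hRI]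
  refine setIntegral_congr_fun measurableSet_Ioo fun u hu => ?_
  have hu0 := hc.trans hu.1
  rw [hslice u hu, hv]
  simp only
  rw [Real.div_rpow hx.le hu0.le, show a - 1 = -(1 - a) by ring, Real.rpow_neg hu0.le]
  push_cast
  ring

/-! ### Kernel integrals near zero -/

theorem IsDiffKernel.integrableOn_mconv_slice {p q f : ℝ → ℂ} {c : ℝ} (hp : IsDiffKernel p q c)
    (hf : LocInt c f) {x : ℝ} (hx : 0 < x) :
    IntegrableOn (fun t => q (x / t) * (f t / t)) (Ioo 0 x) := by
  obtain ⟨C, hC, hqb⟩ := hp.bound_deriv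
  refine Integrable.mono' (((hf x hx).norm).const_mul (C * x ^ (c - 1))) ?_ ?_
  · simp only [div_eq_mul_inv (f _)]
    refine AEStronglyMeasurable.mul ?_ ((hf.aestronglyMeasurable hx).mul
      (by fun_prop : Measurable fun t : ℝ => ((t : ℂ))⁻¹).aestronglyMeasurable)
    refine ContinuousOn.aestronglyMeasurable (hp.continuousOn_deriv.comp ?_ ?_) measurableSet_Ioo
    · exact continuousOn_const.div continuousOn_id fun t ht => ht.1.ne'
    · intro t ht
      exact (one_lt_div ht.1).mpr ht.2
  · filter_upwards [ae_restrict_mem measurableSet_Ioo] with t ht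
    have ht0 := ht.1
    rw [norm_mul, norm_mul, norm_div, Complex.norm_real, Complex.norm_real,
      Real.norm_of_nonneg (Real.rpow_nonneg ht0.le _), Real.norm_of_nonneg ht0.le]
    calc ‖q (x / t)‖ * (‖f t‖ / t) ≤ (C * (x / t) ^ (c - 1)) * (‖f t‖ / t) := by
          gcongr
          exact hqb _ ((one_lt_div ht0).mpr ht.2)
      _ = _ := by
          rw [Real.div_rpow hx.le ht0.le, Real.rpow_sub_one ht0.ne', Real.rpow_neg ht0.le]
          field_simp

theorem IsDiffKernel.norm_kernelInt_le {p q f : ℝ → ℂ} {c : ℝ} (hp : IsDiffKernel p q c)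
    (hf : LocInt c f) {X : ℝ} (hX : 0 < X) : ∃ M : ℝ, ∀ x, 0 < x → x ≤ X →
    ‖kernelInt p f x‖ ≤ M * x ^ c := by
  obtain ⟨C, hC, hpb⟩ := hp.bound
  refine ⟨C * ∫ t in Ioo 0 X, ‖((t ^ (-c) : ℝ) : ℂ) * f t‖, fun x hx hxX => ?_⟩
  have h1 : ‖kernelInt p f x‖ ≤ ∫ t in Ioo 0 x, C * x ^ c * ‖((t ^ (-c) : ℝ) : ℂ) * f t‖ := by
    refine norm_integral_le_of_norm_le ((hf x hx).norm.const_mul _) ?_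
    filter_upwards [ae_restrict_mem measurableSet_Ioo] with t ht
    have ht0 := ht.1
    rw [norm_mul, norm_mul, Complex.norm_real, Real.norm_of_nonneg (by positivity), ← mul_assoc]
    gcongr
    refine (hpb _ ((one_le_div ht0).mpr ht.2.le)).trans_eq ?_
    rw [Real.div_rpow hx.le ht0.le, Real.rpow_neg ht0.le]
    ring
  rw [integral_const_mul] at h1
  refine h1.trans ?_
  rw [mul_right_comm]
  refine mul_le_mul_of_nonneg_right (mul_le_mul_of_nonneg_left ?_ hC) (by positivity)
  exact setIntegral_mono_set (hf X hX).norm (Eventually.of_forall fun _ => norm_nonneg _)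
    (Ioo_subset_Ioo_right hxX).eventuallyLE

/-- A kernel integral with `c > 0` tends to zero at zero, so that it is the primitive of its
derivative with no constant of integration. -/
theorem IsDiffKernel.kernelInt_eq {p q f : ℝ → ℂ} {c : ℝ} (hp : IsDiffKernel p q c)
    (hf : LocInt c f) (hc : 0 < c) {x : ℝ} (hx : 0 < x)
    (hI : IntegrableOn (fun y => f y + mconv q f y) (Ioo 0 x)) :
    kernelInt p f x = ∫ y in Ioo 0 x, (f y + mconv q f y) := by
  obtain ⟨M, hM⟩ := hp.norm_kernelInt_le hf hx
  set G := fun y => f y + mconv q f y with hG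
  have hI' : IntegrableOn G (Icc 0 x) := by rwa [integrableOn_Icc_iff_integrableOn_Ioo]
  have hcont := intervalIntegral.continuousOn_primitive (a := (0 : ℝ)) (b := x) hI'
  have hmem : Ioo (0 : ℝ) x ∈ 𝓝[>] (0 : ℝ) := Ioo_mem_nhdsGT hx
  have t1 : Tendsto (fun y => ∫ t in Ioc 0 y, G t) (𝓝[>] (0 : ℝ)) (𝓝 0) := by
    have h1 := (hcont 0 ⟨le_rfl, hx.le⟩).tendsto
    simp only [Ioc_self, setIntegral_empty] at h1
    refine h1.mono_left (nhdsWithin_le_iff.mpr ?_)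
    filter_upwards [hmem] with y hy using ⟨hy.1.le, hy.2.le⟩
  have t2 : Tendsto (kernelInt p f) (𝓝[>] (0 : ℝ)) (𝓝 0) := by
    have h1 : Tendsto (fun y : ℝ => M * y ^ c) (𝓝[>] (0 : ℝ)) (𝓝 0) := by
      have := ((Real.continuousAt_rpow_const 0 c (Or.inr hc.le)).tendsto.const_mul M)
      rw [Real.zero_rpow hc.ne', mul_zero] at this
      exact this.mono_left nhdsWithin_le_nhds
    refine squeeze_zero_norm' ?_ h1
    filter_upwards [hmem] with y hy using hM y hy.1 hy.2.le
  have t3 := t2.add ((tendsto_const_nhds (x := ∫ t in Ioc 0 x, G t)).sub t1)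
  refine tendsto_nhds_unique (tendsto_const_nhds.congr' ?_)
    (t3.trans_eq ?_)
  · filter_upwards [hmem] with y hy
    have h1 := hp.kernelInt_sub hf hy.1 hy.2
    rw [intervalIntegral.integral_of_le hy.2.le] at h1
    have h2 : ∫ t in Ioc 0 x, G t = (∫ t in Ioc 0 y, G t) + ∫ t in Ioc y x, G t := by
      rw [← setIntegral_union (Ioc_disjoint_Ioc_of_le le_rfl) measurableSet_Ioc
        (hI'.mono_set fun t ht => ⟨ht.1.le, ht.2.trans hy.2.le⟩)
        (hI'.mono_set fun t ht => ⟨hy.1.le.trans ht.1.le, ht.2⟩),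
        Ioc_union_Ioc_eq_Ioc hy.1.le hy.2.le]
    rw [h2, ← h1]
    ring
  · rw [zero_add, sub_zero, integral_Ioc_eq_integral_Ioo]

/-! ### Raising the degree by two -/

/-- For `ν ≥ 0` the exact growth `P_ν(y) = O(y^ν)` is available, which is what
`locInt_of_admissible` requires. -/
theorem isDiffKernel_legendre_self {ν : ℝ} (hν : 0 ≤ ν) :
    IsDiffKernel (legendreP ν) (legendreQ ν) ν := by
  obtain ⟨D, hD, hQ⟩ := exists_norm_legendreQ_le ν
  have hR : ∀ y, 1 ≤ y → legendreR ν y ≤ 2 ^ ν * y ^ ν := fun y hy => by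
    have := legendreR_le hν hy
    rwa [Real.mul_rpow zero_le_two (by linarith)] at this
  refine ⟨continuousOn_legendreP ν, legendreP_one ν, fun y hy => hasDerivAt_legendreP ν hy,
    continuousOn_legendreQ ν, ⟨2 ^ ν, by positivity, fun y hy =>
      (norm_legendreP_le ν hy).trans (hR y hy)⟩, ⟨D * 2 ^ ν, by positivity, fun y hy =>
      (hQ y hy).trans ?_⟩⟩
  have hy0 : 0 < y := by linarith
  rw [Complex.ofReal_re, mul_assoc, Real.rpow_sub_one hy0.ne', ← mul_div_assoc (2 ^ ν)]
  exact mul_le_mul_of_nonneg_left (div_le_div_of_nonneg_right (hR y hy.le) hy0.le) hD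

theorem isDiffKernel_legendre_sub_two {ν : ℝ} (hν : 1 / 2 < ν) :
    IsDiffKernel (legendreP (ν - 2 : ℝ)) (legendreQ (ν - 2 : ℝ)) ν :=
  isDiffKernel_legendre (by simp) (by simp; linarith)

/-- The contiguity relation `y (P_ν' - P_{ν-2}') = ν P_ν + (ν - 1) P_{ν-2}`. -/
theorem mul_legendreQ_sub (ν : ℝ) {y : ℝ} (hy : 1 < y) :
    (y : ℂ) * (legendreQ ν y - legendreQ (ν - 2 : ℝ) y) =
      ν * legendreP ν y + (ν - 1) * legendreP (ν - 2 : ℝ) y := by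
  have h1 := legendreQ_sub_one (ν : ℂ) hy
  have h2 := legendreQ_sub_one' (ν : ℂ) hy
  push_cast
  linear_combination h2 - h1

/-- The kernel `y^(ν-1) (ν P_ν + (ν - 1) P_{ν-2}) / (2ν - 1)`, whose derivative is
`y^(ν-1) P_ν'`. -/
noncomputable def stepKernel (ν y : ℝ) : ℂ :=
  ((y ^ (ν - 1) / (2 * ν - 1) : ℝ) : ℂ) *
    (ν * legendreP ν y + (ν - 1) * legendreP (ν - 2 : ℝ) y)

theorem isDiffKernel_stepKernel {ν : ℝ} (hν : 1 / 2 < ν) :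
    IsDiffKernel (stepKernel ν) (fun y => ((y ^ (ν - 1) : ℝ) : ℂ) * legendreQ ν y)
      (2 * ν - 1) := by
  have h1 := isDiffKernel_legendre_self (ν := ν) (by linarith)
  have h2 := isDiffKernel_legendre_sub_two hν
  have hd : 2 * ν - 1 ≠ 0 := by linarith
  have hd0 : 0 < 2 * ν - 1 := by linarith
  have hdc : (2 * (ν : ℂ) - 1) ≠ 0 := by exact_mod_cast hd
  obtain ⟨C, hC, hb1⟩ := h1.bound
  obtain ⟨D, hD, hb2⟩ := h2.bound
  obtain ⟨E, hE, hb3⟩ := h1.bound_deriv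
  have hpow : ∀ y, 1 ≤ y → ContinuousAt (fun y : ℝ => y ^ (ν - 1)) y := fun y hy =>
    Real.continuousAt_rpow_const y _ (Or.inl (by linarith))
  refine ⟨?_, ?_, fun y hy => ?_, ?_, ⟨(|ν| * C + |ν - 1| * D) / (2 * ν - 1), by positivity,
    fun y hy => ?_⟩, ⟨E, hE, fun y hy => ?_⟩⟩
  · refine ContinuousOn.mul (fun y hy => ?_) ((continuousOn_const.mul h1.continuousOn).add
      (continuousOn_const.mul h2.continuousOn))
    exact (Complex.continuous_ofReal.continuousAt.comp
      ((hpow y hy).div_const _)).continuousWithinAt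
  · simp only [stepKernel, legendreP_one, Real.one_rpow]
    push_cast
    field_simp
    ring
  · have hy0 : 0 < y := by linarith
    have h3 : HasDerivAt (fun y : ℝ => ((y ^ (ν - 1) / (2 * ν - 1) : ℝ) : ℂ))
        (((ν - 1) * y ^ (ν - 1 - 1) / (2 * ν - 1) : ℝ) : ℂ) y :=
      ((Real.hasDerivAt_rpow_const (Or.inl hy0.ne')).div_const _).ofReal_comp
    have h4 := h3.mul (((h1.hasDerivAt y hy).const_mul (ν : ℂ)).add
      ((h2.hasDerivAt y hy).const_mul ((ν : ℂ) - 1)))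
    refine h4.congr_deriv ?_
    have h5 := mul_legendreQ_sub ν hy
    simp only [Pi.add_apply]
    rw [Real.rpow_sub_one hy0.ne', ← h5]
    have hyi : (y : ℂ) * (y : ℂ)⁻¹ = 1 := mul_inv_cancel₀ (by exact_mod_cast hy0.ne')
    have hdi : (2 * (ν : ℂ) - 1) * (2 * (ν : ℂ) - 1)⁻¹ = 1 := mul_inv_cancel₀ hdc
    push_cast
    linear_combination ((y ^ (ν - 1) : ℝ) : ℂ) * legendreQ ν y * hdi +
      (ν - 1) * ((y ^ (ν - 1) : ℝ) : ℂ) * (2 * (ν : ℂ) - 1)⁻¹ *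
        (legendreQ ν y - legendreQ (ν - 2 : ℂ) y) * hyi
  · refine ContinuousOn.mul (fun y hy => ?_) (continuousOn_legendreQ ν)
    exact (Complex.continuous_ofReal.continuousAt.comp
      (hpow y (le_of_lt hy))).continuousWithinAt
  · have hy0 : 0 < y := by linarith
    rw [stepKernel, norm_mul, Complex.norm_real, Real.norm_of_nonneg (by positivity)]
    have h3 : ‖(ν : ℂ) * legendreP ν y + (ν - 1) * legendreP (ν - 2 : ℝ) y‖ ≤
        |ν| * (C * y ^ ν) + |ν - 1| * (D * y ^ ν) := by
      refine (norm_add_le _ _).trans ?_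
      rw [norm_mul, norm_mul, Complex.norm_real, Real.norm_eq_abs,
        show ((ν : ℂ) - 1) = ((ν - 1 : ℝ) : ℂ) by push_cast; ring, Complex.norm_real,
        Real.norm_eq_abs]
      gcongr
      · exact hb1 y hy
      · exact hb2 y hy
    calc y ^ (ν - 1) / (2 * ν - 1) * ‖(ν : ℂ) * legendreP ν y + (ν - 1) *
          legendreP (ν - 2 : ℝ) y‖
        ≤ y ^ (ν - 1) / (2 * ν - 1) * (|ν| * (C * y ^ ν) + |ν - 1| * (D * y ^ ν)) := by
          gcongr
      _ = _ := by
          rw [show 2 * ν - 1 = (ν - 1) + ν by ring, Real.rpow_add hy0]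
          ring
  · have hy0 : 0 < y := by linarith
    rw [norm_mul, Complex.norm_real, Real.norm_of_nonneg (by positivity),
      show 2 * ν - 1 - 1 = (ν - 1) + (ν - 1) by ring, Real.rpow_add hy0, mul_left_comm]
    gcongr
    exact hb3 y hy

/-- The defining integral converges absolutely only if `t^(-ν) f(t)` is integrable near zero, because
`P_ν(y) ≥ y^ν / 2`. -/
theorem locInt_of_admissible {ν : ℝ} (hν : 0 ≤ ν) {f : L2} (hf : Admissible (ν : ℂ) f) :
    LocInt ν f := by
  intro X hX
  have hfm : AEStronglyMeasurable f (volume.restrict (Ioo 0 X)) :=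
    (Lp.aestronglyMeasurable f).mono_measure (Measure.restrict_mono Ioo_subset_Ioi_self le_rfl)
  refine Integrable.mono' ((hf.integrableOn X hX).norm.const_mul (2 * X ^ (-ν)))
    (AEStronglyMeasurable.mul (by fun_prop : Measurable _).aestronglyMeasurable hfm) ?_
  filter_upwards [ae_restrict_mem measurableSet_Ioo] with t ht
  have ht0 := ht.1
  have h1 : 1 ≤ X / t := (one_le_div ht0).mpr ht.2.le
  have h2 := le_legendreR hν h1
  rw [norm_mul, norm_mul, legendreP_ofReal ν h1, Complex.norm_real, Complex.norm_real,
    Real.norm_of_nonneg (by positivity), Real.norm_of_nonneg (legendreR_pos ν h1).le, ← mul_assoc]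
  gcongr
  rw [Real.div_rpow hX.le ht0.le] at h2
  calc t ^ (-ν) = 2 * X ^ (-ν) * (X ^ ν / t ^ ν / 2) := by
        rw [Real.rpow_neg ht0.le, Real.rpow_neg hX.le]
        have := (Real.rpow_pos_of_pos hX ν).ne'
        field_simp
    _ ≤ _ := by gcongr

/-- The kernel of the isometry with dense range that relates the degrees `ν` and `ν - 2`. -/
theorem isL2Kernel_step {ν : ℝ} (hν : 1 / 2 < ν) : IsL2Kernel (powKernel ν (2 * ν - 1)) :=
  isL2Kernel_powKernel hν _

theorem norm_symb_step {ν : ℝ} (hν : 1 / 2 < ν) (ξ : ℝ) :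
    ‖symb (powKernel ν (2 * ν - 1)) (critLine ξ)‖ = 1 := by
  have h0 : critLine ξ - ν ≠ 0 := fun h => by
    have := congrArg Complex.re h
    simp [critLine_re] at this; linarith
  have e : 1 + ((2 * ν - 1 : ℝ) : ℂ) / (critLine ξ - ν) =
      -((starRingEnd ℂ) (critLine ξ - ν)) / (critLine ξ - ν) := by
    rw [map_sub, conj_critLine, Complex.conj_ofReal]
    push_cast
    field_simp
    ring
  rw [symb_powKernel _ (by rw [critLine_re]; exact hν), e, norm_div, norm_neg, Complex.norm_conj,
    div_self (norm_ne_zero_iff.mpr h0)]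

theorem norm_opA_step {ν : ℝ} (hν : 1 / 2 < ν) (f : L2) :
    ‖opA _ (isL2Kernel_step hν) f‖ = ‖f‖ := by
  have h1 := norm_opA_le_of_symb_le (isL2Kernel_step hν) isL2Kernel_zero zero_le_one
    (fun ξ => by rw [norm_symb_step hν, symb_zero]; simp) f
  have h2 := norm_opA_le_of_symb_le isL2Kernel_zero (isL2Kernel_step hν) zero_le_one
    (fun ξ => by rw [norm_symb_step hν, symb_zero]; simp) f
  rw [opA_zero, one_mul] at h1 h2
  exact le_antisymm h1 h2

/-- The domain for the degree `ν` is contained in that for `ν - 2`, and on it both operators have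
the same norm: a unitary operator carries `S_ν f` to `S_{ν-2} f`. -/
theorem mem_domainS_sub_two {ν : ℝ} (hν : 1 / 2 < ν) {f : L2} (hf : f ∈ domainS (ν : ℂ)) :
    f ∈ domainS ((ν - 2 : ℝ) : ℂ) ∧ normS ((ν - 2 : ℝ) : ℂ) f = normS ν f := by
  have hν0 : 0 ≤ ν := by linarith
  obtain ⟨hadm, hL⟩ := hf
  have hl := locInt_of_admissible hν0 hadm
  have hd1 := isDiffKernel_legendre_self hν0
  have hd2 := isDiffKernel_legendre_sub_two hν
  have ae1 := opS_ae_eq hd1 hl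
  have ae2 := opS_ae_eq hd2 hl
  set g : L2 := hL.toLp _ with hg
  have hgae : g =ᵐ[volume.restrict (Ioi (0 : ℝ))] fun x => f x + mconv (legendreQ ν) f x :=
    hL.coeFn_toLp.trans ae1
  have hlg : LocInt (1 - ν) (fun x => f x + mconv (legendreQ ν) f x) :=
    MemLp.locInt ((memLp_congr_ae ae1).mp hL) (by linarith)
  set fh : ℝ → ℂ := fun t => ((t ^ (ν - 1) : ℝ) : ℂ) * f t with hfh
  have hlf : LocInt (2 * ν - 1) fh := fun X hX => by
    refine (hl X hX).congr_fun (fun t ht => ?_) measurableSet_Ioo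
    simp only [hfh]
    rw [← mul_assoc, ← Complex.ofReal_mul, ← Real.rpow_add ht.1]
    congr 3
    ring
  have hG : ∀ y, 0 < y → fh y + mconv (fun y => ((y ^ (ν - 1) : ℝ) : ℂ) * legendreQ ν y) fh y =
      ((y ^ (ν - 1) : ℝ) : ℂ) * (f y + mconv (legendreQ ν) f y) := fun y hy => by
    rw [mul_add]
    congr 1
    simp only [mconv]
    rw [← integral_const_mul]
    refine setIntegral_congr_fun measurableSet_Ioo fun t ht => ?_
    simp only [hfh]
    rw [Real.div_rpow hy.le ht.1.le]
    have := (Real.rpow_pos_of_pos ht.1 (ν - 1)).ne'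
    have h2 : ((t ^ (ν - 1) : ℝ) : ℂ) ≠ 0 := by exact_mod_cast this
    push_cast
    field_simp
  have hW : opA _ (isL2Kernel_step hν) g =ᵐ[volume.restrict (Ioi (0 : ℝ))]
      opS ((ν - 2 : ℝ) : ℂ) f := by
    filter_upwards [coeFn_opA (isL2Kernel_step hν) g, hgae, ae2, ae_restrict_mem measurableSet_Ioi]
      with x h1 h2 h3 hx
    have hx0 : (0 : ℝ) < x := hx
    rw [h1, h2, h3, mconv_congr _ hgae, mconv_powKernel _ _ _ hx0]
    have hint : IntegrableOn (fun y => fh y + mconv (fun y => ((y ^ (ν - 1) : ℝ) : ℂ) *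
        legendreQ ν y) fh y) (Ioo 0 x) := by
      refine (hlg x hx0).congr_fun (fun t ht => ?_) measurableSet_Ioo
      simp only
      rw [hG t ht.1, neg_sub]
    have h4 := (isDiffKernel_stepKernel hν).kernelInt_eq hlf (by linarith) hx0 hint
    rw [setIntegral_congr_fun measurableSet_Ioo fun t ht => hG t ht.1] at h4
    rw [← h4]
    have i1 := hd1.integrableOn_mconv_slice hl hx0
    have i2 := hd2.integrableOn_mconv_slice hl hx0
    rw [add_assoc]
    congr 1
    rw [← eq_sub_iff_add_eq', mconv, mconv, ← integral_sub i2 i1, kernelInt,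
      ← integral_const_mul]
    refine setIntegral_congr_fun measurableSet_Ioo fun t ht => ?_
    have ht0 := ht.1
    have h5 := mul_legendreQ_sub ν ((one_lt_div ht0).mpr ht.2)
    simp only [stepKernel, hfh]
    rw [← h5, Real.div_rpow hx0.le ht0.le, Real.rpow_neg hx0.le, Real.rpow_sub_one hx0.ne']
    have e1 : (x : ℂ) ≠ 0 := by exact_mod_cast hx0.ne'
    have e2 : (t : ℂ) ≠ 0 := by exact_mod_cast ht0.ne'
    have e3 : ((t ^ (ν - 1) : ℝ) : ℂ) ≠ 0 := by
      exact_mod_cast (Real.rpow_pos_of_pos ht0 (ν - 1)).ne'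
    have e4 : ((x ^ ν : ℝ) : ℂ) ≠ 0 := by exact_mod_cast (Real.rpow_pos_of_pos hx0 ν).ne'
    have e5 : (2 * (ν : ℂ) - 1) ≠ 0 := by
      have : 2 * ν - 1 ≠ 0 := by linarith
      exact_mod_cast this
    push_cast
    field_simp
    ring
  refine ⟨⟨admissible_of_locInt hd2 hl, (memLp_congr_ae hW).mp (Lp.memLp _)⟩, ?_⟩
  rw [normS_eq_of_ae hW.symm, norm_opA_step hν, normS_eq_of_ae hL.coeFn_toLp.symm]

/-! ### Functions vanishing near zero -/

theorem kernelInt_congr {p₁ p₂ f g : ℝ → ℂ} (hp : ∀ y, 1 < y → p₁ y = p₂ y)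
    (h : f =ᵐ[volume.restrict (Ioi (0 : ℝ))] g) : kernelInt p₁ f = kernelInt p₂ g := by
  funext x
  refine integral_congr_ae ?_
  filter_upwards [ae_restrict_of_ae_restrict_of_subset
    (Ioo_subset_Ioi_self : Ioo (0 : ℝ) x ⊆ Ioi 0) h, ae_restrict_mem measurableSet_Ioo]
    with t ht htm
  rw [ht, hp _ ((one_lt_div htm.1).mpr htm.2)]

theorem indicator_ae_eq_of_vanish {h : L2} {c : ℝ} (hc : 0 < c)
    (hh : ∀ᵐ t ∂(volume.restrict (Ioi (0 : ℝ))), t < c → h t = 0) :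
    (Ioi (c / 2)).indicator h =ᵐ[volume.restrict (Ioi (0 : ℝ))] h := by
  filter_upwards [hh] with t ht
  by_cases h1 : t ∈ Ioi (c / 2)
  · rw [indicator_of_mem h1]
  · have h2 : t ≤ c / 2 := not_lt.mp h1
    rw [indicator_of_notMem h1, ht (by linarith)]

theorem integrableOn_Icc_L2 (h : L2) {a : ℝ} (ha : 0 < a) (b : ℝ) : IntegrableOn h (Icc a b) :=
  ((Lp.memLp h).mono_measure (Measure.restrict_mono (fun _ ht => ha.trans_le ht.1)
    le_rfl)).integrable (by norm_num)

theorem locInt_of_vanish {h : L2} {c : ℝ} (hc : 0 < c)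
    (hh : ∀ᵐ t ∂(volume.restrict (Ioi (0 : ℝ))), t < c → h t = 0) (d : ℝ) : LocInt d h := by
  intro X hX
  have hc2 : 0 < c / 2 := by linarith
  have h1 : IntegrableOn (fun t : ℝ => ((t ^ (-d) : ℝ) : ℂ) * h t) (Icc (c / 2) X) := by
    refine (integrableOn_Icc_L2 h hc2 X).continuousOn_mul (fun t ht => ?_) isCompact_Icc
    exact (Complex.continuous_ofReal.continuousAt.comp (Real.continuousAt_rpow_const t _
      (Or.inl (hc2.trans_le ht.1).ne'))).continuousWithinAt
  have h2 : IntegrableOn ((Icc (c / 2) X).indicator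
      fun t : ℝ => ((t ^ (-d) : ℝ) : ℂ) * h t) (Ioo 0 X) :=
    ((integrable_indicator_iff measurableSet_Icc).mpr h1).integrableOn
  refine Integrable.congr h2 ?_
  filter_upwards [ae_restrict_of_ae_restrict_of_subset
    (Ioo_subset_Ioi_self : Ioo (0 : ℝ) X ⊆ Ioi 0) hh, ae_restrict_mem measurableSet_Ioo]
    with t ht htm
  by_cases h3 : t ∈ Icc (c / 2) X
  · rw [indicator_of_mem h3]
  · have h4 : t < c / 2 := not_le.mp fun h5 => h3 ⟨h5, htm.2.le⟩
    rw [indicator_of_notMem h3, ht (by linarith), mul_zero]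

theorem opA_vanish {k : ℝ → ℂ} (hk : IsL2Kernel k) {h : L2} {c : ℝ}
    (hh : ∀ᵐ t ∂(volume.restrict (Ioi (0 : ℝ))), t < c → h t = 0) :
    ∀ᵐ t ∂(volume.restrict (Ioi (0 : ℝ))), t < c → opA k hk h t = 0 := by
  filter_upwards [coeFn_opA hk h, hh] with x h1 h2 hx
  rw [h1, h2 hx, zero_add, mconv]
  refine integral_eq_zero_of_ae ?_
  filter_upwards [ae_restrict_of_ae_restrict_of_subset
    (Ioo_subset_Ioi_self : Ioo (0 : ℝ) x ⊆ Ioi 0) hh, ae_restrict_mem measurableSet_Ioo]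
    with t ht htm
  rw [ht (htm.2.trans hx)]
  simp

theorem primitive_opA_powKernel {ν : ℂ} {R : ℝ → ℂ} {a b c : ℝ} (ha : 1 / 2 < a)
    (hR : ContinuousOn R (Ici 1)) (hR1 : R 1 = 0)
    (hR' : ∀ z, 1 < z → HasDerivAt R (legendreP ν z * ((z ^ (a - 2) : ℝ) : ℂ)) z)
    {h : L2} (hc : 0 < c)
    (hh : ∀ᵐ t ∂(volume.restrict (Ioi (0 : ℝ))), t < c → h t = 0) :
    primitive ν (opA _ (isL2Kernel_powKernel ha b) h) =
      kernelInt (fun y => legendreP ν y - ((b * y ^ (1 - a) : ℝ) : ℂ) * R y) h := by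
  have hae := indicator_ae_eq_of_vanish hc hh
  have hc2 : 0 < c / 2 := by linarith
  have h1 : opA _ (isL2Kernel_powKernel ha b) h =ᵐ[volume.restrict (Ioi (0 : ℝ))] fun t =>
      (Ioi (c / 2)).indicator h t + mconv (powKernel a b) ((Ioi (c / 2)).indicator h) t := by
    filter_upwards [coeFn_opA (isL2Kernel_powKernel ha b) h, hae] with x h2 h3
    rw [h2, h3, mconv_congr _ hae]
  rw [primitive_congr ν h1, ← kernelInt_congr (fun _ _ => rfl) hae]
  funext x
  refine kernelInt_add_mconv_powKernel (continuousOn_legendreP ν) hR hR1 hR' hc2 (fun X => ?_)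
    (fun t ht => indicator_of_notMem (not_lt.mpr ht) _) x
  exact (integrableOn_Icc_L2 h hc2 X).indicator measurableSet_Ioi

/-! ### The inductive step -/

/-- The unitary operator of the step maps functions vanishing near zero in the domain for `ν - 2`
to such functions in the domain for `ν`. -/
theorem opA_step_mem_dom0 {ν : ℝ} (hν : 1 / 2 < ν) {h : L2} (hh : h ∈ dom0 ((ν - 2 : ℝ) : ℂ)) :
    opA _ (isL2Kernel_step hν) h ∈ dom0 (ν : ℂ) ∧
      normS ν (opA _ (isL2Kernel_step hν) h) = normS ((ν - 2 : ℝ) : ℂ) h := by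
  obtain ⟨⟨hadm, hL⟩, c, hc, hv⟩ := hh
  have hd1 := isDiffKernel_legendre_self (ν := ν) (by linarith)
  have hd2 := isDiffKernel_legendre_sub_two hν
  have hdc : (2 * (ν : ℂ) - 1) ≠ 0 := by
    have : 2 * ν - 1 ≠ 0 := by linarith
    exact_mod_cast this
  -- the primitive of `z^(ν-2) P_ν(z)`
  set R : ℝ → ℂ := fun y => ((y ^ (ν - 1) / (2 * ν - 1) : ℝ) : ℂ) *
    (legendreP ν y - legendreP (ν - 2 : ℝ) y) with hR
  have hprim : primitive ν (opA _ (isL2Kernel_step hν) h) = primitive ((ν - 2 : ℝ) : ℂ) h := by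
    refine (primitive_opA_powKernel (R := R) hν ?_ ?_ (fun z hz => ?_) hc hv).trans
      (kernelInt_congr (fun y hy => ?_) (ae_eq_refl _))
    · refine ContinuousOn.mul (fun y hy => ?_) (hd1.continuousOn.sub hd2.continuousOn)
      have hy1 : (1 : ℝ) ≤ y := hy
      exact (Complex.continuous_ofReal.continuousAt.comp ((Real.continuousAt_rpow_const y _
        (Or.inl (by linarith))).div_const _)).continuousWithinAt
    · simp only [hR, legendreP_one, sub_self, mul_zero]
    · have hz0 : 0 < z := by linarith
      have h3 : HasDerivAt (fun y : ℝ => ((y ^ (ν - 1) / (2 * ν - 1) : ℝ) : ℂ))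
          (((ν - 1) * z ^ (ν - 1 - 1) / (2 * ν - 1) : ℝ) : ℂ) z :=
        ((Real.hasDerivAt_rpow_const (Or.inl hz0.ne')).div_const _).ofReal_comp
      refine (h3.mul ((hd1.hasDerivAt z hz).sub (hd2.hasDerivAt z hz))).congr_deriv ?_
      have h5 := mul_legendreQ_sub ν hz
      have hzi : (z : ℂ) * (z : ℂ)⁻¹ = 1 := mul_inv_cancel₀ (by exact_mod_cast hz0.ne')
      have hdi : (2 * (ν : ℂ) - 1) * (2 * (ν : ℂ) - 1)⁻¹ = 1 := mul_inv_cancel₀ hdc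
      rw [Pi.sub_apply, show ν - 2 = ν - 1 - 1 by ring, Real.rpow_sub_one hz0.ne' (ν - 1),
        show ν - 1 - 1 = ν - 2 by ring]
      push_cast at h5 ⊢
      linear_combination ((z ^ (ν - 1) : ℝ) : ℂ) * (z : ℂ)⁻¹ * (2 * (ν : ℂ) - 1)⁻¹ * h5 -
        ((z ^ (ν - 1) : ℝ) : ℂ) * (2 * (ν : ℂ) - 1)⁻¹ *
          (legendreQ ν z - legendreQ (ν - 2 : ℂ) z) * hzi +
        ((z ^ (ν - 1) : ℝ) : ℂ) * (z : ℂ)⁻¹ * legendreP ν z * hdi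
    · have hy0 : 0 < y := by linarith
      have h6 : (2 * ν - 1) * y ^ (1 - ν) * (y ^ (ν - 1) / (2 * ν - 1)) = 1 := by
        rw [show 1 - ν = -(ν - 1) by ring, Real.rpow_neg hy0.le]
        have h7 := (Real.rpow_pos_of_pos hy0 (ν - 1)).ne'
        have h8 : 2 * ν - 1 ≠ 0 := by linarith
        field_simp
      simp only [hR]
      rw [← mul_assoc, ← Complex.ofReal_mul, h6, Complex.ofReal_one, one_mul, sub_sub_cancel]
  have hop : opS ν (opA _ (isL2Kernel_step hν) h) = opS ((ν - 2 : ℝ) : ℂ) h := by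
    unfold opS
    rw [hprim]
  have hvW := opA_vanish (isL2Kernel_step hν) hv
  refine ⟨⟨⟨admissible_of_locInt hd1 (locInt_of_vanish hc hvW ν), ?_⟩, c, hc, hvW⟩, ?_⟩
  · rw [hop]; exact hL
  · rw [normS, hop, normS]

theorem sin_pi_mul_sub_two (ν : ℝ) :
    Real.sin (Real.pi * (ν - 2)) = Real.sin (Real.pi * ν) := by
  rw [show Real.pi * (ν - 2) = Real.pi * ν - 2 * Real.pi by ring, Real.sin_sub_two_pi]

theorem NormCriterion.add_two {ν : ℝ} (hν : 1 / 2 < ν) (h : NormCriterion (ν - 2)) :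
    NormCriterion ν := by
  have hs := sin_pi_mul_sub_two ν
  refine ⟨?_, fun C hC hb => ?_, fun C hC hb f hf => ?_⟩
  · refine ((denseRange_opA_powKernel hν (2 * ν - 1)).dense_image
      (ContinuousLinearMap.continuous _) h.dense).mono ?_
    rintro _ ⟨g, hg, rfl⟩
    exact (opA_step_mem_dom0 hν hg).1
  · rw [← hs]
    refine h.lineBound C hC fun g hg => ?_
    obtain ⟨h1, h2⟩ := opA_step_mem_dom0 hν hg
    rw [← h2, ← norm_opA_step hν g]
    exact hb _ h1
  · obtain ⟨h1, h2⟩ := mem_domainS_sub_two hν hf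
    rw [← h2]
    exact h.bound C hC (by rwa [hs]) f h1

/-! ### The degree `1/2` -/

/-- The kernel `P_{-1/2}'(y) / y`. -/
noncomputable def halfKernel (y : ℝ) : ℂ := legendreQ ((1 / 2 : ℝ) - 1 : ℂ) y / y

theorem continuousOn_halfKernel : ContinuousOn halfKernel (Ioi 1) :=
  (continuousOn_legendreQ _).div Complex.continuous_ofReal.continuousOn fun y hy => by
    have : (1 : ℝ) < y := hy
    exact_mod_cast (by linarith : y ≠ 0)

theorem cpow_mul_halfKernel (s : ℂ) {y : ℝ} (hy : 1 < y) :
    (y : ℂ) ^ (s - 1 - 1) * legendreQ ((1 / 2 : ℝ) - 1 : ℂ) y =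
      (y : ℂ) ^ (s - 1) * halfKernel y := by
  have hy0 : (y : ℂ) ≠ 0 := by exact_mod_cast (by linarith : y ≠ 0)
  rw [Complex.cpow_sub (s - 1) 1 hy0, Complex.cpow_one, halfKernel]
  ring

theorem integrableOn_cpow_mul_halfKernel {s : ℂ} (hs : s.re < 5 / 2) :
    IntegrableOn (fun y : ℝ => (y : ℂ) ^ (s - 1) * halfKernel y) (Ioi 1) := by
  refine (integrableOn_cpow_mul_legendreQ ((1 / 2 : ℝ) - 1 : ℂ) (s := s - 1) ?_).congr_fun
    (fun y hy => cpow_mul_halfKernel s hy) measurableSet_Ioi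
  rw [lt_min_iff]
  constructor <;> simp <;> linarith

theorem isL2Kernel_halfKernel : IsL2Kernel halfKernel :=
  ⟨continuousOn_halfKernel, integrableOn_cpow_mul_halfKernel (by norm_num)⟩

theorem symb_halfKernel {s : ℂ} (hs : s.re < 5 / 2) :
    symb halfKernel s = multiplier ((1 / 2 : ℝ) - 1 : ℂ) (s - 1) := by
  rw [← one_add_integral_cpow_mul_legendreQ ((1 / 2 : ℝ) - 1 : ℂ) (s := s - 1) (by
    rw [lt_min_iff]
    constructor <;> simp <;> linarith), symb]
  congr 1
  exact setIntegral_congr_fun measurableSet_Ioi fun y hy => (cpow_mul_halfKernel s hy).symm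

theorem integrableOn_halfKernel : IntegrableOn halfKernel (Ioi 1) :=
  (integrableOn_cpow_mul_halfKernel (s := 1) (by norm_num)).congr_fun (fun y _ => by simp)
    measurableSet_Ioi

/-- The primitive `1 + ∫_1^y P_{-1/2}'(z) dz / z`. -/
noncomputable def halfPrim (y : ℝ) : ℂ := 1 + ∫ t in (1 : ℝ)..y, (Ioi 1).indicator halfKernel t

theorem integrable_indicator_halfKernel : Integrable ((Ioi 1).indicator halfKernel) :=
  (integrable_indicator_iff measurableSet_Ioi).mpr integrableOn_halfKernel

theorem isDiffKernel_halfPrim : IsDiffKernel halfPrim halfKernel (1 / 4) where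
  continuousOn := (continuous_const.add (intervalIntegral.continuous_primitive
    (fun _ _ => integrable_indicator_halfKernel.intervalIntegrable) 1)).continuousOn
  map_one := by simp [halfPrim]
  hasDerivAt := fun y hy => by
    have hy' : y ∈ Ioi (1 : ℝ) := hy
    have hev : (Ioi (1 : ℝ)).indicator halfKernel =ᶠ[𝓝 y] halfKernel := by
      filter_upwards [Ioi_mem_nhds hy] with z hz using indicator_of_mem hz _
    have h1 := intervalIntegral.integral_hasDerivAt_right (a := 1) (b := y)
      integrable_indicator_halfKernel.intervalIntegrable
      (integrable_indicator_halfKernel.1.stronglyMeasurableAtFilter)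
      ((continuousOn_halfKernel.continuousAt (Ioi_mem_nhds hy)).congr hev.symm)
    rw [indicator_of_mem hy'] at h1
    exact h1.const_add 1
  continuousOn_deriv := continuousOn_halfKernel
  bound := by
    refine ⟨1 + ∫ t, ‖(Ioi 1).indicator halfKernel t‖, by positivity, fun y hy => ?_⟩
    have h1 : ‖halfPrim y‖ ≤ 1 + ∫ t, ‖(Ioi 1).indicator halfKernel t‖ := by
      refine (norm_add_le _ _).trans ?_
      rw [norm_one]
      gcongr
      rw [intervalIntegral.integral_of_le hy]
      refine (norm_integral_le_integral_norm _).trans ?_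
      exact setIntegral_le_integral integrable_indicator_halfKernel.norm
        (Eventually.of_forall fun _ => norm_nonneg _)
    refine h1.trans (le_mul_of_one_le_right (by positivity) ?_)
    exact Real.one_le_rpow hy (by norm_num)
  bound_deriv := by
    obtain ⟨D, hD, hQ⟩ := exists_norm_legendreQ_le ((1 / 2 : ℝ) - 1 : ℂ)
    obtain ⟨E, hE, hR⟩ := exists_legendreR_le (a := ((1 / 2 : ℝ) - 1 : ℂ).re) (c := 1 / 4)
      (by simp; norm_num) (by simp; norm_num)
    refine ⟨D * E, by positivity, fun y hy => ?_⟩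
    have hy0 : 0 < y := by linarith
    rw [halfKernel, norm_div, Complex.norm_real, Real.norm_of_nonneg hy0.le]
    refine (div_le_self (norm_nonneg _) hy.le).trans ((hQ y hy).trans ?_)
    rw [mul_assoc, Real.rpow_sub_one hy0.ne', ← mul_div_assoc E]
    exact mul_le_mul_of_nonneg_left (div_le_div_of_nonneg_right (hR y hy.le) hy0.le) hD

/-- On the range of the operator with kernel `powKernel 1 (1/2)`, the operator of degree `1/2` is
again a convolution operator in `L₂`. -/
theorem opA_half_mem_dom0 {h : L2} (hh : h ∈ cptL2) :
    opA _ (isL2Kernel_powKernel one_half_lt_one (1 / 2)) h ∈ dom0 ((1 / 2 : ℝ) : ℂ) ∧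
      normS ((1 / 2 : ℝ) : ℂ) (opA _ (isL2Kernel_powKernel one_half_lt_one (1 / 2)) h) =
        ‖opA _ isL2Kernel_halfKernel h‖ := by
  obtain ⟨c, hc, hv⟩ := vanish_of_mem_cptL2 hh
  have hd : IsDiffKernel (legendreP ((1 / 2 : ℝ) : ℂ)) (legendreQ ((1 / 2 : ℝ) : ℂ)) 1 :=
    isDiffKernel_legendre (by simp; norm_num) (by simp; norm_num)
  have hprim : primitive ((1 / 2 : ℝ) : ℂ)
      (opA _ (isL2Kernel_powKernel one_half_lt_one (1 / 2)) h) = kernelInt halfPrim h := by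
    refine (primitive_opA_powKernel
      (R := fun y => 2 * (legendreP ((1 / 2 : ℝ) : ℂ) y - halfPrim y)) one_half_lt_one ?_ ?_
      (fun z hz => ?_) hc hv).trans (kernelInt_congr (fun y hy => ?_) (ae_eq_refl _))
    · exact continuousOn_const.mul (hd.continuousOn.sub isDiffKernel_halfPrim.continuousOn)
    · simp only [hd.map_one, isDiffKernel_halfPrim.map_one, sub_self, mul_zero]
    · have hz0 : (z : ℂ) ≠ 0 := by exact_mod_cast (by linarith : z ≠ 0)
      refine (((hd.hasDerivAt z hz).sub (isDiffKernel_halfPrim.hasDerivAt z hz)).const_mul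
        (2 : ℂ)).congr_deriv ?_
      have h1 := legendreQ_sub_one ((1 / 2 : ℝ) : ℂ) hz
      rw [halfKernel, h1, show (1 : ℝ) - 2 = -1 by norm_num, Real.rpow_neg_one]
      push_cast
      field_simp
      ring
    · simp only [sub_self, Real.rpow_zero]
      push_cast
      ring
  have hL : opS ((1 / 2 : ℝ) : ℂ) (opA _ (isL2Kernel_powKernel one_half_lt_one (1 / 2)) h)
      =ᵐ[volume.restrict (Ioi (0 : ℝ))] opA _ isL2Kernel_halfKernel h := by
    have hl : LocInt (1 / 4) h := MemLp.locInt (Lp.memLp h) (by norm_num)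
    filter_upwards [isDiffKernel_halfPrim.ae_hasDerivAt hl, coeFn_opA isL2Kernel_halfKernel h]
      with x h1 h2
    rw [opS, hprim, h2]
    exact HasDerivAt.deriv h1
  have hvW := opA_vanish (isL2Kernel_powKernel one_half_lt_one (1 / 2)) hv
  exact ⟨⟨⟨admissible_of_locInt hd (locInt_of_vanish hc hvW 1),
    (memLp_congr_ae hL).mpr (Lp.memLp _)⟩, c, hc, hvW⟩, normS_eq_of_ae hL⟩

theorem multiplier_half_shift {s : ℂ} (h1 : s ≠ 1 / 2) (h2 : s ≠ 1) :
    multiplier ((1 / 2 : ℝ) - 1 : ℂ) (s - 1) * (s - 1) =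
      multiplier ((1 / 2 : ℝ) : ℂ) s * (s - 1 / 2) := by
  have n1 : 1 / 4 - s / 2 ≠ 0 := fun h => h1 (by linear_combination -2 * h)
  have n2 : 1 / 2 - s / 2 ≠ 0 := fun h => h2 (by linear_combination -2 * h)
  have g1 := Complex.Gamma_add_one _ n1
  have g2 := Complex.Gamma_add_one _ n2
  simp only [multiplier]
  push_cast
  rw [show -(s - 1) / 2 + (1 / 2 - 1) / 2 + 1 = 1 / 4 - s / 2 + 1 by ring,
    show -(s - 1) / 2 - (1 / 2 - 1) / 2 + 1 / 2 = 1 / 4 - s / 2 + 1 by ring,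
    show 1 / 2 - (s - 1) / 2 = 1 - s / 2 by ring,
    show 1 - (s - 1) / 2 = 1 / 2 - s / 2 + 1 by ring,
    show -s / 2 + 1 / 2 / 2 + 1 = 1 / 4 - s / 2 + 1 by ring,
    show -s / 2 - 1 / 2 / 2 + 1 / 2 = 1 / 4 - s / 2 by ring, g2]
  nth_rw 2 [g1]
  have n3 : 1 - s ≠ 0 := fun h => h2 (by linear_combination -h)
  rw [show 1 / 2 - s / 2 = (1 - s) / 2 by ring]
  simp only [div_eq_mul_inv, mul_inv]
  have n4 : (1 - s) * (1 - s)⁻¹ = 1 := mul_inv_cancel₀ n3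
  linear_combination (Complex.Gamma (1 * 4⁻¹ - s * 2⁻¹ + 1) * (1 * 4⁻¹ - s * 2⁻¹) *
    Complex.Gamma (1 * 4⁻¹ - s * 2⁻¹) * (Complex.Gamma (1 - s * 2⁻¹))⁻¹ *
    (Complex.Gamma ((1 - s) * 2⁻¹))⁻¹ * (-2)) * n4

theorem normCriterion_half : NormCriterion (1 / 2) := by
  have hs1 : Real.sin (Real.pi * (1 / 2)) = 1 := by
    rw [mul_one_div, Real.sin_pi_div_two]
  refine ⟨?_, fun C hC hb => ?_, fun C hC hb => ?_⟩
  · -- density comes from the dense range of the Hardy operator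
    refine ((denseRange_opA_powKernel one_half_lt_one (1 / 2)).dense_image
      (ContinuousLinearMap.continuous _) dense_cptL2).mono ?_
    rintro _ ⟨g, hg, rfl⟩
    exact (opA_half_mem_dom0 hg).1
  · have hle := symb_le_of_norm_opA_le isL2Kernel_halfKernel
      (isL2Kernel_powKernel one_half_lt_one (1 / 2)) hC fun f hf => by
        obtain ⟨h1, h2⟩ := opA_half_mem_dom0 hf
        rw [← h2]
        exact hb _ h1
    have hne : ∀ τ : ℝ, τ ≠ 0 → Real.cosh τ ≤ C ^ 2 * (Real.cosh τ - 1) := by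
      intro τ hτ
      set ξ := τ / (2 * Real.pi ^ 2) with hξ
      have hπ := Real.pi_ne_zero
      have e : 2 * Real.pi ^ 2 * ξ = τ := by
        rw [hξ]; field_simp
      have hξ0 : ξ ≠ 0 := by rw [hξ]; positivity
      have m1 : critLine ξ ≠ 1 / 2 := fun h => by
        have := congrArg Complex.im h
        simp [critLine, hξ0, hπ] at this
      have m2 : critLine ξ ≠ 1 := fun h => by
        have := congrArg Complex.re h
        rw [critLine_re] at this
        norm_num at this
      have h1 := hle ξ
      have h2 := multiplier_half_shift m1 m2
      have m3 : critLine ξ - 1 / 2 ≠ 0 := sub_ne_zero.mpr m1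
      have m4 : critLine ξ - 1 ≠ 0 := sub_ne_zero.mpr m2
      rw [symb_halfKernel (by rw [critLine_re]; norm_num),
        symb_powKernel _ (by rw [critLine_re]; norm_num), eq_div_of_mul_eq m4 h2] at h1
      have e2 : 1 + ((1 / 2 : ℝ) : ℂ) / (critLine ξ - (1 : ℝ)) =
          (critLine ξ - 1 / 2) / (critLine ξ - 1) := by
        push_cast
        field_simp
        ring
      rw [e2, mul_div_assoc, norm_mul] at h1
      have h3 : ‖multiplier ((1 / 2 : ℝ) : ℂ) (critLine ξ)‖ ≤ C :=
        le_of_mul_le_mul_right h1 (norm_pos_iff.mpr (div_ne_zero m3 m4))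
      have h4 := pow_le_pow_left₀ (norm_nonneg _) h3 2
      rw [norm_sq_multiplier, e, hs1, div_le_iff₀ (by linarith [Real.one_lt_cosh.mpr hτ])] at h4
      exact h4
    rw [hs1]
    intro τ
    rcases eq_or_ne τ 0 with rfl | hτ
    · -- by continuity; the inequality at `0` is absurd, so no such `C` exists
      have c1 : Tendsto (fun τ => Real.cosh τ) (𝓝[≠] 0) (𝓝 (Real.cosh 0)) :=
        (Real.continuous_cosh.tendsto 0).mono_left nhdsWithin_le_nhds
      refine le_of_tendsto_of_tendsto c1 ((c1.sub_const 1).const_mul (C ^ 2)) ?_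
      filter_upwards [self_mem_nhdsWithin] with τ hτ using hne τ hτ
    · exact hne τ hτ
  · -- the multiplier has a pole at `τ = 0`
    have h1 := hb 0
    rw [hs1, Real.cosh_zero] at h1
    norm_num at h1

/-! ### All degrees -/

theorem primitive_symm (ν : ℂ) (f : ℝ → ℂ) : primitive (-1 - ν) f = primitive ν f :=
  kernelInt_congr (fun _ hy => legendreP_symm ν hy) (ae_eq_refl _)

theorem opS_symm (ν : ℂ) (f : ℝ → ℂ) : opS (-1 - ν) f = opS ν f := by
  unfold opS
  rw [primitive_symm]

theorem Admissible.symm {ν : ℂ} {f : ℝ → ℂ} (hf : Admissible ν f) : Admissible (-1 - ν) f := by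
  refine ⟨fun x hx => (hf.integrableOn x hx).congr_fun (fun t ht => ?_) measurableSet_Ioo, ?_⟩
  · simp only [legendreP_symm ν ((one_lt_div ht.1).mpr ht.2)]
  · rw [primitive_symm]
    exact hf.differentiableAt

theorem domainS_symm (ν : ℂ) : domainS (-1 - ν) = domainS ν := by
  ext f
  constructor
  · rintro ⟨h1, h2⟩
    have h3 := h1.symm
    rw [show -1 - (-1 - ν) = ν by ring] at h3
    exact ⟨h3, by rwa [opS_symm] at h2⟩
  · rintro ⟨h1, h2⟩
    exact ⟨h1.symm, by rwa [opS_symm]⟩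

theorem NormCriterion.symm {ν : ℝ} (h : NormCriterion ν) : NormCriterion (-1 - ν) := by
  have hc : ((-1 - ν : ℝ) : ℂ) = -1 - (ν : ℂ) := by push_cast; ring
  have hn : ∀ f : ℝ → ℂ, normS ((-1 - ν : ℝ) : ℂ) f = normS ν f := fun f => by
    rw [hc, normS, opS_symm, normS]
  have hdom : domainS ((-1 - ν : ℝ) : ℂ) = domainS ν := by rw [hc, domainS_symm]
  have hd0 : dom0 ((-1 - ν : ℝ) : ℂ) = dom0 ν := by rw [dom0, hdom, dom0]
  have hs : Real.sin (Real.pi * (-1 - ν)) = Real.sin (Real.pi * ν) := by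
    rw [show Real.pi * (-1 - ν) = -(Real.pi * ν + Real.pi) by ring, Real.sin_neg, Real.sin_add_pi,
      neg_neg]
  refine ⟨by rw [hd0]; exact h.dense, fun C hC hb => ?_, fun C hC hb f hf => ?_⟩
  · rw [hs]
    refine h.lineBound C hC fun f hf => ?_
    rw [← hn]
    exact hb f (by rwa [hd0])
  · rw [hn]
    exact h.bound C hC (by rwa [← hs]) f (by rwa [← hdom])

theorem normCriterion_of_le (n : ℕ) :
    ∀ ν : ℝ, -3 / 2 < ν → ν ≤ 1 / 2 + 2 * n → NormCriterion ν := by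
  induction n with
  | zero =>
    intro ν h1 h2
    rcases lt_or_eq_of_le h2 with h3 | h3
    · exact normCriterion_of_mem_Ioo h1 (by simpa using h3)
    · rw [h3]; simpa using normCriterion_half
  | succ n ih =>
    intro ν h1 h2
    push_cast at h2
    rcases le_or_gt ν (1 / 2) with h3 | h3
    · have : (0 : ℝ) ≤ n := Nat.cast_nonneg n
      exact ih ν h1 (by linarith)
    · exact NormCriterion.add_two h3 (ih (ν - 2) (by linarith) (by linarith))

theorem normCriterion (ν : ℝ) : NormCriterion ν := by
  have key : ∀ ν : ℝ, -3 / 2 < ν → NormCriterion ν := fun ν h => by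
    obtain ⟨n, hn⟩ := exists_nat_gt ν
    have : (0 : ℝ) ≤ n := Nat.cast_nonneg n
    exact normCriterion_of_le n ν h (by linarith)
  rcases lt_or_ge (-3 / 2) ν with h | h
  · exact key ν h
  · have h1 := (key (-1 - ν) (by linarith)).symm
    rwa [sub_sub_cancel] at h1

/-! ### The operator norm -/

theorem opNorm_le_iff (T : L2 →ₗ.[ℂ] L2) {C : ℝ} (hC : 0 ≤ C) :
    opNorm T ≤ ENNReal.ofReal C ↔ ∀ f : T.domain, ‖T f‖ ≤ C * ‖f‖ := by
  have e : ∀ f : T.domain, ‖T f‖ₑ ≤ ENNReal.ofReal C ↔ ‖T f‖ ≤ C := fun f => by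
    rw [← ofReal_norm, ENNReal.ofReal_le_ofReal_iff hC]
  rw [opNorm, iSup₂_le_iff]
  constructor
  · intro h f
    rcases eq_or_ne f 0 with rfl | hf
    · rw [T.map_zero]; simp
    · have hf0 : ‖f‖ ≠ 0 := norm_ne_zero_iff.mpr hf
      have h1 := (e _).mp (h (((‖f‖⁻¹ : ℝ) : ℂ) • f) (by
        rw [norm_smul, Complex.norm_real, norm_inv, norm_norm, inv_mul_cancel₀ hf0]))
      rw [T.map_smul, norm_smul, Complex.norm_real, norm_inv, norm_norm,
        inv_mul_le_iff₀ (by positivity)] at h1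
      linarith
  · intro h f hf
    exact (e f).mpr ((h f).trans (mul_le_of_le_one_right hC hf))

theorem opNorm_opL2_le_iff (ν : ℝ) {C : ℝ} (hC : 0 ≤ C) :
    opNorm (opL2 (ν : ℂ)) ≤ ENNReal.ofReal C ↔ LineBound (Real.sin (Real.pi * ν)) C := by
  rw [opNorm_le_iff _ hC]
  constructor
  · intro h
    refine (normCriterion ν).lineBound C hC fun f hf => ?_
    have h1 := h ⟨f, hf.1⟩
    rwa [norm_opL2] at h1
  · intro h f
    rw [norm_opL2]
    exact (normCriterion ν).bound C hC h f f.2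

theorem eq_of_forall_le_ofReal_iff {a b : ℝ≥0∞}
    (h : ∀ C : ℝ, 0 ≤ C → (a ≤ ENNReal.ofReal C ↔ b ≤ ENNReal.ofReal C)) : a = b := by
  have key : ∀ {a b : ℝ≥0∞}, (∀ C : ℝ, 0 ≤ C → (b ≤ ENNReal.ofReal C → a ≤ ENNReal.ofReal C)) →
      a ≤ b := fun {a b} h => by
    rcases eq_or_ne b ⊤ with rfl | hb
    · exact le_top
    · rw [← ENNReal.ofReal_toReal hb]
      exact h _ ENNReal.toReal_nonneg (ENNReal.ofReal_toReal hb).ge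
  exact le_antisymm (key fun C hC => (h C hC).mpr) (key fun C hC => (h C hC).mp)

/-- The supremum of `cosh πτ / (cosh πτ - σ)` is attained at `τ = 0` if `σ ≥ 0` and as `τ → ∞`
otherwise. -/
theorem lineBound_iff {σ C : ℝ} (h1 : σ < 1) (h2 : -1 ≤ σ) (hC : 0 ≤ C) :
    LineBound σ C ↔ 1 / min 1 (Real.sqrt (1 - σ)) ≤ C := by
  have hs : 0 < Real.sqrt (1 - σ) := Real.sqrt_pos.mpr (by linarith)
  have hsq : Real.sqrt (1 - σ) ^ 2 = 1 - σ := Real.sq_sqrt (by linarith)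
  rw [div_le_iff₀ (lt_min one_pos hs)]
  constructor
  · intro h
    have a1 : 1 ≤ C := by
      by_contra hlt
      have hC1 : 0 < 1 - C ^ 2 := by nlinarith
      -- at this `τ` the inequality `(1 - C²) cosh τ ≤ C²` fails, since `cosh τ > τ / 2`
      have h3 := h (2 / (1 - C ^ 2))
      have h4 : 2 / (1 - C ^ 2) < 2 * Real.cosh (2 / (1 - C ^ 2)) := by
        have := Real.add_one_le_exp (2 / (1 - C ^ 2))
        have := Real.exp_pos (-(2 / (1 - C ^ 2)))
        rw [Real.cosh_eq]
        linarith
      rw [div_lt_iff₀ hC1] at h4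
      nlinarith [sq_nonneg C]
    have a2 : 1 ≤ C * Real.sqrt (1 - σ) := by
      have h3 := h 0
      rw [Real.cosh_zero, ← hsq, ← mul_pow] at h3
      exact (one_le_sq_iff₀ (by positivity)).mp h3
    rcases min_cases 1 (Real.sqrt (1 - σ)) with ⟨h3, -⟩ | ⟨h3, -⟩ <;> rw [h3]
    · linarith
    · exact a2
  · intro h τ
    have a1 : 1 ≤ C := h.trans ((mul_le_mul_of_nonneg_left (min_le_left _ _) hC).trans_eq
      (mul_one C))
    have a2 : 1 ≤ C * Real.sqrt (1 - σ) :=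
      h.trans (mul_le_mul_of_nonneg_left (min_le_right _ _) hC)
    have b1 : 1 ≤ C ^ 2 := one_le_pow₀ a1
    have b2 : 1 ≤ C ^ 2 * (1 - σ) := by
      rw [← hsq, ← mul_pow]
      exact one_le_pow₀ a2
    nlinarith [Real.one_le_cosh τ, mul_nonneg (sub_nonneg.mpr b1)
      (sub_nonneg.mpr (Real.one_le_cosh τ))]

theorem sin_pi_mul_eq_one_iff (ν : ℝ) :
    Real.sin (Real.pi * ν) = 1 ↔ ∃ k : ℤ, ν = 2 * (k : ℝ) + 1 / 2 := by
  rw [Real.sin_eq_one_iff]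
  refine exists_congr fun k => ⟨fun h => ?_, fun h => ?_⟩
  · refine mul_left_cancel₀ Real.pi_pos.ne' ?_
    linarith
  · rw [h]; ring

theorem isBoundedOp_iff (ν : ℝ) :
    IsBoundedOp (opL2 (ν : ℂ)) ↔ ∀ k : ℤ, ν ≠ 2 * (k : ℝ) + 1 / 2 := by
  rw [← not_exists, ← sin_pi_mul_eq_one_iff]
  have hex : IsBoundedOp (opL2 (ν : ℂ)) ↔
      ∃ C : ℝ, 0 ≤ C ∧ LineBound (Real.sin (Real.pi * ν)) C := by
    constructor
    · rintro ⟨C, hC⟩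
      refine ⟨max C 0, le_max_right _ _, ?_⟩
      rw [← opNorm_opL2_le_iff ν (le_max_right _ _), opNorm_le_iff _ (le_max_right _ _)]
      exact fun f => (hC f).trans (mul_le_mul_of_nonneg_right (le_max_left _ _) (norm_nonneg _))
    · rintro ⟨C, hC, h⟩
      rw [← opNorm_opL2_le_iff ν hC, opNorm_le_iff _ hC] at h
      exact ⟨C, h⟩
  rw [hex]
  constructor
  · rintro ⟨C, -, h⟩ h1
    have h2 := h 0
    rw [h1, Real.cosh_zero] at h2
    norm_num at h2
  · intro h
    have h1 := lt_of_le_of_ne (Real.sin_le_one (Real.pi * ν)) h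
    have h0 : 0 ≤ 1 / min 1 (Real.sqrt (1 - Real.sin (Real.pi * ν))) :=
      div_nonneg zero_le_one (le_min zero_le_one (Real.sqrt_nonneg _))
    exact ⟨_, h0, (lineBound_iff h1 (Real.neg_one_le_sin _) h0).mpr le_rfl⟩

end BuschmanErdelyi

theorem mainTheorem1 :
    -- action under the Mellin transform
    (∀ ν s : ℂ, s.re < min (2 + ν.re) (1 - ν.re) →
      ∀ f : ℝ → ℂ, MellinConvergent f s →
        BuschmanErdelyi.Admissible ν f ∧
        MellinConvergent (BuschmanErdelyi.opS ν f) s ∧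
        mellin (BuschmanErdelyi.opS ν f) s = BuschmanErdelyi.multiplier ν s * mellin f s) ∧
    -- the operator is densely defined, and everywhere defined for `-3/2 < ν < 1/2`
    (∀ ν : ℝ, Dense ((BuschmanErdelyi.opL2 (ν : ℂ)).domain : Set BuschmanErdelyi.L2)) ∧
    (∀ ν : ℝ, -3 / 2 < ν → ν < 1 / 2 → (BuschmanErdelyi.opL2 (ν : ℂ)).domain = ⊤) ∧
    -- its norm
    Function.Periodic (fun ν : ℝ => BuschmanErdelyi.opNorm (BuschmanErdelyi.opL2 (ν : ℂ))) 2 ∧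
    (∀ ν : ℝ, (∀ k : ℤ, ν ≠ 2 * (k : ℝ) + 1 / 2) →
      BuschmanErdelyi.opNorm (BuschmanErdelyi.opL2 (ν : ℂ)) =
        ENNReal.ofReal (1 / min 1 (Real.sqrt (1 - Real.sin (Real.pi * ν))))) ∧
    -- boundedness
    (∀ ν : ℝ, BuschmanErdelyi.IsBoundedOp (BuschmanErdelyi.opL2 (ν : ℂ)) ↔
      ∀ k : ℤ, ν ≠ 2 * (k : ℝ) + 1 / 2) := by
  refine ⟨BuschmanErdelyi.mellin_opS, fun ν => ?_, fun ν h1 h2 => ?_, fun ν => ?_, fun ν hν => ?_,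
    BuschmanErdelyi.isBoundedOp_iff⟩
  · exact (BuschmanErdelyi.normCriterion ν).dense.mono fun f hf => hf.1
  · exact BuschmanErdelyi.domainS_eq_top (ν := (ν : ℂ)) h1 h2
  · refine BuschmanErdelyi.eq_of_forall_le_ofReal_iff fun C hC => ?_
    rw [BuschmanErdelyi.opNorm_opL2_le_iff _ hC, BuschmanErdelyi.opNorm_opL2_le_iff _ hC,
      ← BuschmanErdelyi.sin_pi_mul_sub_two (ν + 2), add_sub_cancel_right]
  · refine BuschmanErdelyi.eq_of_forall_le_ofReal_iff fun C hC => ?_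
    have h1 := lt_of_le_of_ne (Real.sin_le_one (Real.pi * ν)) fun h => by
      obtain ⟨k, hk⟩ := (BuschmanErdelyi.sin_pi_mul_eq_one_iff ν).mp h
      exact hν k hk
    rw [BuschmanErdelyi.opNorm_opL2_le_iff ν hC,
      BuschmanErdelyi.lineBound_iff h1 (Real.neg_one_le_sin _) hC,
      ENNReal.ofReal_le_ofReal_iff hC]
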